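/- **Setting.** Let $D\subset\mathbb C^n$ be a domain (nonempty, open, connected), $h=h_{i\bar j}(z)\,dz^i\otimes d\bar z^j$ a smooth Hermitian metric on $D$, $W=W^i\,\partial/\partial z^i$ a smooth vector field and $f=\|u\|_h:D\to\mathbb R$ a smooth function with $0<\|W\|_h<\|u\|_h\le 1$ on $D$. Put $$\tilde\varepsilon=\|u\|_h^2-\|W\|_h^2,\qquad W_i=h_{i\bar j}\overline{W^j},\qquad a_{i\bar j}=\frac{h_{i\bar j}}{\tilde\varepsilon}+\frac{W_i}{\tilde\varepsilon}\frac{\overline{W_j}}{\tilde\varepsilon},\qquad b_i=\frac{W_i}{\tilde\varepsilon},$$ $$F(z,\eta)=\sqrt{a_{i\bar j}\eta^i\bar\eta^j}+|b_i\eta^i|.$$ $F$ is the complex Randers solution (case $\cos\varphi=-1$) of the generalized Zermelo navigation problem with data $(h,\|u\|_h,W)$. A Hermitian metric such as $h$ or $a$ is regarded as the complex Finsler metric $\eta\mapsto\sqrt{h_{i\bar j}\eta^i\bar\eta^j}$. **Notions.** A complex Finsler metric on $D$ is a continuous $X:D\times\mathbb C^n\to[0,\infty)$, smooth for $\eta\neq0$,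 zero only at $\eta=0$, with $X(z,\lambda\eta)=|\lambda|X(z,\eta)$ for $\lambda\in\mathbb C$ and with $g_{i\bar j}=\partial^2X^2/\partial\eta^i\partial\bar\eta^j$ positive definite for $\eta\ne0$. For such $X$ (and for $F$, where it is smooth) put $N^i_j=g^{\bar m i}\frac{\partial g_{l\bar m}}{\partial z^j}\eta^l$, $2G^i=N^i_j\eta^j$, $L^i_{jk}=\partial N^i_k/\partial\eta^j$, $T^i_{jk}=L^i_{jk}-L^i_{kj}$, $\theta^{*k}=g^{\bar mk}g_{h\bar p}\,\overline{T^p_{jm}}\,\eta^h\bar\eta^j$ and $\mathcal K_X(z,\eta)=-\frac4{X^4}g_{k\bar m}\frac{\partial G^k}{\partial\bar z^h}\bar\eta^h\bar\eta^m$ (holomorphic curvature). * $X$ is Kähler if $T^i_{jk}\eta^j=0$. $X$ is generalized Berwald if the $G^i$ are holomorphic in $\eta$; for $F$ this is required at all nonzero tangent vectors at which $F$ is smooth. * $X$ and $\tilde X$ are projectively related if there is a smooth complex valued $P$ on $D\times(\mathbb C^n\setminus0)$ with $\tilde G^i=G^i+\frac12(\tilde\theta^{*i}-\theta^{*i})+P\eta^i$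 for $\eta\neq0$. * A complex Finsler metric is locally Minkowski if around every point there is a holomorphic chart in which $g_{i\bar j}$ depends only on $\eta$. $X$ is locally projectively flat if it is projectively related to some locally Minkowski metric on $D$. **Corollary 4.12.** Suppose that $F$ is generalized Berwald. Then $$\bigl(h\text{ is Kähler and }a\text{ is locally projectively flat}\bigr)\iff\bigl(a\text{ is Kähler and }h\text{ is locally projectively flat}\bigr).$$ Moreover, either of these assertions implies that $a$ and $h$ are projectively related and, if $n\ge2$, that there are constants $c_1,c_2\in\mathbb R$ with $\mathcal K_h=c_1$ and $\mathcal K_a=c_2$ for all $z\in D$ and $\eta\neq0$, and, at every point of $D$, $$c_1=\frac{n\tilde\varepsilon+\|W\|_h^2}{n\tilde\varepsilon^2}\,c_2+\frac{2}{n\tilde\varepsilon}\,h^{\bar mj}\left(\frac1{\tilde\varepsilon}\frac{\partial\tilde\varepsilon}{\partial\bar z^m}\frac{\partial\tilde\varepsilon}{\partial z^j}-\frac{\partial^2\tilde\varepsilon}{\partial\bar z^m\partial z^j}\right).$$ -/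

import Mathlib

open scoped ContDiff ComplexOrder

namespace ComplexFinsler

noncomputable section

/-! ### Wirtinger derivatives on `ℂⁿ`

`Fin n → ℂ` is used only through its (real and complex) differentiable structure, which does not
depend on the choice of a norm. -/

/-- `∂f/∂zᵏ = ½ (∂f/∂xᵏ - i ∂f/∂yᵏ)` at `z`. -/
def dz {n : ℕ} (f : (Fin n → ℂ) → ℂ) (k : Fin n) (z : Fin n → ℂ) : ℂ :=
  (1 / 2 : ℂ) * (fderiv ℝ f z (Pi.single k 1) - Complex.I * fderiv ℝ f z (Pi.single k Complex.I))

/-- `∂f/∂z̄ᵏ = ½ (∂f/∂xᵏ + i ∂f/∂yᵏ)` at `z`. -/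
def dzbar {n : ℕ} (f : (Fin n → ℂ) → ℂ) (k : Fin n) (z : Fin n → ℂ) : ℂ :=
  (1 / 2 : ℂ) * (fderiv ℝ f z (Pi.single k 1) + Complex.I * fderiv ℝ f z (Pi.single k Complex.I))

/-! ### Complex Finsler geometry on a domain of `ℂⁿ`

A metric is a function `F z η` of the base point `z` and the tangent vector `η`; the holomorphic
tangent bundle of `D ⊆ ℂⁿ` is `D × ℂⁿ`. -/

/-- The holomorphic tangent bundle of `D` without its zero section. -/
def slitBundle {n : ℕ} (D : Set (Fin n → ℂ)) : Set ((Fin n → ℂ) × (Fin n → ℂ)) :=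
  {p | p.1 ∈ D ∧ p.2 ≠ 0}

/-- The fundamental tensor `g_{i j̄} = ∂²F² / ∂ηⁱ ∂η̄ʲ`; the row index is `i`, the column index
is `j̄`. -/
def fundamentalTensor {n : ℕ} (F : (Fin n → ℂ) → (Fin n → ℂ) → ℝ) (z η : Fin n → ℂ) :
    Matrix (Fin n) (Fin n) ℂ :=
  Matrix.of fun i j => dz (fun ξ => dzbar (fun ζ => ((F z ζ ^ 2 : ℝ) : ℂ)) j ξ) i η

/-- The coefficients `N^i_j = g^{m̄ i} (∂g_{l m̄}/∂zʲ) ηˡ` of the Chern-Finsler complex nonlinear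
connection; `g^{m̄ i}` is the `(m, i)` entry of the inverse matrix. -/
def chernFinsler {n : ℕ} (F : (Fin n → ℂ) → (Fin n → ℂ) → ℝ) (z η : Fin n → ℂ)
    (i j : Fin n) : ℂ :=
  ∑ m, ∑ l, (fundamentalTensor F z η)⁻¹ m i * dz (fun w => fundamentalTensor F w η l m) j z * η l

/-- The spray coefficients `Gⁱ`, where `2 Gⁱ = N^i_j ηʲ`. -/
def spray {n : ℕ} (F : (Fin n → ℂ) → (Fin n → ℂ) → ℝ) (z η : Fin n → ℂ) (i : Fin n) : ℂ :=
  (1 / 2 : ℂ) * ∑ j, chernFinsler F z η i j * η j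

/-- The horizontal coefficients `L^i_{jk} = ∂N^i_k / ∂ηʲ` of the Chern-Finsler connection. -/
def connectionCoeff {n : ℕ} (F : (Fin n → ℂ) → (Fin n → ℂ) → ℝ) (z η : Fin n → ℂ)
    (i j k : Fin n) : ℂ :=
  dz (fun ξ => chernFinsler F z ξ i k) j η

/-- The torsion `T^i_{jk} = L^i_{jk} - L^i_{kj}`. -/
def torsion {n : ℕ} (F : (Fin n → ℂ) → (Fin n → ℂ) → ℝ) (z η : Fin n → ℂ)
    (i j k : Fin n) : ℂ :=
  connectionCoeff F z η i j k - connectionCoeff F z η i k j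

/-- `θ*ᵏ = g^{m̄ k} g_{h p̄} (L^{p̄}_{j̄ m̄} - L^{p̄}_{m̄ j̄}) ηʰ η̄ʲ`, the right-hand side of the
geodesic equation `γ̈ᵏ + 2 Gᵏ(γ, γ̇) = θ*ᵏ(γ, γ̇)`. -/
def thetaStar {n : ℕ} (F : (Fin n → ℂ) → (Fin n → ℂ) → ℝ) (z η : Fin n → ℂ) (k : Fin n) : ℂ :=
  ∑ m, ∑ h, ∑ p, ∑ j, (fundamentalTensor F z η)⁻¹ m k * fundamentalTensor F z η h p *
    star (torsion F z η p j m) * η h * star (η j)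

/-- The holomorphic curvature of `F` in direction `η`:
`K_F(z, η) = -(4 / F⁴) g_{k m̄} (∂Gᵏ/∂z̄ʰ) η̄ʰ η̄ᵐ`. -/
def holCurvature {n : ℕ} (F : (Fin n → ℂ) → (Fin n → ℂ) → ℝ) (z η : Fin n → ℂ) : ℂ :=
  -(4 / (F z η : ℂ) ^ 4) * ∑ k, ∑ m, ∑ h, fundamentalTensor F z η k m *
    dzbar (fun w => spray F w η k) h z * star (η h) * star (η m)

/-- `F` is a complex Finsler metric on `D`. -/
structure IsComplexFinsler {n : ℕ} (D : Set (Fin n → ℂ))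
    (F : (Fin n → ℂ) → (Fin n → ℂ) → ℝ) : Prop where
  continuousOn : ContinuousOn (Function.uncurry F) (D ×ˢ Set.univ)
  smooth : ContDiffOn ℝ ∞ (Function.uncurry F) (slitBundle D)
  nonneg : ∀ z ∈ D, ∀ η, 0 ≤ F z η
  eq_zero_iff : ∀ z ∈ D, ∀ η, F z η = 0 ↔ η = 0
  homogeneous : ∀ z ∈ D, ∀ (c : ℂ) (η : Fin n → ℂ), F z (c • η) = ‖c‖ * F z η
  posDef : ∀ z ∈ D, ∀ η, η ≠ 0 → (fundamentalTensor F z η).PosDef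

/-- `F` is Kähler on `D`: `T^i_{jk} ηʲ = 0`. -/
def IsKahler {n : ℕ} (D : Set (Fin n → ℂ)) (F : (Fin n → ℂ) → (Fin n → ℂ) → ℝ) : Prop :=
  ∀ z ∈ D, ∀ η, η ≠ 0 → ∀ i k, ∑ j, torsion F z η i j k * η j = 0

/-- `F` is generalized Berwald on `D`: the spray coefficients are holomorphic in `η`. The condition
is imposed at the nonzero tangent vectors at which `F` is smooth: these are all of them for a
complex Finsler metric, and those with `β(z, η) ≠ 0` for a complex Randers metric `α + |β|`. -/
def IsGeneralizedBerwald {n : ℕ} (D : Set (Fin n → ℂ))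
    (F : (Fin n → ℂ) → (Fin n → ℂ) → ℝ) : Prop :=
  ∀ z ∈ D, ∀ η, η ≠ 0 → ContDiffAt ℝ ∞ (Function.uncurry F) (z, η) →
    ∀ i, DifferentiableAt ℂ (fun ξ => spray F z ξ i) η

/-- `F` and `F'` are projectively related on `D`: there is a projective change
`G'ⁱ = Gⁱ + Bⁱ + P ηⁱ`, where `Bⁱ = ½ (θ'*ⁱ - θ*ⁱ)` and `P` is a smooth complex valued function
on the slit tangent bundle. -/
def IsProjectivelyRelated {n : ℕ} (D : Set (Fin n → ℂ))
    (F F' : (Fin n → ℂ) → (Fin n → ℂ) → ℝ) : Prop :=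
  ∃ P : (Fin n → ℂ) → (Fin n → ℂ) → ℂ,
    ContDiffOn ℝ ∞ (Function.uncurry P) (slitBundle D) ∧
    ∀ z ∈ D, ∀ η, η ≠ 0 → ∀ i,
      spray F' z η i =
        spray F z η i + (1 / 2 : ℂ) * (thetaStar F' z η i - thetaStar F z η i) + P z η * η i

/-- The expression of `F` in the chart `e` of `ℂⁿ`, as a function of the chart coordinates `w` and
of the induced fibre coordinates `ξ`. -/
def inChart {n : ℕ} (F : (Fin n → ℂ) → (Fin n → ℂ) → ℝ)
    (e : OpenPartialHomeomorph (Fin n → ℂ) (Fin n → ℂ)) (w ξ : Fin n → ℂ) : ℝ :=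
  F (e.symm w) (fderiv ℂ e.symm w ξ)

/-- `F` is a locally Minkowski complex Finsler metric on `D`: around every point there is a
holomorphic chart in which the fundamental tensor depends only on the fibre coordinates. -/
def IsLocallyMinkowski {n : ℕ} (D : Set (Fin n → ℂ))
    (F : (Fin n → ℂ) → (Fin n → ℂ) → ℝ) : Prop :=
  IsComplexFinsler D F ∧
  ∀ p ∈ D, ∃ e : OpenPartialHomeomorph (Fin n → ℂ) (Fin n → ℂ),
    p ∈ e.source ∧ e.source ⊆ D ∧
    DifferentiableOn ℂ e e.source ∧ DifferentiableOn ℂ e.symm e.target ∧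
    ∀ w ∈ e.target, ∀ w' ∈ e.target, ∀ ξ, ξ ≠ 0 →
      fundamentalTensor (inChart F e) w ξ = fundamentalTensor (inChart F e) w' ξ

/-- `F` is locally projectively flat on `D`: it is projectively related to a locally Minkowski
metric on `D`. -/
def IsLocallyProjectivelyFlat {n : ℕ} (D : Set (Fin n → ℂ))
    (F : (Fin n → ℂ) → (Fin n → ℂ) → ℝ) : Prop :=
  ∃ F' : (Fin n → ℂ) → (Fin n → ℂ) → ℝ, IsLocallyMinkowski D F' ∧ IsProjectivelyRelated D F' F

/-! ### Hermitian metrics and generalized navigation data -/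

/-- `h(η, ζ̄) = h_{i j̄}(z) ηⁱ ζ̄ʲ`. -/
def hermitianForm {n : ℕ} (h : (Fin n → ℂ) → Matrix (Fin n) (Fin n) ℂ) (z η ζ : Fin n → ℂ) : ℂ :=
  ∑ i, ∑ j, h z i j * η i * star (ζ j)

/-- `‖η‖_h = √(h_{i j̄}(z) ηⁱ η̄ʲ)`, the Hermitian metric `h` as a complex Finsler metric. -/
def hermitianNorm {n : ℕ} (h : (Fin n → ℂ) → Matrix (Fin n) (Fin n) ℂ) (z η : Fin n → ℂ) : ℝ :=
  √(hermitianForm h z η η).re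

/-- `h` is a smooth Hermitian metric on `D`. -/
structure IsHermitianMetric {n : ℕ} (D : Set (Fin n → ℂ))
    (h : (Fin n → ℂ) → Matrix (Fin n) (Fin n) ℂ) : Prop where
  smooth : ∀ i j, ContDiffOn ℝ ∞ (fun z => h z i j) D
  posDef : ∀ z ∈ D, (h z).PosDef

/-- Generalized navigation data `(h, ‖u‖_h, W)` on `D` in the complex Randers case: a background
Hermitian metric `h`, the ship's own speed `f = ‖u‖_h` and the wind `W`, all of them smooth, with
`0 < ‖W‖_h < ‖u‖_h ≤ 1`. -/
structure IsRandersNavigationData {n : ℕ} (D : Set (Fin n → ℂ))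
    (h : (Fin n → ℂ) → Matrix (Fin n) (Fin n) ℂ) (f : (Fin n → ℂ) → ℝ)
    (W : (Fin n → ℂ) → (Fin n → ℂ)) : Prop where
  hermitian : IsHermitianMetric D h
  smooth_speed : ContDiffOn ℝ ∞ f D
  smooth_wind : ContDiffOn ℝ ∞ W D
  wind_pos : ∀ z ∈ D, 0 < hermitianNorm h z (W z)
  wind_lt_speed : ∀ z ∈ D, hermitianNorm h z (W z) < f z
  speed_le_one : ∀ z ∈ D, f z ≤ 1

/-- `ε̃ = ‖u‖_h² - ‖W‖_h²`. -/
def epsTilde {n : ℕ} (h : (Fin n → ℂ) → Matrix (Fin n) (Fin n) ℂ) (f : (Fin n → ℂ) → ℝ)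
    (W : (Fin n → ℂ) → (Fin n → ℂ)) (z : Fin n → ℂ) : ℝ :=
  f z ^ 2 - hermitianNorm h z (W z) ^ 2

/-- `W_i = h_{i j̄} W̄ʲ`. -/
def lowerWind {n : ℕ} (h : (Fin n → ℂ) → Matrix (Fin n) (Fin n) ℂ)
    (W : (Fin n → ℂ) → (Fin n → ℂ)) (z : Fin n → ℂ) (i : Fin n) : ℂ :=
  ∑ j, h z i j * star (W z j)

/-- The new Hermitian metric `a_{i j̄} = h_{i j̄} / ε̃ + (W_i / ε̃) (W̄_j / ε̃)`. -/
def newMetric {n : ℕ} (h : (Fin n → ℂ) → Matrix (Fin n) (Fin n) ℂ) (f : (Fin n → ℂ) → ℝ)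
    (W : (Fin n → ℂ) → (Fin n → ℂ)) (z : Fin n → ℂ) : Matrix (Fin n) (Fin n) ℂ :=
  Matrix.of fun i j => h z i j / (epsTilde h f W z : ℂ) +
    lowerWind h W z i / (epsTilde h f W z : ℂ) * (star (lowerWind h W z j) / (epsTilde h f W z : ℂ))

/-- `β(z, η) = b_i ηⁱ` with the `(1,0)`-form `b_i = W_i / ε̃`. -/
def newForm {n : ℕ} (h : (Fin n → ℂ) → Matrix (Fin n) (Fin n) ℂ) (f : (Fin n → ℂ) → ℝ)
    (W : (Fin n → ℂ) → (Fin n → ℂ)) (z η : Fin n → ℂ) : ℂ :=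
  ∑ i, lowerWind h W z i / (epsTilde h f W z : ℂ) * η i

/-- The complex Randers solution `F = α + |β|` (`cos φ = -1`) of the generalized Zermelo navigation
problem with data `(h, f, W)`, where `α(z, η) = √(a_{i j̄} ηⁱ η̄ʲ)`. -/
def randersSolution {n : ℕ} (h : (Fin n → ℂ) → Matrix (Fin n) (Fin n) ℂ) (f : (Fin n → ℂ) → ℝ)
    (W : (Fin n → ℂ) → (Fin n → ℂ)) (z η : Fin n → ℂ) : ℝ :=
  hermitianNorm (newMetric h f W) z η + ‖newForm h f W z η‖

/-- The solution is the one given by Zermelo's formula with `Re h(η, W̄) = -|h(η, W̄)|`: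
`F(z, η) = (√(|h(η, W̄)|² + ‖η‖_h² ε̃) + |h(η, W̄)|) / ε̃`. -/
theorem randersSolution_eq {n : ℕ} (h : (Fin n → ℂ) → Matrix (Fin n) (Fin n) ℂ)
    (f : (Fin n → ℂ) → ℝ) (W : (Fin n → ℂ) → (Fin n → ℂ)) (z η : Fin n → ℂ)
    (hε : 0 < epsTilde h f W z) (hη : 0 ≤ (hermitianForm h z η η).re) :
    randersSolution h f W z η =
      (√(‖hermitianForm h z η (W z)‖ ^ 2 + hermitianNorm h z η ^ 2 * epsTilde h f W z) +
        ‖hermitianForm h z η (W z)‖) / epsTilde h f W z := by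
  have hsum : ∑ i, lowerWind h W z i * η i = hermitianForm h z η (W z) := by
    simp only [lowerWind, hermitianForm, Finset.sum_mul]
    exact Finset.sum_congr rfl fun i _ => Finset.sum_congr rfl fun j _ => by ring
  have hb : newForm h f W z η = hermitianForm h z η (W z) / (epsTilde h f W z : ℂ) := by
    rw [← hsum, Finset.sum_div]
    exact Finset.sum_congr rfl fun i _ => by ring
  have ha : hermitianForm (newMetric h f W) z η η =
      hermitianForm h z η η / (epsTilde h f W z : ℂ) +
        newForm h f W z η * star (newForm h f W z η) := by
    simp only [hermitianForm, newForm, newMetric, Matrix.of_apply, star_sum, Finset.sum_mul_sum,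
      Finset.sum_div, ← Finset.sum_add_distrib]
    refine Finset.sum_congr rfl fun i _ => Finset.sum_congr rfl fun j _ => ?_
    simp only [star_mul', star_div₀, Complex.star_def, Complex.conj_ofReal]
    ring
  have hre : (hermitianForm (newMetric h f W) z η η).re =
      (‖hermitianForm h z η (W z)‖ ^ 2 + hermitianNorm h z η ^ 2 * epsTilde h f W z) /
        epsTilde h f W z ^ 2 := by
    rw [ha, Complex.star_def, Complex.mul_conj, Complex.add_re, Complex.div_ofReal_re,
      Complex.ofReal_re, Complex.normSq_eq_norm_sq, hb, norm_div, Complex.norm_real,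
      Real.norm_of_nonneg hε.le, hermitianNorm, Real.sq_sqrt hη]
    field_simp
    ring
  rw [randersSolution, hermitianNorm, hre, Real.sqrt_div' _ (sq_nonneg _), Real.sqrt_sq hε.le, hb,
    norm_div, Complex.norm_real, Real.norm_of_nonneg hε.le, ← add_div]

end

end ComplexFinsler

open ComplexFinsler

/-! The equivalence rests on two independent facts.

(1) A locally projectively flat Hermitian metric k is Kähler. A locally Minkowski metric has θ* = 0
and the spray of a torsion free holomorphic linear connection Γ (`IsLocallyMinkowski.exists_coeff`).
The spray of k is quadratic in η while θ* has bidegree (1,1), so comparing the projective relation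
at η and at iη shows that θ* and the difference of the two sprays are separately multiples of η
(`exists_proportional`). Antisymmetry of the torsion gives k(θ*, η) = 0, hence θ* = 0, and then the
torsion vanishes (`dz_symm_of_thetaStar`).

(2) If F = α + |β| is generalized Berwald, then, Kähler or not, the sprays of h and a differ by a
linear form in η times η; for n ≥ 2 the form is ½ ∂ log ε̃ (`IsGeneralizedBerwald.christoffel_eq`).
Indeed F² is constant along the horizontal directions, which gives an equation α · U = |β| · V whose
brackets U, V involve the spray G of F and first derivatives of a and b. Restrict it to a complex
line η₀ + tζ with η₀ dual to β and β(ζ) = 0. There β is constant and α = √(p + q|t|²), while U and V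
are affine in t̄ with coefficients entire in t because G is holomorphic. Such a square root is not a
quotient of functions of that kind (`sqrt_norm_sq_rigidity`), so U = V = 0. Eliminating G leaves an
identity between the derivatives of a and b (`berwald_algebra`), and inserting it in the derivative
of h = ε̃ (a - b b*) compares the two sprays. In dimension one every vector is a multiple of η and
nothing is needed.

By (1) either assertion makes one metric Kähler by hypothesis and the other one by flatness. Then
both θ* vanish, and (2) says that a and h are projectively related and carries flatness from one to
the other.

For the curvature, write Γ[k] for the Chern connection of k. It differs from the holomorphic Γ by a
symmetrized ψ ⊗ id, so ∂̄Γ[k] is a symmetrized c ⊗ id. Symmetry of the Kähler curvature tensor gives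
c = κ k with κ real, Schur's lemma makes κ constant for n ≥ 2, and the holomorphic curvature is -4κ.
Applying ∂̄ to (2) and tracing with h relates the two values of κ. -/

namespace ComplexFinsler

open Metric Set Filter
open scoped Topology

/-! ### Holomorphic maps of several variables are smooth -/

section Holomorphic

variable {n : ℕ} {F : Type*} [NormedAddCommGroup F] [NormedSpace ℂ F] [CompleteSpace F]

/-- Cauchy's formula for a directional derivative. -/
theorem fderiv_apply_eq_cauchy {U : Set (Fin n → ℂ)} (hU : IsOpen U) {f : (Fin n → ℂ) → F}
    (hf : DifferentiableOn ℂ f U) {z v : Fin n → ℂ} {r : ℝ} (hr : 0 < r)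
    (hz : ∀ c ∈ closedBall (0 : ℂ) r, z + c • v ∈ U) :
    fderiv ℂ f z v =
      (2 * Real.pi * Complex.I : ℂ)⁻¹ • ∮ c in C(0, r), ((c - 0) ^ 2)⁻¹ • f (z + c • v) := by
  have hcont : Continuous fun c : ℂ => z + c • v := by fun_prop
  have hd : DifferentiableOn ℂ (fun c : ℂ => f (z + c • v)) ((fun c : ℂ => z + c • v) ⁻¹' U) :=
    hf.comp (by fun_prop) fun c hc => hc
  have key := Complex.two_pi_I_inv_smul_circleIntegral_sub_sq_inv_smul_of_differentiable
    (hU.preimage hcont) hz hd (mem_ball_self hr)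
  have hz0 : z ∈ U := by simpa using hz 0 (by simp [hr.le])
  have hder : HasDerivAt (fun c : ℂ => f (z + c • v)) (fderiv ℂ f z v) 0 := by
    have h1 : HasFDerivAt f (fderiv ℂ f z) (z + (0 : ℂ) • v) := by
      simpa using (hf.differentiableAt (hU.mem_nhds hz0)).hasFDerivAt
    have h2 : HasDerivAt (fun c : ℂ => z + c • v) v 0 := by
      simpa using ((hasDerivAt_id (0 : ℂ)).smul_const v).const_add z
    exact h1.comp_hasDerivAt (0 : ℂ) h2
  rw [← hder.deriv, ← key]

/-- A directional derivative of a holomorphic map is holomorphic. -/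
theorem differentiableOn_fderiv_apply [SecondCountableTopology F] {U : Set (Fin n → ℂ)} (hU : IsOpen U)
    {f : (Fin n → ℂ) → F} (hf : DifferentiableOn ℂ f U) (v : Fin n → ℂ) :
    DifferentiableOn ℂ (fun z => fderiv ℂ f z v) U := by
  intro z₀ hz₀
  refine DifferentiableAt.differentiableWithinAt ?_
  have hcf : ContinuousAt f z₀ := (hf.differentiableAt (hU.mem_nhds hz₀)).continuousAt
  obtain ⟨R, hR, hball⟩ : ∃ R > 0, ball z₀ R ⊆ U ∧ ∀ z ∈ ball z₀ R, dist (f z) (f z₀) < 1 := by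
    obtain ⟨R₁, h₁, hs₁⟩ := Metric.isOpen_iff.1 hU z₀ hz₀
    obtain ⟨R₂, h₂, hs₂⟩ := Metric.continuousAt_iff.1 hcf 1 one_pos
    exact ⟨min R₁ R₂, lt_min h₁ h₂, (ball_subset_ball (min_le_left _ _)).trans hs₁,
      fun z hz => hs₂ ((mem_ball.1 hz).trans_le (min_le_right _ _))⟩
  obtain ⟨hRU, hR1⟩ := hball
  -- The oscillation of f on the R-ball is below 2, so Schwarz's lemma on balls of radius R/2 bounds
  -- the derivative uniformly. This is the dominating function for differentiating under the
  -- integral.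
  have hbound : ∀ z ∈ ball z₀ (R / 2), ‖fderiv ℂ f z‖ ≤ 2 / (R / 2) := by
    intro z hz
    have hsub : ball z (R / 2) ⊆ ball z₀ R := ball_subset_ball' (by
      have := mem_ball.1 hz; linarith)
    refine Complex.norm_fderiv_le_div_of_mapsTo_ball (hf.mono (hsub.trans hRU)) ?_ (by positivity)
    intro w hw
    rw [mem_closedBall]
    have h1 := hR1 w (hsub hw)
    have h2 := hR1 z (hsub (mem_ball_self (by positivity)))
    linarith [dist_triangle_right (f w) (f z) (f z₀)]
  obtain ⟨r, hr, hrv⟩ : ∃ r > 0, r * ‖v‖ < R / 4 := by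
    -- The `+ 1` covers v = 0. The circle then stays within R/4 + R/4 = R/2 of z₀.
    refine ⟨R / 4 / (‖v‖ + 1), by positivity, ?_⟩
    rw [div_mul_eq_mul_div, div_lt_iff₀ (by positivity)]
    nlinarith [norm_nonneg v]
  have hmem : ∀ z ∈ ball z₀ (R / 4), ∀ c ∈ closedBall (0 : ℂ) r,
      z + c • v ∈ ball z₀ (R / 2) := by
    intro z hz c hc
    rw [mem_ball, dist_eq_norm] at hz ⊢
    have : ‖c • v‖ ≤ r * ‖v‖ := by
      rw [norm_smul]; exact mul_le_mul_of_nonneg_right (by simpa using hc) (norm_nonneg _)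
    calc ‖z + c • v - z₀‖ = ‖(z - z₀) + c • v‖ := by congr 1; abel
      _ ≤ ‖z - z₀‖ + ‖c • v‖ := norm_add_le _ _
      _ < R / 2 := by linarith
  have hhalf : ball z₀ (R / 2) ⊆ U := (ball_subset_ball (by linarith)).trans hRU
  have hcirc : ∀ t : ℝ, circleMap 0 r t ∈ closedBall (0 : ℂ) r := fun t => by
    simp [abs_of_pos hr]
  have hne : ∀ t : ℝ, circleMap 0 r t ≠ 0 := fun t => by
    exact circleMap_ne_center hr.ne'
  have hcoef : Continuous fun t : ℝ =>
      deriv (circleMap 0 r) t * ((circleMap 0 r t - 0) ^ 2)⁻¹ := by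
    refine Continuous.mul ?_ (Continuous.inv₀ ?_ ?_)
    · change Continuous fun t => deriv (circleMap 0 r) t
      simp only [deriv_circleMap]
      exact (continuous_circleMap 0 r).mul continuous_const
    · exact ((continuous_circleMap 0 r).sub continuous_const).pow 2
    · intro t; simpa using hne t
  have hlin : ∀ z ∈ ball z₀ (R / 4), Continuous fun t : ℝ => f (z + circleMap 0 r t • v) := by
    intro z hz
    refine continuous_iff_continuousAt.2 fun t => ?_
    have h1 := (hf.differentiableAt (hU.mem_nhds (hhalf (hmem z hz _ (hcirc t))))).continuousAt
    exact ContinuousAt.comp (f := fun t : ℝ => z + circleMap 0 r t • v) h1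
      (continuous_const.add ((continuous_circleMap 0 r).smul continuous_const)).continuousAt
  have key : HasFDerivAt (fun z => ∫ t in (0 : ℝ)..2 * Real.pi,
      (deriv (circleMap 0 r) t * ((circleMap 0 r t - 0) ^ 2)⁻¹) • f (z + circleMap 0 r t • v))
      (∫ t in (0 : ℝ)..2 * Real.pi, (deriv (circleMap 0 r) t * ((circleMap 0 r t - 0) ^ 2)⁻¹) •
        fderiv ℂ f (z₀ + circleMap 0 r t • v)) z₀ := by
    refine intervalIntegral.hasFDerivAt_integral_of_dominated_of_fderiv_le
      (F := fun z t => (deriv (circleMap 0 r) t * ((circleMap 0 r t - 0) ^ 2)⁻¹) •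
        f (z + circleMap 0 r t • v))
      (F' := fun z t => (deriv (circleMap 0 r) t * ((circleMap 0 r t - 0) ^ 2)⁻¹) •
        fderiv ℂ f (z + circleMap 0 r t • v)) (bound := fun t =>
        ‖deriv (circleMap 0 r) t * ((circleMap 0 r t - 0) ^ 2)⁻¹‖ * (2 / (R / 2)))
      (ball_mem_nhds z₀ (show 0 < R / 4 by positivity)) ?_ ?_ ?_ ?_ ?_ ?_
    · filter_upwards [ball_mem_nhds z₀ (show 0 < R / 4 by positivity)] with z hz
      exact (hcoef.smul (hlin z hz)).aestronglyMeasurable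
    · exact (hcoef.smul (hlin z₀ (mem_ball_self (by positivity)))).intervalIntegrable _ _
    · refine (hcoef.aestronglyMeasurable).smul ?_
      -- The derivative is not yet known to be continuous, so measurability along the circle comes
      -- from `measurable_fderiv`.
      borelize F
      have : Measurable fun t : ℝ => fderiv ℂ f (z₀ + circleMap 0 r t • v) :=
        (measurable_fderiv ℂ f).comp
          (continuous_const.add ((continuous_circleMap 0 r).smul continuous_const)).measurable
      exact this.aestronglyMeasurable
    · refine MeasureTheory.ae_of_all _ fun t _ z hz => ?_
      rw [norm_smul]
      exact mul_le_mul_of_nonneg_left (hbound _ (hmem z hz _ (hcirc t))) (norm_nonneg _)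
    · exact (hcoef.norm.mul continuous_const).intervalIntegrable _ _
    · refine MeasureTheory.ae_of_all _ fun t _ z hz => ?_
      have h1 := (hf.differentiableAt (hU.mem_nhds (hhalf (hmem z hz _ (hcirc t))))).hasFDerivAt
      have h2 : HasFDerivAt (fun x : Fin n → ℂ => x + circleMap 0 r t • v)
          (ContinuousLinearMap.id ℂ (Fin n → ℂ)) z := (hasFDerivAt_id z).add_const _
      have h3 := h1.comp z h2
      exact h3.const_smul (deriv (circleMap 0 r) t * ((circleMap 0 r t - 0) ^ 2)⁻¹)
  have hev : (fun z => fderiv ℂ f z v) =ᶠ[𝓝 z₀] fun z => (2 * Real.pi * Complex.I : ℂ)⁻¹ •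
      ∫ t in (0 : ℝ)..2 * Real.pi,
      (deriv (circleMap 0 r) t * ((circleMap 0 r t - 0) ^ 2)⁻¹) • f (z + circleMap 0 r t • v) := by
    filter_upwards [ball_mem_nhds z₀ (show 0 < R / 4 by positivity)] with z hz
    rw [fderiv_apply_eq_cauchy hU hf hr fun c hc => hhalf (hmem z hz c hc), circleIntegral]
    simp only [smul_smul]
  exact (key.differentiableAt.const_smul _).congr_of_eventuallyEq hev

/-- Holomorphic maps on open subsets of `ℂⁿ` are smooth. -/
theorem contDiffOn_of_differentiableOn [SecondCountableTopology F] {U : Set (Fin n → ℂ)} (hU : IsOpen U)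
    {f : (Fin n → ℂ) → F} (hf : DifferentiableOn ℂ f U) : ContDiffOn ℂ ∞ f U := by
  rw [contDiffOn_infty]
  intro m
  induction m generalizing f with
  | zero => exact contDiffOn_zero.2 hf.continuousOn
  | succ m ih =>
    -- Directional derivatives keep the target space F, so the induction only has to generalize f.
    rw [Nat.cast_succ, contDiffOn_succ_iff_fderiv_apply hU.uniqueDiffOn]
    refine ⟨hf, fun h => absurd h (by simp), fun y => ?_⟩
    exact (ih (differentiableOn_fderiv_apply hU hf y)).congr fun x hx => by
      rw [fderivWithin_of_isOpen hU hx]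

end Holomorphic

/-! ### Calculus of Wirtinger derivatives -/

section Wirtinger

variable {n : ℕ} {f g : (Fin n → ℂ) → ℂ} {z : Fin n → ℂ}

theorem single_I (k : Fin n) :
    (Pi.single k Complex.I : Fin n → ℂ) = Complex.I • Pi.single k 1 := by
  rw [← Pi.single_smul]; simp

theorem eq_sum_single (v : Fin n → ℂ) :
    v = ∑ k, ((v k).re • (Pi.single k 1 : Fin n → ℂ) +
      (v k).im • (Pi.single k Complex.I : Fin n → ℂ)) := by
  ext j
  simp only [Finset.sum_apply, Pi.add_apply, Pi.smul_apply, Pi.single_apply]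
  rw [Finset.sum_eq_single j]
  · simp [Complex.re_add_im]
  · intro b _ hb; simp [hb.symm]
  · simp

theorem fderiv_eq_sum (f : (Fin n → ℂ) → ℂ) (z v : Fin n → ℂ) :
    fderiv ℝ f z v = ∑ k, (v k * dz f k z + star (v k) * dzbar f k z) := by
  conv_lhs => rw [eq_sum_single v]
  rw [map_sum]
  refine Finset.sum_congr rfl fun k _ => ?_
  rw [map_add, map_smul, map_smul, Complex.real_smul, Complex.real_smul, dz, dzbar]
  conv_rhs => rw [← Complex.re_add_im (v k)]
  simp only [star_add, star_mul', Complex.star_def, Complex.conj_ofReal, Complex.conj_I]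
  linear_combination (fderiv ℝ f z (Pi.single k Complex.I) * (v k).im) * Complex.I_mul_I

/-- The (1,0) part of a real linear map is obtained by averaging it against multiplication by i.
This coordinate-free form yields the chain rule and Euler's identities without componentwise
computation. -/
theorem sum_dz_eq (f : (Fin n → ℂ) → ℂ) (z v : Fin n → ℂ) :
    ∑ k, v k * dz f k z =
      (1 / 2 : ℂ) * (fderiv ℝ f z v - Complex.I * fderiv ℝ f z (Complex.I • v)) := by
  rw [fderiv_eq_sum, fderiv_eq_sum, Finset.mul_sum, ← Finset.sum_sub_distrib, Finset.mul_sum]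
  refine Finset.sum_congr rfl fun k _ => ?_
  simp only [Pi.smul_apply, smul_eq_mul, star_mul', Complex.star_def, Complex.conj_I]
  linear_combination (1 / 2 * (v k * dz f k z - (starRingEnd ℂ) (v k) * dzbar f k z)) *
    Complex.I_mul_I

theorem sum_dzbar_eq (f : (Fin n → ℂ) → ℂ) (z v : Fin n → ℂ) :
    ∑ k, star (v k) * dzbar f k z =
      (1 / 2 : ℂ) * (fderiv ℝ f z v + Complex.I * fderiv ℝ f z (Complex.I • v)) := by
  rw [fderiv_eq_sum, fderiv_eq_sum, Finset.mul_sum, ← Finset.sum_add_distrib, Finset.mul_sum]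
  refine Finset.sum_congr rfl fun k _ => ?_
  simp only [Pi.smul_apply, smul_eq_mul, star_mul', Complex.star_def, Complex.conj_I]
  linear_combination (1 / 2 * (-v k * dz f k z + (starRingEnd ℂ) (v k) * dzbar f k z)) *
    Complex.I_mul_I

theorem dz_congr (hfg : f =ᶠ[𝓝 z] g) (k : Fin n) : dz f k z = dz g k z := by
  simp only [dz, hfg.fderiv_eq]

theorem dzbar_congr (hfg : f =ᶠ[𝓝 z] g) (k : Fin n) : dzbar f k z = dzbar g k z := by
  simp only [dzbar, hfg.fderiv_eq]

@[simp] theorem dz_const (c : ℂ) (k : Fin n) : dz (fun _ => c) k z = 0 := by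
  simp [dz]

@[simp] theorem dzbar_const (c : ℂ) (k : Fin n) : dzbar (fun _ => c) k z = 0 := by
  simp [dzbar]

theorem dz_add (hf : DifferentiableAt ℝ f z) (hg : DifferentiableAt ℝ g z) (k : Fin n) :
    dz (fun w => f w + g w) k z = dz f k z + dz g k z := by
  simp only [dz, fderiv_fun_add hf hg, _root_.add_apply]; ring

theorem dzbar_add (hf : DifferentiableAt ℝ f z) (hg : DifferentiableAt ℝ g z) (k : Fin n) :
    dzbar (fun w => f w + g w) k z = dzbar f k z + dzbar g k z := by
  simp only [dzbar, fderiv_fun_add hf hg, _root_.add_apply]; ring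

theorem dz_mul (hf : DifferentiableAt ℝ f z) (hg : DifferentiableAt ℝ g z) (k : Fin n) :
    dz (fun w => f w * g w) k z = dz f k z * g z + f z * dz g k z := by
  simp only [dz, fderiv_fun_mul hf hg, _root_.add_apply,
    _root_.smul_apply, smul_eq_mul]; ring

theorem dzbar_mul (hf : DifferentiableAt ℝ f z) (hg : DifferentiableAt ℝ g z) (k : Fin n) :
    dzbar (fun w => f w * g w) k z = dzbar f k z * g z + f z * dzbar g k z := by
  simp only [dzbar, fderiv_fun_mul hf hg, _root_.add_apply,
    _root_.smul_apply, smul_eq_mul]; ring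

theorem dz_const_mul (hf : DifferentiableAt ℝ f z) (c : ℂ) (k : Fin n) :
    dz (fun w => c * f w) k z = c * dz f k z := by
  rw [dz_mul (differentiableAt_const c) hf, dz_const]; ring

theorem dzbar_const_mul (hf : DifferentiableAt ℝ f z) (c : ℂ) (k : Fin n) :
    dzbar (fun w => c * f w) k z = c * dzbar f k z := by
  rw [dzbar_mul (differentiableAt_const c) hf, dzbar_const]; ring

theorem dz_mul_const (hf : DifferentiableAt ℝ f z) (c : ℂ) (k : Fin n) :
    dz (fun w => f w * c) k z = dz f k z * c := by
  rw [dz_mul hf (differentiableAt_const c), dz_const]; ring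

theorem dzbar_mul_const (hf : DifferentiableAt ℝ f z) (c : ℂ) (k : Fin n) :
    dzbar (fun w => f w * c) k z = dzbar f k z * c := by
  rw [dzbar_mul hf (differentiableAt_const c), dzbar_const]; ring

theorem dz_sub (hf : DifferentiableAt ℝ f z) (hg : DifferentiableAt ℝ g z) (k : Fin n) :
    dz (fun w => f w - g w) k z = dz f k z - dz g k z := by
  simp only [dz, fderiv_fun_sub hf hg, _root_.sub_apply]; ring

theorem dzbar_sub (hf : DifferentiableAt ℝ f z) (hg : DifferentiableAt ℝ g z) (k : Fin n) :
    dzbar (fun w => f w - g w) k z = dzbar f k z - dzbar g k z := by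
  simp only [dzbar, fderiv_fun_sub hf hg, _root_.sub_apply]; ring

theorem dz_sum {ι : Type*} {s : Finset ι} {f : ι → (Fin n → ℂ) → ℂ}
    (hf : ∀ i ∈ s, DifferentiableAt ℝ (f i) z) (k : Fin n) :
    dz (fun w => ∑ i ∈ s, f i w) k z = ∑ i ∈ s, dz (f i) k z := by
  simp only [dz, fderiv_fun_sum hf, _root_.sum_apply, Finset.mul_sum,
    ← Finset.sum_sub_distrib]

theorem dzbar_sum {ι : Type*} {s : Finset ι} {f : ι → (Fin n → ℂ) → ℂ}
    (hf : ∀ i ∈ s, DifferentiableAt ℝ (f i) z) (k : Fin n) :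
    dzbar (fun w => ∑ i ∈ s, f i w) k z = ∑ i ∈ s, dzbar (f i) k z := by
  simp only [dzbar, fderiv_fun_sum hf, _root_.sum_apply, Finset.mul_sum,
    ← Finset.sum_add_distrib]

theorem fderiv_star_apply (f : (Fin n → ℂ) → ℂ) (z v : Fin n → ℂ) :
    fderiv ℝ (fun w => star (f w)) z v = star (fderiv ℝ f z v) := by
  rw [fderiv_star]; rfl

theorem dz_star (f : (Fin n → ℂ) → ℂ) (k : Fin n) (z : Fin n → ℂ) :
    dz (fun w => star (f w)) k z = star (dzbar f k z) := by
  simp only [dz, dzbar, fderiv_star_apply]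
  simp; ring

theorem dzbar_star (f : (Fin n → ℂ) → ℂ) (k : Fin n) (z : Fin n → ℂ) :
    dzbar (fun w => star (f w)) k z = star (dz f k z) := by
  simp only [dz, dzbar, fderiv_star_apply]
  simp

theorem dzbar_eq_star_dz_of_real (f : (Fin n → ℂ) → ℝ) (k : Fin n) (z : Fin n → ℂ) :
    dzbar (fun w => (f w : ℂ)) k z = star (dz (fun w => (f w : ℂ)) k z) := by
  rw [← dzbar_star]; simp

theorem dz_of_hasFDerivAt {L : (Fin n → ℂ) →L[ℂ] ℂ} (hf : HasFDerivAt f L z) (k : Fin n) :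
    dz f k z = L (Pi.single k 1) := by
  rw [dz, (hf.restrictScalars ℝ).fderiv]
  simp only [ContinuousLinearMap.coe_restrictScalars']
  rw [single_I, map_smul, smul_eq_mul]
  linear_combination (-1 / 2 * L (Pi.single k 1)) * Complex.I_mul_I

theorem dzbar_of_differentiableAt (hf : DifferentiableAt ℂ f z) (k : Fin n) :
    dzbar f k z = 0 := by
  rw [dzbar, (hf.hasFDerivAt.restrictScalars ℝ).fderiv]
  simp only [ContinuousLinearMap.coe_restrictScalars']
  rw [single_I, map_smul, smul_eq_mul]
  linear_combination (1 / 2 * fderiv ℂ f z (Pi.single k 1)) * Complex.I_mul_I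

theorem dz_proj (i k : Fin n) : dz (fun w : Fin n → ℂ => w i) k z = if i = k then 1 else 0 := by
  rw [dz_of_hasFDerivAt (L := ContinuousLinearMap.proj i) (hasFDerivAt_apply i z)]
  simp [Pi.single_apply]

theorem dzbar_star_proj (i k : Fin n) :
    dzbar (fun w : Fin n → ℂ => star (w i)) k z = if i = k then 1 else 0 := by
  rw [dzbar_star, dz_proj]; split_ifs <;> simp

/-- Since the inner map is holomorphic, its derivative commutes with i and no conjugate derivatives
of f enter. -/
theorem dz_comp {φ : (Fin n → ℂ) → (Fin n → ℂ)} {J : (Fin n → ℂ) →L[ℂ] (Fin n → ℂ)}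
    (hf : DifferentiableAt ℝ f (φ z)) (hφ : HasFDerivAt φ J z) (k : Fin n) :
    dz (fun w => f (φ w)) k z = ∑ p, J (Pi.single k 1) p * dz f p (φ z) := by
  rw [sum_dz_eq, dz]
  have := (hf.hasFDerivAt.comp z (hφ.restrictScalars ℝ)).fderiv
  simp only [Function.comp_def] at this
  rw [this]
  simp only [ContinuousLinearMap.comp_apply, ContinuousLinearMap.coe_restrictScalars']
  rw [single_I, map_smul]

theorem dzbar_comp {φ : (Fin n → ℂ) → (Fin n → ℂ)} {J : (Fin n → ℂ) →L[ℂ] (Fin n → ℂ)}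
    (hf : DifferentiableAt ℝ f (φ z)) (hφ : HasFDerivAt φ J z) (k : Fin n) :
    dzbar (fun w => f (φ w)) k z = ∑ p, star (J (Pi.single k 1) p) * dzbar f p (φ z) := by
  rw [sum_dzbar_eq, dzbar]
  have := (hf.hasFDerivAt.comp z (hφ.restrictScalars ℝ)).fderiv
  simp only [Function.comp_def] at this
  rw [this]
  simp only [ContinuousLinearMap.comp_apply, ContinuousLinearMap.coe_restrictScalars']
  rw [single_I, map_smul]

/-! ### Smoothness and symmetry -/

theorem contDiffAt_dz (hf : ContDiffAt ℝ ∞ f z) (k : Fin n) : ContDiffAt ℝ ∞ (dz f k) z := by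
  have h := hf.fderiv_right (m := ∞) (by simp)
  exact contDiffAt_const.mul ((h.clm_apply contDiffAt_const).sub
    (contDiffAt_const.mul (h.clm_apply contDiffAt_const)))

theorem contDiffAt_dzbar (hf : ContDiffAt ℝ ∞ f z) (k : Fin n) :
    ContDiffAt ℝ ∞ (dzbar f k) z := by
  have h := hf.fderiv_right (m := ∞) (by simp)
  exact contDiffAt_const.mul ((h.clm_apply contDiffAt_const).add
    (contDiffAt_const.mul (h.clm_apply contDiffAt_const)))

theorem contDiffAt_dz_snd {Φ : (Fin n → ℂ) → (Fin n → ℂ) → ℂ} {η : Fin n → ℂ}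
    (hΦ : ContDiffAt ℝ ∞ (Function.uncurry Φ) (z, η)) (k : Fin n) :
    ContDiffAt ℝ ∞ (Function.uncurry fun w ξ => dz (Φ w) k ξ) (z, η) := by
  have h : ContDiffAt ℝ ∞ (fun p : (Fin n → ℂ) × (Fin n → ℂ) => fderiv ℝ (Φ p.1) p.2) (z, η) := by
    refine ContDiffAt.fderiv (n := ∞) (f := fun p : (Fin n → ℂ) × (Fin n → ℂ) => Φ p.1)
      ?_ contDiffAt_snd (by simp)
    exact hΦ.comp (((z, η), η) : ((Fin n → ℂ) × (Fin n → ℂ)) × (Fin n → ℂ))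
      ((contDiffAt_fst.fst).prodMk contDiffAt_snd)
  exact contDiffAt_const.mul ((h.clm_apply contDiffAt_const).sub
    (contDiffAt_const.mul (h.clm_apply contDiffAt_const)))

theorem contDiffAt_dzbar_snd {Φ : (Fin n → ℂ) → (Fin n → ℂ) → ℂ} {η : Fin n → ℂ}
    (hΦ : ContDiffAt ℝ ∞ (Function.uncurry Φ) (z, η)) (k : Fin n) :
    ContDiffAt ℝ ∞ (Function.uncurry fun w ξ => dzbar (Φ w) k ξ) (z, η) := by
  have h : ContDiffAt ℝ ∞ (fun p : (Fin n → ℂ) × (Fin n → ℂ) => fderiv ℝ (Φ p.1) p.2) (z, η) := by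
    refine ContDiffAt.fderiv (n := ∞) (f := fun p : (Fin n → ℂ) × (Fin n → ℂ) => Φ p.1)
      ?_ contDiffAt_snd (by simp)
    exact hΦ.comp (((z, η), η) : ((Fin n → ℂ) × (Fin n → ℂ)) × (Fin n → ℂ))
      ((contDiffAt_fst.fst).prodMk contDiffAt_snd)
  exact contDiffAt_const.mul ((h.clm_apply contDiffAt_const).add
    (contDiffAt_const.mul (h.clm_apply contDiffAt_const)))

theorem fderiv_dz_apply (hf : ContDiffAt ℝ ∞ f z) (k : Fin n) (v : Fin n → ℂ) :
    fderiv ℝ (dz f k) z v = (1 / 2 : ℂ) * (fderiv ℝ (fderiv ℝ f) z v (Pi.single k 1) -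
      Complex.I * fderiv ℝ (fderiv ℝ f) z v (Pi.single k Complex.I)) := by
  have h : HasFDerivAt (fderiv ℝ f) (fderiv ℝ (fderiv ℝ f) z) z :=
    ((hf.fderiv_right (m := ∞) (by simp)).differentiableAt (by simp)).hasFDerivAt
  have h1 := h.clm_apply (hasFDerivAt_const (Pi.single k 1 : Fin n → ℂ) z)
  have h2 := h.clm_apply (hasFDerivAt_const (Pi.single k Complex.I : Fin n → ℂ) z)
  have h3 := ((h1.sub (h2.const_mul Complex.I)).const_mul (1 / 2 : ℂ)).fderiv
  simp only [Pi.sub_def] at h3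
  rw [show dz f k = fun z => (1 / 2 : ℂ) * (fderiv ℝ f z (Pi.single k 1) -
    Complex.I * fderiv ℝ f z (Pi.single k Complex.I)) from rfl, h3]
  simp

theorem fderiv_dzbar_apply (hf : ContDiffAt ℝ ∞ f z) (k : Fin n) (v : Fin n → ℂ) :
    fderiv ℝ (dzbar f k) z v = (1 / 2 : ℂ) * (fderiv ℝ (fderiv ℝ f) z v (Pi.single k 1) +
      Complex.I * fderiv ℝ (fderiv ℝ f) z v (Pi.single k Complex.I)) := by
  have h : HasFDerivAt (fderiv ℝ f) (fderiv ℝ (fderiv ℝ f) z) z :=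
    ((hf.fderiv_right (m := ∞) (by simp)).differentiableAt (by simp)).hasFDerivAt
  have h1 := h.clm_apply (hasFDerivAt_const (Pi.single k 1 : Fin n → ℂ) z)
  have h2 := h.clm_apply (hasFDerivAt_const (Pi.single k Complex.I : Fin n → ℂ) z)
  have h3 := ((h1.add (h2.const_mul Complex.I)).const_mul (1 / 2 : ℂ)).fderiv
  simp only [Pi.add_def] at h3
  rw [show dzbar f k = fun z => (1 / 2 : ℂ) * (fderiv ℝ f z (Pi.single k 1) +
    Complex.I * fderiv ℝ f z (Pi.single k Complex.I)) from rfl, h3]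
  simp
  ring

theorem fderiv_fderiv_comm (hf : ContDiffAt ℝ ∞ f z) (v w : Fin n → ℂ) :
    fderiv ℝ (fderiv ℝ f) z v w = fderiv ℝ (fderiv ℝ f) z w v :=
  (hf.isSymmSndFDerivAt (by
    rw [minSmoothness_of_isRCLikeNormedField]; exact WithTop.coe_le_coe.2 le_top)) v w

theorem dzbar_dz_comm (hf : ContDiffAt ℝ ∞ f z) (j k : Fin n) :
    dzbar (dz f j) k z = dz (dzbar f k) j z := by
  rw [dzbar, dz, fderiv_dz_apply hf, fderiv_dz_apply hf, fderiv_dzbar_apply hf,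
    fderiv_dzbar_apply hf, fderiv_fderiv_comm hf (Pi.single j 1),
    fderiv_fderiv_comm hf (Pi.single j 1), fderiv_fderiv_comm hf (Pi.single j Complex.I),
    fderiv_fderiv_comm hf (Pi.single j Complex.I)]
  ring

theorem dzbar_dzbar_comm (hf : ContDiffAt ℝ ∞ f z) (j k : Fin n) :
    dzbar (dzbar f j) k z = dzbar (dzbar f k) j z := by
  rw [dzbar, dzbar, fderiv_dzbar_apply hf, fderiv_dzbar_apply hf, fderiv_dzbar_apply hf,
    fderiv_dzbar_apply hf, fderiv_fderiv_comm hf (Pi.single j 1),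
    fderiv_fderiv_comm hf (Pi.single j 1), fderiv_fderiv_comm hf (Pi.single j Complex.I),
    fderiv_fderiv_comm hf (Pi.single j Complex.I)]
  ring

/-! ### Euler's identities -/

theorem hasDerivAt_along {v : Fin n → ℂ} (hf : DifferentiableAt ℝ f z) :
    HasDerivAt (fun t : ℝ => f (z + t • v)) (fderiv ℝ f z v) 0 := by
  have h1 : HasFDerivAt f (fderiv ℝ f z) (z + (0 : ℝ) • v) := by simpa using hf.hasFDerivAt
  have h2 : HasDerivAt (fun t : ℝ => z + t • v) v 0 := by
    simpa using ((hasDerivAt_id (0 : ℝ)).smul_const v).const_add z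
  exact h1.comp_hasDerivAt (0 : ℝ) h2

theorem add_smul_eq (z : Fin n → ℂ) (c : ℂ) (t : ℝ) :
    z + t • (c • z) = (1 + (t : ℂ) * c) • z := by
  ext i; simp; ring

theorem hasDerivAt_one_add_mul (c : ℂ) :
    HasDerivAt (fun t : ℝ => 1 + (t : ℂ) * c) c 0 := by
  have h := ((Complex.ofRealCLM.hasDerivAt (x := 0)).mul_const c).const_add 1
  simpa using h

/-- Differentiate the homogeneity along t ↦ (1 + tc)z at t = 0. A complex c is allowed because
Euler's identity needs the differential at both z and iz. Nonzero scalars suffice, and for ∂̄F²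
homogeneity is only available there. -/
theorem fderiv_of_homogeneous_one (hf : DifferentiableAt ℝ f z)
    (hom : ∀ c : ℂ, c ≠ 0 → f (c • z) = c * f z) (c : ℂ) :
    fderiv ℝ f z (c • z) = c * f z := by
  have h := hasDerivAt_along (v := c • z) hf
  simp only [add_smul_eq] at h
  have h1 := hasDerivAt_one_add_mul c
  have hne : ∀ᶠ t : ℝ in 𝓝 0, 1 + (t : ℂ) * c ≠ 0 :=
    h1.continuousAt.eventually_ne (by simp)
  refine h.unique ((h1.mul_const (f z)).congr_of_eventuallyEq ?_)
  filter_upwards [hne] with t ht using hom _ ht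

theorem fderiv_of_homogeneous_two (hf : DifferentiableAt ℝ f z)
    (hom : ∀ c : ℂ, f (c • z) = c * star c * f z) (c : ℂ) :
    fderiv ℝ f z (c • z) = (c + star c) * f z := by
  have h := hasDerivAt_along (v := c • z) hf
  simp only [add_smul_eq, hom] at h
  have h1 := hasDerivAt_one_add_mul c
  have h3 := (h1.mul h1.star).mul_const (f z)
  have := h.unique h3
  rw [this]; simp

/-- Euler's identity for functions homogeneous of bidegree `(1, 0)`. -/
theorem sum_dz_of_homogeneous_one (hf : DifferentiableAt ℝ f z)
    (hom : ∀ c : ℂ, c ≠ 0 → f (c • z) = c * f z) : ∑ k, z k * dz f k z = f z := by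
  rw [sum_dz_eq, fderiv_of_homogeneous_one hf hom]
  have := fderiv_of_homogeneous_one hf hom 1
  rw [one_smul] at this
  rw [this]
  linear_combination (-1 / 2 * f z) * Complex.I_mul_I

theorem sum_dzbar_of_homogeneous_two (hf : DifferentiableAt ℝ f z)
    (hom : ∀ c : ℂ, f (c • z) = c * star c * f z) : ∑ k, star (z k) * dzbar f k z = f z := by
  rw [sum_dzbar_eq, fderiv_of_homogeneous_two hf hom]
  have := fderiv_of_homogeneous_two hf hom 1
  rw [one_smul] at this
  rw [this]
  simp
  ring

end Wirtinger

/-! ### Hermitian metrics as Finsler metrics: Chern connection, torsion, Kähler condition -/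

section Hermitian

variable {n : ℕ} {D : Set (Fin n → ℂ)} {k : (Fin n → ℂ) → Matrix (Fin n) (Fin n) ℂ}
  {z : Fin n → ℂ}

theorem dz_linear (c : Fin n → ℂ) (j : Fin n) (z : Fin n → ℂ) :
    dz (fun ζ => ∑ i, c i * ζ i) j z = c j := by
  rw [dz_sum fun i _ => by fun_prop]
  have (i : Fin n) : dz (fun ζ : Fin n → ℂ => c i * ζ i) j z = if i = j then c i else 0 := by
    rw [dz_const_mul (by fun_prop), dz_proj]; simp
  simp [this]

theorem dzbar_linear (c : Fin n → ℂ) (j : Fin n) (z : Fin n → ℂ) :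
    dzbar (fun ζ => ∑ i, c i * ζ i) j z = 0 :=
  dzbar_of_differentiableAt (by fun_prop) j

theorem dz_conjLinear (c : Fin n → ℂ) (j : Fin n) (z : Fin n → ℂ) :
    dz (fun ζ => ∑ i, c i * star (ζ i)) j z = 0 := by
  have := dz_star (fun ζ => ∑ i, star (c i) * ζ i) j z
  rw [dzbar_linear, star_zero] at this
  rw [← this]; simp

theorem differentiable_star_proj (i : Fin n) :
    Differentiable ℝ fun ζ : Fin n → ℂ => star (ζ i) := by
  have : Differentiable ℝ fun ζ : Fin n → ℂ => ζ i := by fun_prop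
  exact this.star

theorem differentiable_conjLinear (c : Fin n → ℂ) :
    Differentiable ℝ fun ζ : Fin n → ℂ => ∑ i, c i * star (ζ i) :=
  Differentiable.fun_sum fun i _ => (differentiable_star_proj i).const_mul _

theorem hermitianForm_eq_sum_mul (h : (Fin n → ℂ) → Matrix (Fin n) (Fin n) ℂ)
    (z η ζ : Fin n → ℂ) :
    hermitianForm h z η ζ = ∑ i, η i * ∑ j, h z i j * star (ζ j) := by
  simp only [hermitianForm, Finset.mul_sum]
  exact Finset.sum_congr rfl fun i _ => Finset.sum_congr rfl fun j _ => by ring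

theorem hermitianForm_eq_sum_mul' (h : (Fin n → ℂ) → Matrix (Fin n) (Fin n) ℂ)
    (z η ζ : Fin n → ℂ) :
    hermitianForm h z η ζ = ∑ j, (∑ i, h z i j * η i) * star (ζ j) := by
  simp only [hermitianForm, Finset.sum_mul]
  exact Finset.sum_comm

theorem dz_hermitianForm (h : (Fin n → ℂ) → Matrix (Fin n) (Fin n) ℂ) (z η : Fin n → ℂ)
    (j : Fin n) :
    dz (fun ζ => hermitianForm h z ζ ζ) j η = ∑ m, h z j m * star (η m) := by
  simp only [hermitianForm_eq_sum_mul]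
  rw [dz_sum fun i _ => DifferentiableAt.fun_mul (differentiableAt_apply i η)
    (differentiable_conjLinear (fun m => h z i m) η)]
  rw [Finset.sum_eq_single j]
  · rw [dz_mul (by fun_prop) (differentiable_conjLinear _ _), dz_conjLinear, dz_proj]; simp
  · intro i _ hi
    rw [dz_mul (by fun_prop) (differentiable_conjLinear _ _), dz_conjLinear, dz_proj]; simp [hi]
  · simp

theorem dzbar_hermitianForm (h : (Fin n → ℂ) → Matrix (Fin n) (Fin n) ℂ) (z η : Fin n → ℂ)
    (j : Fin n) :
    dzbar (fun ζ => hermitianForm h z ζ ζ) j η = ∑ l, h z l j * η l := by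
  simp only [hermitianForm_eq_sum_mul']
  have hd (i : Fin n) : DifferentiableAt ℝ (fun ζ : Fin n → ℂ => ∑ l, h z l i * ζ l) η := by
    fun_prop
  rw [dzbar_sum fun i _ => (hd i).fun_mul (differentiable_star_proj i η)]
  rw [Finset.sum_eq_single j]
  · rw [dzbar_mul (by fun_prop) (differentiable_star_proj _ _), dzbar_linear, dzbar_star_proj]
    simp
  · intro i _ hi
    rw [dzbar_mul (by fun_prop) (differentiable_star_proj _ _), dzbar_linear, dzbar_star_proj]
    simp [hi]
  · simp

theorem differentiable_hermitianForm (h : (Fin n → ℂ) → Matrix (Fin n) (Fin n) ℂ)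
    (z : Fin n → ℂ) : Differentiable ℝ fun ζ => hermitianForm h z ζ ζ := by
  simp only [hermitianForm_eq_sum_mul]
  exact Differentiable.fun_sum fun i _ =>
    Differentiable.mul (by fun_prop) (differentiable_conjLinear _)

theorem hermitianForm_star (hk : (k z).IsHermitian) (η ζ : Fin n → ℂ) :
    star (hermitianForm k z η ζ) = hermitianForm k z ζ η := by
  simp only [hermitianForm, star_sum, star_mul', star_star]
  rw [Finset.sum_comm]
  refine Finset.sum_congr rfl fun i _ => Finset.sum_congr rfl fun j _ => ?_
  rw [hk.apply i j]; ring

theorem hermitianForm_pos (hk : (k z).PosDef) {η : Fin n → ℂ} (hη : η ≠ 0) :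
    0 < hermitianForm k z η η := by
  have h := hk.dotProduct_mulVec_pos (x := star η) (by simpa using hη)
  convert h using 1
  simp only [hermitianForm, dotProduct, Matrix.mulVec, Pi.star_apply, star_star, Finset.mul_sum]
  exact Finset.sum_congr rfl fun i _ => Finset.sum_congr rfl fun j _ => by ring

theorem hermitianForm_re_pos (hk : (k z).PosDef) {η : Fin n → ℂ} (hη : η ≠ 0) :
    0 < (hermitianForm k z η η).re := (Complex.pos_iff.1 (hermitianForm_pos hk hη)).1

theorem hermitianForm_ofReal_re (hk : (k z).IsHermitian) (η : Fin n → ℂ) :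
    ((hermitianForm k z η η).re : ℂ) = hermitianForm k z η η :=
  Complex.conj_eq_iff_re.1 (hermitianForm_star hk η η)

@[simp] theorem hermitianForm_zero_left (η : Fin n → ℂ) : hermitianForm k z 0 η = 0 := by
  simp [hermitianForm]

theorem hermitianForm_re_nonneg (hk : (k z).PosDef) (η : Fin n → ℂ) :
    0 ≤ (hermitianForm k z η η).re := by
  rcases eq_or_ne η 0 with rfl | hη
  · simp
  · exact (hermitianForm_re_pos hk hη).le

theorem hermitianNorm_sq (hk : (k z).PosDef) (η : Fin n → ℂ) :
    ((hermitianNorm k z η ^ 2 : ℝ) : ℂ) = hermitianForm k z η η := by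
  rw [hermitianNorm, Real.sq_sqrt (hermitianForm_re_nonneg hk η),
    hermitianForm_ofReal_re hk.isHermitian]

theorem hermitianNorm_pos (hk : (k z).PosDef) {η : Fin n → ℂ} (hη : η ≠ 0) :
    0 < hermitianNorm k z η := Real.sqrt_pos.2 (hermitianForm_re_pos hk hη)

/-- Squaring removes the root, so F² is a sesquilinear form in η, and no exception is needed at η =
0. -/
theorem fundamentalTensor_hermitianNorm (hk : (k z).PosDef) (η : Fin n → ℂ) :
    fundamentalTensor (hermitianNorm k) z η = k z := by
  ext i j
  simp only [fundamentalTensor, Matrix.of_apply, hermitianNorm_sq hk, dzbar_hermitianForm,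
    dz_linear]

/-! ### The Chern connection of a Hermitian metric -/

/-- The connection coefficients `Γ^i_{jl} = k^{m̄ i} ∂k_{l m̄} / ∂zʲ`. -/
noncomputable def christoffel (k : (Fin n → ℂ) → Matrix (Fin n) (Fin n) ℂ) (z : Fin n → ℂ)
    (i j l : Fin n) : ℂ :=
  ∑ m, (k z)⁻¹ m i * dz (fun w => k w l m) j z

theorem sum_inv_mul {A : Matrix (Fin n) (Fin n) ℂ} (hA : IsUnit A) (i j : Fin n) :
    ∑ m, A⁻¹ i m * A m j = if i = j then 1 else 0 := by
  have := congrFun (congrFun (Matrix.nonsing_inv_mul A ((Matrix.isUnit_iff_isUnit_det A).1 hA)) i) j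
  simpa [Matrix.mul_apply, Matrix.one_apply] using this

theorem sum_mul_inv {A : Matrix (Fin n) (Fin n) ℂ} (hA : IsUnit A) (i j : Fin n) :
    ∑ m, A i m * A⁻¹ m j = if i = j then 1 else 0 := by
  have := congrFun (congrFun (Matrix.mul_nonsing_inv A ((Matrix.isUnit_iff_isUnit_det A).1 hA)) i) j
  simpa [Matrix.mul_apply, Matrix.one_apply] using this

theorem sum_inv_mul_sum {A : Matrix (Fin n) (Fin n) ℂ} (hA : IsUnit A) (x : Fin n → ℂ)
    (i : Fin n) : ∑ m, A⁻¹ m i * ∑ p, x p * A p m = x i := by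
  simp only [Finset.mul_sum]
  rw [Finset.sum_comm]
  calc ∑ p, ∑ m, A⁻¹ m i * (x p * A p m) = ∑ p, x p * ∑ m, A p m * A⁻¹ m i := by
        simp only [Finset.mul_sum]
        exact Finset.sum_congr rfl fun p _ => Finset.sum_congr rfl fun m _ => by ring
    _ = x i := by simp [sum_mul_inv hA]

theorem sum_sum_inv_mul {A : Matrix (Fin n) (Fin n) ℂ} (hA : IsUnit A) (y : Fin n → ℂ)
    (q : Fin n) : ∑ i, (∑ m, A⁻¹ m i * y m) * A i q = y q := by
  simp only [Finset.sum_mul]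
  rw [Finset.sum_comm]
  calc ∑ m, ∑ i, A⁻¹ m i * y m * A i q = ∑ m, y m * ∑ i, A⁻¹ m i * A i q := by
        simp only [Finset.mul_sum]
        exact Finset.sum_congr rfl fun p _ => Finset.sum_congr rfl fun m _ => by ring
    _ = y q := by simp [sum_inv_mul hA]

theorem sum_christoffel_mul (hk : (k z).PosDef) (j l m : Fin n) :
    ∑ i, christoffel k z i j l * k z i m = dz (fun w => k w l m) j z := by
  simp only [christoffel]
  exact sum_sum_inv_mul hk.isUnit (fun m => dz (fun w => k w l m) j z) m

theorem IsHermitianMetric.contDiffAt (hk : IsHermitianMetric D k) (hD : IsOpen D) (hz : z ∈ D)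
    (i j : Fin n) : ContDiffAt ℝ ∞ (fun w => k w i j) z :=
  (hk.smooth i j).contDiffAt (hD.mem_nhds hz)

theorem IsHermitianMetric.differentiableAt (hk : IsHermitianMetric D k) (hD : IsOpen D)
    (hz : z ∈ D) (i j : Fin n) : DifferentiableAt ℝ (fun w => k w i j) z :=
  (hk.contDiffAt hD hz i j).differentiableAt (by simp)

theorem contDiffAt_det {A : (Fin n → ℂ) → Matrix (Fin n) (Fin n) ℂ}
    (hA : ∀ i j, ContDiffAt ℝ ∞ (fun w => A w i j) z) : ContDiffAt ℝ ∞ (fun w => (A w).det) z := by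
  simp only [Matrix.det_apply]
  exact ContDiffAt.sum fun σ _ => (contDiffAt_prod fun i _ => hA _ _).const_smul _

theorem contDiffAt_inv_apply {A : (Fin n → ℂ) → Matrix (Fin n) (Fin n) ℂ}
    (hA : ∀ i j, ContDiffAt ℝ ∞ (fun w => A w i j) z) (hz : (A z).det ≠ 0) (i j : Fin n) :
    ContDiffAt ℝ ∞ (fun w => (A w)⁻¹ i j) z := by
  simp only [Matrix.inv_def, Matrix.smul_apply, Ring.inverse_eq_inv', smul_eq_mul,
    Matrix.adjugate_apply]
  refine ((contDiffAt_det hA).inv hz).mul (contDiffAt_det fun p q => ?_)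
  by_cases hp : p = j
  · subst hp; simpa using contDiffAt_const
  · simpa [Matrix.updateRow_ne hp] using hA p q

theorem IsHermitianMetric.contDiffAt_christoffel (hk : IsHermitianMetric D k) (hD : IsOpen D)
    (hz : z ∈ D) (i j l : Fin n) : ContDiffAt ℝ ∞ (fun w => christoffel k w i j l) z :=
  ContDiffAt.sum fun m _ => (contDiffAt_inv_apply (hk.contDiffAt hD hz)
    (hk.posDef z hz).det_pos.ne' m i).mul (contDiffAt_dz (hk.contDiffAt hD hz l m) j)

theorem chernFinsler_hermitianNorm (hk : IsHermitianMetric D k) (hD : IsOpen D) (hz : z ∈ D)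
    (η : Fin n → ℂ) (i j : Fin n) :
    chernFinsler (hermitianNorm k) z η i j = ∑ l, christoffel k z i j l * η l := by
  simp only [chernFinsler, fundamentalTensor_hermitianNorm (hk.posDef z hz), christoffel,
    Finset.sum_mul]
  rw [Finset.sum_comm]
  refine Finset.sum_congr rfl fun l _ => Finset.sum_congr rfl fun m _ => ?_
  congr 2
  refine dz_congr ?_ j
  filter_upwards [hD.mem_nhds hz] with w hw
  rw [fundamentalTensor_hermitianNorm (hk.posDef w hw)]

theorem spray_hermitianNorm (hk : IsHermitianMetric D k) (hD : IsOpen D) (hz : z ∈ D)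
    (η : Fin n → ℂ) (i : Fin n) :
    spray (hermitianNorm k) z η i =
      (1 / 2 : ℂ) * ∑ j, ∑ l, christoffel k z i j l * η l * η j := by
  simp only [spray, chernFinsler_hermitianNorm hk hD hz, Finset.sum_mul]

theorem torsion_hermitianNorm (hk : IsHermitianMetric D k) (hD : IsOpen D) (hz : z ∈ D)
    (η : Fin n → ℂ) (i j l : Fin n) :
    torsion (hermitianNorm k) z η i j l = christoffel k z i l j - christoffel k z i j l := by
  simp only [torsion, connectionCoeff, chernFinsler_hermitianNorm hk hD hz, dz_linear]

/-- The torsion of a Hermitian metric does not depend on η, so testing the contracted condition on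
basis vectors recovers every component. -/
theorem isKahler_iff_christoffel (hk : IsHermitianMetric D k) (hD : IsOpen D) :
    IsKahler D (hermitianNorm k) ↔
      ∀ z ∈ D, ∀ i j l, christoffel k z i j l = christoffel k z i l j := by
  constructor
  · intro H z hz i j l
    have := H z hz (Pi.single j 1) (by simp) i l
    simp only [torsion_hermitianNorm hk hD hz] at this
    simp only [Pi.single_apply, mul_ite, mul_one, mul_zero, Finset.sum_ite_eq', Finset.mem_univ,
      if_true] at this
    exact (sub_eq_zero.1 this).symm
  · intro H z hz η _ i l
    simp only [torsion_hermitianNorm hk hD hz]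
    exact Finset.sum_eq_zero fun j _ => by rw [H z hz i l j]; ring

theorem isKahler_iff_dz (hk : IsHermitianMetric D k) (hD : IsOpen D) :
    IsKahler D (hermitianNorm k) ↔
      ∀ z ∈ D, ∀ j l m, dz (fun w => k w l m) j z = dz (fun w => k w j m) l z := by
  rw [isKahler_iff_christoffel hk hD]
  constructor
  · intro H z hz j l m
    rw [← sum_christoffel_mul (hk.posDef z hz), ← sum_christoffel_mul (hk.posDef z hz)]
    exact Finset.sum_congr rfl fun i _ => by rw [H z hz]
  · intro H z hz i j l
    exact Finset.sum_congr rfl fun m _ => by rw [H z hz]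

theorem thetaStar_eq_zero_of_torsion {F : (Fin n → ℂ) → (Fin n → ℂ) → ℝ} {z η : Fin n → ℂ}
    (H : ∀ i j l, torsion F z η i j l = 0) (i : Fin n) : thetaStar F z η i = 0 := by
  simp [thetaStar, H]

theorem thetaStar_of_isKahler (hk : IsHermitianMetric D k) (hD : IsOpen D)
    (hK : IsKahler D (hermitianNorm k)) (hz : z ∈ D) (η : Fin n → ℂ) (i : Fin n) :
    thetaStar (hermitianNorm k) z η i = 0 :=
  thetaStar_eq_zero_of_torsion (fun i j l => by
    rw [torsion_hermitianNorm hk hD hz, (isKahler_iff_christoffel hk hD).1 hK z hz, sub_self]) i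

end Hermitian

/-! ### Euler identities for functions homogeneous of bidegree (1,1) -/

section Homogeneous

variable {n : ℕ} {L : (Fin n → ℂ) → ℂ} {η : Fin n → ℂ}

theorem hasFDerivAt_smul (c : ℂ) (η : Fin n → ℂ) :
    HasFDerivAt (fun w : Fin n → ℂ => c • w) (c • ContinuousLinearMap.id ℂ (Fin n → ℂ)) η :=
  (hasFDerivAt_id η).const_smul c

/-- Applying ∂̄ to L(cξ) = c c̄ L(ξ) produces a factor c̄ on the left, which cancels one on the
right; hence the restriction to c ≠ 0. -/
theorem dzbar_homogeneous (hL : DifferentiableAt ℝ L η)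
    (hom : ∀ (c : ℂ) (ξ : Fin n → ℂ), L (c • ξ) = c * star c * L ξ) (m : Fin n) (c : ℂ)
    (hc : c ≠ 0) : dzbar L m (c • η) = c * dzbar L m η := by
  have hd : DifferentiableAt ℝ L (c • η) := by
    have h1 : L = fun w => (c * star c) * L (c⁻¹ • w) := by
      funext w; rw [← hom, smul_inv_smul₀ hc]
    rw [h1]
    have h2 : DifferentiableAt ℝ L (c⁻¹ • (c • η)) := by rwa [inv_smul_smul₀ hc]
    exact (h2.comp (c • η) ((hasFDerivAt_smul c⁻¹ _).restrictScalars ℝ).differentiableAt).const_mul _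
  have h1 := dzbar_comp hd (hasFDerivAt_smul c η) m
  simp only [hom] at h1
  rw [dzbar_const_mul hL] at h1
  have h2 : ∑ p, star ((c • ContinuousLinearMap.id ℂ (Fin n → ℂ)) (Pi.single m 1) p) *
      dzbar L p (c • η) = star c * dzbar L m (c • η) := by
    rw [Finset.sum_eq_single m]
    · simp
    · intro p _ hp; simp [hp]
    · simp
  rw [h2] at h1
  have hc' : star c ≠ 0 := by simpa using hc
  apply mul_left_cancel₀ hc'
  rw [← h1]; ring

/-- Euler's identity for `∂̄L`. -/
theorem sum_mul_dz_dzbar (hL : ContDiffAt ℝ ∞ L η)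
    (hom : ∀ (c : ℂ) (ξ : Fin n → ℂ), L (c • ξ) = c * star c * L ξ) (m : Fin n) :
    ∑ i, η i * dz (dzbar L m) i η = dzbar L m η :=
  sum_dz_of_homogeneous_one ((contDiffAt_dzbar hL m).differentiableAt (by simp))
    (dzbar_homogeneous (hL.differentiableAt (by simp)) hom m)

theorem star_dz_dzbar {L : (Fin n → ℂ) → ℝ} (hL : ContDiffAt ℝ ∞ (fun ξ => (L ξ : ℂ)) η)
    (i m : Fin n) :
    star (dz (dzbar (fun ξ => (L ξ : ℂ)) m) i η) = dz (dzbar (fun ξ => (L ξ : ℂ)) i) m η := by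
  rw [← dzbar_star]
  have : (fun w => star (dzbar (fun ξ => (L ξ : ℂ)) m w)) = dz (fun ξ => (L ξ : ℂ)) m := by
    funext w; rw [dzbar_eq_star_dz_of_real, star_star]
  rw [this, dzbar_dz_comm hL]

theorem sum_star_mul_dz_dzbar {L : (Fin n → ℂ) → ℝ}
    (hL : ContDiffAt ℝ ∞ (fun ξ => (L ξ : ℂ)) η)
    (hom : ∀ (c : ℂ) (ξ : Fin n → ℂ), (L (c • ξ) : ℂ) = c * star c * L ξ) (i : Fin n) :
    ∑ m, star (η m) * dz (dzbar (fun ξ => (L ξ : ℂ)) m) i η = dz (fun ξ => (L ξ : ℂ)) i η := by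
  have h := congrArg star (sum_mul_dz_dzbar (L := fun ξ => (L ξ : ℂ)) hL hom i)
  rw [star_sum, dzbar_eq_star_dz_of_real, star_star] at h
  rw [← h]
  refine Finset.sum_congr rfl fun m _ => ?_
  rw [star_mul', star_dz_dzbar hL]

theorem eq_sum_dz_dzbar (hL : ContDiffAt ℝ ∞ L η)
    (hom : ∀ (c : ℂ) (ξ : Fin n → ℂ), L (c • ξ) = c * star c * L ξ) :
    L η = ∑ m, star (η m) * ∑ i, η i * dz (dzbar L m) i η := by
  simp only [sum_mul_dz_dzbar hL hom]
  exact (sum_dzbar_of_homogeneous_two (hL.differentiableAt (by simp)) fun c => hom c η).symm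

end Homogeneous

/-! ### The Chern-Finsler connection in terms of F² -/

section Finsler

variable {n : ℕ} {D : Set (Fin n → ℂ)} {F : (Fin n → ℂ) → (Fin n → ℂ) → ℝ} {z η : Fin n → ℂ}

/-- `F²` as a complex valued function. -/
noncomputable def energy (F : (Fin n → ℂ) → (Fin n → ℂ) → ℝ) (z ζ : Fin n → ℂ) : ℂ :=
  ((F z ζ ^ 2 : ℝ) : ℂ)

theorem fundamentalTensor_apply (F : (Fin n → ℂ) → (Fin n → ℂ) → ℝ) (z η : Fin n → ℂ)
    (i j : Fin n) : fundamentalTensor F z η i j = dz (dzbar (energy F z) j) i η := rfl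

theorem energy_homogeneous (hom : ∀ (c : ℂ) (ξ : Fin n → ℂ), F z (c • ξ) = ‖c‖ * F z ξ) (c : ℂ)
    (ξ : Fin n → ℂ) : energy F z (c • ξ) = c * star c * energy F z ξ := by
  have : c * star c = ((‖c‖ ^ 2 : ℝ) : ℂ) := by
    rw [Complex.star_def, Complex.mul_conj, Complex.normSq_eq_norm_sq]
  rw [energy, energy, hom, this, ← Complex.ofReal_mul, mul_pow]

theorem contDiffAt_energy_snd (hF : ContDiffAt ℝ ∞ (Function.uncurry (energy F)) (z, η)) :
    ContDiffAt ℝ ∞ (energy F z) η :=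
  hF.comp (f := fun ξ => (z, ξ)) η (contDiffAt_const.prodMk contDiffAt_id)

theorem differentiableAt_fundamentalTensor
    (hF : ContDiffAt ℝ ∞ (Function.uncurry (energy F)) (z, η)) (l m : Fin n) :
    DifferentiableAt ℝ (fun w => fundamentalTensor F w η l m) z := by
  have h := contDiffAt_dz_snd (contDiffAt_dzbar_snd hF m) l
  exact (h.comp (f := fun w => (w, η)) z (contDiffAt_id.prodMk contDiffAt_const)).differentiableAt
    (by simp)

/-- The Chern-Finsler connection in terms of `∂F²/∂η̄ᵐ`. -/
theorem chernFinsler_eq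
    (hF : ∀ᶠ w in 𝓝 z, ContDiffAt ℝ ∞ (Function.uncurry (energy F)) (w, η))
    (hom : ∀ᶠ w in 𝓝 z, ∀ (c : ℂ) (ξ : Fin n → ℂ), F w (c • ξ) = ‖c‖ * F w ξ) (i j : Fin n) :
    chernFinsler F z η i j =
      ∑ m, (fundamentalTensor F z η)⁻¹ m i * dz (fun w => dzbar (energy F w) m η) j z := by
  simp only [chernFinsler]
  refine Finset.sum_congr rfl fun m _ => ?_
  have h1 : (fun w => dzbar (energy F w) m η) =ᶠ[𝓝 z]
      fun w => ∑ l, fundamentalTensor F w η l m * η l := by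
    filter_upwards [hF, hom] with w hw hw'
    rw [← sum_mul_dz_dzbar (contDiffAt_energy_snd hw) (energy_homogeneous hw')]
    exact Finset.sum_congr rfl fun l _ => by rw [fundamentalTensor_apply]; ring
  rw [dz_congr h1, dz_sum fun l _ =>
    (differentiableAt_fundamentalTensor hF.self_of_nhds l m).mul_const _, Finset.mul_sum]
  refine Finset.sum_congr rfl fun l _ => ?_
  rw [dz_mul_const (differentiableAt_fundamentalTensor hF.self_of_nhds l m)]; ring

/-- `F²` is horizontally constant: `∂F²/∂zʲ = N^i_j ∂F²/∂ηⁱ`. -/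
theorem sum_chernFinsler_mul_dz
    (hF : ∀ᶠ w in 𝓝 z, ContDiffAt ℝ ∞ (Function.uncurry (energy F)) (w, η))
    (hom : ∀ᶠ w in 𝓝 z, ∀ (c : ℂ) (ξ : Fin n → ℂ), F w (c • ξ) = ‖c‖ * F w ξ)
    (hg : IsUnit (fundamentalTensor F z η)) (j : Fin n) :
    ∑ i, chernFinsler F z η i j * dz (energy F z) i η = dz (fun w => energy F w η) j z := by
  have hd (m : Fin n) : DifferentiableAt ℝ (fun w => dzbar (energy F w) m η) z :=
    ((contDiffAt_dzbar_snd hF.self_of_nhds m).comp (f := fun w => (w, η)) z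
      (contDiffAt_id.prodMk contDiffAt_const)).differentiableAt (by simp)
  have h1 : (fun w => energy F w η) =ᶠ[𝓝 z]
      fun w => ∑ m, star (η m) * dzbar (energy F w) m η := by
    filter_upwards [hF, hom] with w hw hw'
    exact (sum_dzbar_of_homogeneous_two ((contDiffAt_energy_snd hw).differentiableAt (by simp))
      fun c => energy_homogeneous hw' c η).symm
  rw [dz_congr h1, dz_sum fun m _ => (hd m).const_mul _]
  have h2 (i : Fin n) : dz (energy F z) i η = ∑ q, star (η q) * fundamentalTensor F z η i q :=
    (sum_star_mul_dz_dzbar (L := fun ξ => F z ξ ^ 2) (contDiffAt_energy_snd hF.self_of_nhds)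
      (energy_homogeneous hom.self_of_nhds) i).symm
  simp only [chernFinsler_eq hF hom, h2]
  calc _ = ∑ q, star (η q) * ∑ i, (∑ m, (fundamentalTensor F z η)⁻¹ m i *
        dz (fun w => dzbar (energy F w) m η) j z) * fundamentalTensor F z η i q := by
        simp only [Finset.mul_sum]
        rw [Finset.sum_comm]
        exact Finset.sum_congr rfl fun q _ => Finset.sum_congr rfl fun i _ => by
          simp only [Finset.sum_mul, Finset.mul_sum]
          exact Finset.sum_congr rfl fun _ _ => by ring
    _ = _ := by
        refine Finset.sum_congr rfl fun q _ => ?_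
        rw [sum_sum_inv_mul hg (fun m => dz (fun w => dzbar (energy F w) m η) j z) q,
          dz_const_mul (hd q)]

theorem isOpen_slitBundle (hD : IsOpen D) : IsOpen (slitBundle D) :=
  (hD.preimage continuous_fst).inter (isOpen_ne.preimage continuous_snd)

theorem IsComplexFinsler.contDiffAt_energy (hF : IsComplexFinsler D F) (hD : IsOpen D)
    (hz : z ∈ D) (hη : η ≠ 0) : ContDiffAt ℝ ∞ (Function.uncurry (energy F)) (z, η) := by
  have h := hF.smooth.contDiffAt ((isOpen_slitBundle hD).mem_nhds (x := (z, η)) ⟨hz, hη⟩)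
  exact Complex.ofRealCLM.contDiff.contDiffAt.comp (z, η) (h.pow 2)

end Finsler

/-! ### Locally Minkowski metrics as pullbacks of a fixed norm -/

section Minkowski

variable {n : ℕ} {D : Set (Fin n → ℂ)} {F : (Fin n → ℂ) → (Fin n → ℂ) → ℝ} {z η : Fin n → ℂ}

theorem fderiv_symm_fderiv {e : OpenPartialHomeomorph (Fin n → ℂ) (Fin n → ℂ)}
    (he : DifferentiableOn ℂ e e.source) (he' : DifferentiableOn ℂ e.symm e.target)
    (hz : z ∈ e.source) (v : Fin n → ℂ) : fderiv ℂ e.symm (e z) (fderiv ℂ e z v) = v := by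
  have h1 := (he.differentiableAt (e.open_source.mem_nhds hz)).hasFDerivAt
  have h2 := (he'.differentiableAt (e.open_target.mem_nhds (e.map_source hz))).hasFDerivAt
  have h3 := h2.comp z h1
  have h4 : HasFDerivAt (e.symm ∘ e) (ContinuousLinearMap.id ℂ (Fin n → ℂ)) z :=
    (hasFDerivAt_id z).congr_of_eventuallyEq (by
      filter_upwards [e.open_source.mem_nhds hz] with w hw using e.left_inv hw)
  exact congrArg (fun A : (Fin n → ℂ) →L[ℂ] (Fin n → ℂ) => A v) (h3.unique h4)

theorem fderiv_fderiv_symm {e : OpenPartialHomeomorph (Fin n → ℂ) (Fin n → ℂ)}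
    (he : DifferentiableOn ℂ e e.source) (he' : DifferentiableOn ℂ e.symm e.target)
    (hz : z ∈ e.source) (v : Fin n → ℂ) : fderiv ℂ e z (fderiv ℂ e.symm (e z) v) = v := by
  have := fderiv_symm_fderiv (e := e.symm) he' he (e.map_source hz) v
  simpa [e.left_inv hz] using this

/-- Euler's identity recovers F² from its fundamental tensor, so a tensor independent of the base
point forces the same of F². -/
theorem energy_inChart_eq {e : OpenPartialHomeomorph (Fin n → ℂ) (Fin n → ℂ)}
    (hF : IsComplexFinsler D F) (hD : IsOpen D) (hsub : e.source ⊆ D)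
    (he : DifferentiableOn ℂ e e.source) (he' : DifferentiableOn ℂ e.symm e.target)
    {w w' : Fin n → ℂ} (hw : w ∈ e.target) (hw' : w' ∈ e.target) {ξ : Fin n → ℂ} (hξ : ξ ≠ 0)
    (H : fundamentalTensor (inChart F e) w ξ = fundamentalTensor (inChart F e) w' ξ) :
    energy (inChart F e) w ξ = energy (inChart F e) w' ξ := by
  have key : ∀ u ∈ e.target, energy (inChart F e) u ξ =
      ∑ m, star (ξ m) * ∑ i, ξ i * fundamentalTensor (inChart F e) u ξ i m := by
    intro u hu
    have hu' : e.symm u ∈ e.source := e.map_target hu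
    have hne : fderiv ℂ e.symm u ξ ≠ 0 := by
      intro h0
      have := fderiv_fderiv_symm he he' hu' ξ
      rw [e.right_inv hu, h0, map_zero] at this
      exact hξ this.symm
    have h1 : ContDiffAt ℝ ∞ (energy (inChart F e) u) ξ :=
      (contDiffAt_energy_snd (hF.contDiffAt_energy hD (hsub hu') hne)).comp ξ
        ((fderiv ℂ e.symm u).restrictScalars ℝ).contDiff.contDiffAt
    refine eq_sum_dz_dzbar h1 (energy_homogeneous fun c ζ => ?_)
    simp only [inChart, map_smul, hF.homogeneous _ (hsub hu')]
  rw [key w hw, key w' hw', H]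

/-- A locally Minkowski metric is locally the pullback of a norm under a biholomorphic map `φ`;
`B z` is the inverse of the derivative of `φ`. -/
theorem IsLocallyMinkowski.exists_map (hF : IsLocallyMinkowski D F) (hD : IsOpen D) (hz : z ∈ D) :
    ∃ (U : Set (Fin n → ℂ)) (φ : (Fin n → ℂ) → (Fin n → ℂ))
      (B : (Fin n → ℂ) → (Fin n → ℂ) →L[ℂ] (Fin n → ℂ)), IsOpen U ∧ z ∈ U ∧ U ⊆ D ∧
      DifferentiableOn ℂ φ U ∧ (∀ v, DifferentiableOn ℂ (fun w => B w v) U) ∧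
      (∀ w ∈ U, ∀ v, B w (fderiv ℂ φ w v) = v) ∧ (∀ w ∈ U, ∀ v, fderiv ℂ φ w (B w v) = v) ∧
      ∀ w ∈ U, ∀ ζ, energy F w ζ = energy F z (fderiv ℂ φ w ζ) := by
  obtain ⟨hF, hch⟩ := hF
  obtain ⟨e, hze, hsub, he, he', H⟩ := hch z hz
  -- Composing the chart with the constant linear map D(e⁻¹)(e z) makes the derivative at z the
  -- identity, so that the model norm is F(z, ·) itself.
  have hφ : ∀ w ∈ e.source, HasFDerivAt (fun w => fderiv ℂ e.symm (e z) (e w))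
      ((fderiv ℂ e.symm (e z)).comp (fderiv ℂ e w)) w := fun w hw =>
    (fderiv ℂ e.symm (e z)).hasFDerivAt.comp w
      (he.differentiableAt (e.open_source.mem_nhds hw)).hasFDerivAt
  refine ⟨e.source, fun w => fderiv ℂ e.symm (e z) (e w),
    fun w => (fderiv ℂ e.symm (e w)).comp (fderiv ℂ e z), e.open_source, hze, hsub,
    fun w hw => (hφ w hw).differentiableAt.differentiableWithinAt, ?_, ?_, ?_, ?_⟩
  · intro v
    have := (differentiableOn_fderiv_apply e.open_target he' (fderiv ℂ e z v)).comp he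
      e.mapsTo
    exact this
  · intro w hw v
    rw [(hφ w hw).fderiv]
    simp only [ContinuousLinearMap.comp_apply]
    rw [fderiv_fderiv_symm he he' hze, fderiv_symm_fderiv he he' hw]
  · intro w hw v
    rw [(hφ w hw).fderiv]
    simp only [ContinuousLinearMap.comp_apply]
    rw [fderiv_fderiv_symm he he' hw, fderiv_symm_fderiv he he' hze]
  · intro w hw ζ
    rw [(hφ w hw).fderiv, ContinuousLinearMap.comp_apply]
    rcases eq_or_ne ζ 0 with rfl | hζ
    · simp only [map_zero, energy, (hF.eq_zero_iff w (hsub hw) 0).2 rfl,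
        (hF.eq_zero_iff z hz 0).2 rfl]
    · have hne : fderiv ℂ e w ζ ≠ 0 := by
        intro h0
        have := fderiv_symm_fderiv he he' hw ζ
        rw [h0, map_zero] at this
        exact hζ this.symm
      have h1 := energy_inChart_eq hF hD hsub he he' (e.map_source hw) (e.map_source hze) hne
        (H _ (e.map_source hw) _ (e.map_source hze) _ hne)
      simpa only [energy, inChart, e.left_inv hw, e.left_inv hze,
        fderiv_symm_fderiv he he' hw] using h1

end Minkowski

/-! ### The spray of a locally Minkowski metric comes from a flat holomorphic connection -/

section Coefficients

variable {n : ℕ} {D : Set (Fin n → ℂ)} {F : (Fin n → ℂ) → (Fin n → ℂ) → ℝ} {z η : Fin n → ℂ}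

theorem clm_apply_eq_sum (A : (Fin n → ℂ) →L[ℂ] (Fin n → ℂ)) (v : Fin n → ℂ) :
    A v = ∑ l, v l • A (Pi.single l 1) := by
  conv_lhs => rw [pi_eq_sum_univ' v]
  rw [map_sum]
  refine Finset.sum_congr rfl fun l _ => ?_
  rw [map_smul]

/-- The connection coefficients `(Dφ)⁻¹ D²φ` of the flat connection with flat chart `φ`. -/
noncomputable def flatCoeff (φ : (Fin n → ℂ) → (Fin n → ℂ))
    (B : (Fin n → ℂ) → (Fin n → ℂ) →L[ℂ] (Fin n → ℂ)) (z : Fin n → ℂ) (i j l : Fin n) : ℂ :=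
  B z (fderiv ℂ (fun w => fderiv ℂ φ w (Pi.single l 1)) z (Pi.single j 1)) i

/-- Symmetry of D²φ is what makes the flat connection torsion free. Charts are only assumed complex
differentiable, so the second derivative relies on the smoothness of holomorphic maps. -/
theorem fderiv_fderiv_apply_comm {U : Set (Fin n → ℂ)} (hU : IsOpen U)
    {φ : (Fin n → ℂ) → (Fin n → ℂ)} (hφ : DifferentiableOn ℂ φ U) (hz : z ∈ U)
    (u v : Fin n → ℂ) :
    fderiv ℂ (fun w => fderiv ℂ φ w u) z v = fderiv ℂ (fun w => fderiv ℂ φ w v) z u := by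
  have h1 : ContDiffAt ℂ ∞ φ z := (contDiffOn_of_differentiableOn hU hφ).contDiffAt (hU.mem_nhds hz)
  have h2 : HasFDerivAt (fderiv ℂ φ) (fderiv ℂ (fderiv ℂ φ) z) z :=
    ((h1.fderiv_right (m := ∞) (by simp)).differentiableAt (by simp)).hasFDerivAt
  have h3 (u v : Fin n → ℂ) :
      fderiv ℂ (fun w => fderiv ℂ φ w u) z v = fderiv ℂ (fderiv ℂ φ) z v u := by
    rw [(h2.clm_apply (hasFDerivAt_const u z)).fderiv]
    simp
  rw [h3, h3]
  exact (h1.isSymmSndFDerivAt (by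
    rw [minSmoothness_of_isRCLikeNormedField]; exact WithTop.coe_le_coe.2 le_top)) v u

theorem differentiableOn_flatCoeff {U : Set (Fin n → ℂ)} (hU : IsOpen U)
    {φ : (Fin n → ℂ) → (Fin n → ℂ)} (hφ : DifferentiableOn ℂ φ U)
    {B : (Fin n → ℂ) → (Fin n → ℂ) →L[ℂ] (Fin n → ℂ)}
    (hB : ∀ v, DifferentiableOn ℂ (fun w => B w v) U) (i j l : Fin n) :
    DifferentiableOn ℂ (fun w => flatCoeff φ B w i j l) U := by
  have h1 : DifferentiableOn ℂ
      (fun w => fderiv ℂ (fun w => fderiv ℂ φ w (Pi.single l 1)) w (Pi.single j 1)) U :=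
    differentiableOn_fderiv_apply hU (differentiableOn_fderiv_apply hU hφ _) _
  simp only [flatCoeff]
  have (w : Fin n → ℂ) (v : Fin n → ℂ) : B w v i = ∑ p, v p * B w (Pi.single p 1) i := by
    rw [clm_apply_eq_sum (B w) v, Finset.sum_apply]
    rfl
  refine DifferentiableOn.congr ?_ fun w _ => this w _
  refine DifferentiableOn.fun_sum fun p _ => DifferentiableOn.fun_mul ?_ ?_
  · exact fun w hw => (differentiableWithinAt_pi.1 (h1 w hw)) p
  · exact fun w hw => (differentiableWithinAt_pi.1 (hB (Pi.single p 1) w hw)) i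

theorem flatCoeff_comm {U : Set (Fin n → ℂ)} (hU : IsOpen U)
    {φ : (Fin n → ℂ) → (Fin n → ℂ)} (hφ : DifferentiableOn ℂ φ U)
    {B : (Fin n → ℂ) → (Fin n → ℂ) →L[ℂ] (Fin n → ℂ)} (hz : z ∈ U) (i j l : Fin n) :
    flatCoeff φ B z i j l = flatCoeff φ B z i l j := by
  rw [flatCoeff, flatCoeff, fderiv_fderiv_apply_comm hU hφ hz]

theorem sum_flatCoeff {U : Set (Fin n → ℂ)} (hU : IsOpen U)
    {φ : (Fin n → ℂ) → (Fin n → ℂ)} (hφ : DifferentiableOn ℂ φ U)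
    {B : (Fin n → ℂ) → (Fin n → ℂ) →L[ℂ] (Fin n → ℂ)} (hz : z ∈ U) (i j : Fin n)
    (η : Fin n → ℂ) :
    ∑ l, flatCoeff φ B z i j l * η l =
      B z (fderiv ℂ (fun w => fderiv ℂ φ w η) z (Pi.single j 1)) i := by
  rw [fderiv_fderiv_apply_comm hU hφ hz, clm_apply_eq_sum (fderiv ℂ _ z) η, map_sum,
    Finset.sum_apply]
  refine Finset.sum_congr rfl fun l _ => ?_
  rw [map_smul, Pi.smul_apply, smul_eq_mul, flatCoeff, fderiv_fderiv_apply_comm hU hφ hz, mul_comm]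

theorem dzbar_energy_of_map {U : Set (Fin n → ℂ)} (hF : IsComplexFinsler D F) (hD : IsOpen D)
    {z₀ : Fin n → ℂ} (hz₀ : z₀ ∈ D) {φ : (Fin n → ℂ) → (Fin n → ℂ)}
    (hmap : ∀ w ∈ U, ∀ ζ, energy F w ζ = energy F z₀ (fderiv ℂ φ w ζ))
    (hz : z ∈ U) (hη : fderiv ℂ φ z η ≠ 0) (m : Fin n) :
    dzbar (energy F z) m η = ∑ q, star (fderiv ℂ φ z (Pi.single m 1) q) *
      dzbar (energy F z₀) q (fderiv ℂ φ z η) := by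
  rw [← dzbar_comp ((contDiffAt_energy_snd (hF.contDiffAt_energy hD hz₀ hη)).differentiableAt
    (by simp)) (fderiv ℂ φ z).hasFDerivAt m]
  exact dzbar_congr (Eventually.of_forall fun ζ => hmap z hz ζ) m

theorem fundamentalTensor_of_map {U : Set (Fin n → ℂ)} (hF : IsComplexFinsler D F) (hD : IsOpen D)
    {z₀ : Fin n → ℂ} (hz₀ : z₀ ∈ D) {φ : (Fin n → ℂ) → (Fin n → ℂ)}
    (hmap : ∀ w ∈ U, ∀ ζ, energy F w ζ = energy F z₀ (fderiv ℂ φ w ζ))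
    (hz : z ∈ U) (hη : fderiv ℂ φ z η ≠ 0) (i m : Fin n) :
    fundamentalTensor F z η i m = ∑ q, star (fderiv ℂ φ z (Pi.single m 1) q) *
      ∑ p, fderiv ℂ φ z (Pi.single i 1) p *
        fundamentalTensor F z₀ (fderiv ℂ φ z η) p q := by
  have hd (q : Fin n) : DifferentiableAt ℝ (dzbar (energy F z₀) q) (fderiv ℂ φ z η) :=
    (contDiffAt_dzbar (contDiffAt_energy_snd (hF.contDiffAt_energy hD hz₀ hη)) q).differentiableAt
      (by simp)
  have hd' (q : Fin n) :
      DifferentiableAt ℝ (fun ζ => dzbar (energy F z₀) q (fderiv ℂ φ z ζ)) η :=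
    (hd q).comp η ((fderiv ℂ φ z).hasFDerivAt.restrictScalars ℝ).differentiableAt
  have hev : dzbar (energy F z) m =ᶠ[𝓝 η] fun ζ =>
      ∑ q, star (fderiv ℂ φ z (Pi.single m 1) q) *
        dzbar (energy F z₀) q (fderiv ℂ φ z ζ) := by
    filter_upwards [(fderiv ℂ φ z).continuous.continuousAt.eventually_ne hη] with ζ hζ
    exact dzbar_energy_of_map hF hD hz₀ hmap hz hζ m
  rw [fundamentalTensor_apply, dz_congr hev, dz_sum fun q _ => (hd' q).const_mul _]
  refine Finset.sum_congr rfl fun q _ => ?_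
  rw [dz_const_mul (hd' q), dz_comp (hd q) (fderiv ℂ φ z).hasFDerivAt]
  rfl

/-- The Chern-Finsler connection of a locally Minkowski metric. -/
theorem chernFinsler_of_map {U : Set (Fin n → ℂ)} (hF : IsComplexFinsler D F) (hD : IsOpen D)
    (hU : IsOpen U) (hUD : U ⊆ D) {z₀ : Fin n → ℂ} (hz₀ : z₀ ∈ D)
    {φ : (Fin n → ℂ) → (Fin n → ℂ)} (hφ : DifferentiableOn ℂ φ U)
    {B : (Fin n → ℂ) → (Fin n → ℂ) →L[ℂ] (Fin n → ℂ)}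
    (hB : ∀ w ∈ U, ∀ v, B w (fderiv ℂ φ w v) = v)
    (hB' : ∀ w ∈ U, ∀ v, fderiv ℂ φ w (B w v) = v)
    (hmap : ∀ w ∈ U, ∀ ζ, energy F w ζ = energy F z₀ (fderiv ℂ φ w ζ))
    (hz : z ∈ U) (hη : η ≠ 0) (i j : Fin n) :
    chernFinsler F z η i j = ∑ l, flatCoeff φ B z i j l * η l := by
  have hne : ∀ w ∈ U, fderiv ℂ φ w η ≠ 0 := by
    intro w hw h0
    have := hB w hw η
    rw [h0, map_zero] at this
    exact hη this.symm
  have hsm : ∀ᶠ w in 𝓝 z, ContDiffAt ℝ ∞ (Function.uncurry (energy F)) (w, η) := by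
    filter_upwards [hU.mem_nhds hz] with w hw using hF.contDiffAt_energy hD (hUD hw) hη
  have hhom : ∀ᶠ w in 𝓝 z, ∀ (c : ℂ) (ξ : Fin n → ℂ), F w (c • ξ) = ‖c‖ * F w ξ := by
    filter_upwards [hU.mem_nhds hz] with w hw using hF.homogeneous w (hUD hw)
  have hJ (v : Fin n → ℂ) : DifferentiableAt ℂ (fun w => fderiv ℂ φ w v) z :=
    (differentiableOn_fderiv_apply hU hφ v).differentiableAt (hU.mem_nhds hz)
  have hJ' (v : Fin n → ℂ) (q : Fin n) : DifferentiableAt ℂ (fun w => fderiv ℂ φ w v q) z :=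
    differentiableAt_pi.1 (hJ v) q
  have hd (q : Fin n) : DifferentiableAt ℝ (dzbar (energy F z₀) q) (fderiv ℂ φ z η) :=
    (contDiffAt_dzbar (contDiffAt_energy_snd (hF.contDiffAt_energy hD hz₀ (hne z hz)))
      q).differentiableAt (by simp)
  have hd' (q : Fin n) :
      DifferentiableAt ℝ (fun w => dzbar (energy F z₀) q (fderiv ℂ φ w η)) z :=
    DifferentiableAt.comp (g := dzbar (energy F z₀) q) (f := fun w => fderiv ℂ φ w η) z (hd q)
      ((hJ η).restrictScalars ℝ)
  have hs (v : Fin n → ℂ) (q : Fin n) :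
      DifferentiableAt ℝ (fun w => star (fderiv ℂ φ w v q)) z :=
    ((hJ' v q).restrictScalars ℝ).star
  -- X solves Dφ(X) = ∂ⱼ(Dφ η). Since F² depends on the base point only through Dφ, and the
  -- conjugate Jacobian is killed by ∂ⱼ, the derivative ∂ⱼ∂̄ₘF² equals X contracted with the
  -- fundamental tensor. Inverting the tensor leaves X.
  set X : Fin n → ℂ := B z (fderiv ℂ (fun w => fderiv ℂ φ w η) z (Pi.single j 1)) with hX
  have hXJ : fderiv ℂ (fun w => fderiv ℂ φ w η) z (Pi.single j 1) = fderiv ℂ φ z X :=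
    (hB' z hz _).symm
  have hm (m : Fin n) : dz (fun w => dzbar (energy F w) m η) j z =
      ∑ p, X p * fundamentalTensor F z η p m := by
    have hev : (fun w => dzbar (energy F w) m η) =ᶠ[𝓝 z] fun w =>
        ∑ q, star (fderiv ℂ φ w (Pi.single m 1) q) *
          dzbar (energy F z₀) q (fderiv ℂ φ w η) := by
      filter_upwards [hU.mem_nhds hz] with w hw
      exact dzbar_energy_of_map hF hD hz₀ hmap hw (hne w hw) m
    rw [dz_congr hev, dz_sum fun q _ => (hs _ q).fun_mul (hd' q)]
    have (q : Fin n) : dz (fun w => star (fderiv ℂ φ w (Pi.single m 1) q) *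
        dzbar (energy F z₀) q (fderiv ℂ φ w η)) j z =
        star (fderiv ℂ φ z (Pi.single m 1) q) * ∑ p, fderiv ℂ φ z X p *
          fundamentalTensor F z₀ (fderiv ℂ φ z η) p q := by
      rw [dz_mul (hs _ q) (hd' q), dz_star, dzbar_of_differentiableAt (hJ' _ q), star_zero,
        zero_mul, zero_add, dz_comp (φ := fun w => fderiv ℂ φ w η) (hd q) (hJ η).hasFDerivAt, hXJ]
      rfl
    simp only [this, fundamentalTensor_of_map hF hD hz₀ hmap hz (hne z hz)]
    simp only [clm_apply_eq_sum (fderiv ℂ φ z) X, Finset.sum_apply, Pi.smul_apply, smul_eq_mul,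
      Finset.mul_sum, Finset.sum_mul]
    conv_rhs => rw [Finset.sum_comm]
    refine Finset.sum_congr rfl fun q _ => ?_
    rw [Finset.sum_comm]
    refine Finset.sum_congr rfl fun p _ => Finset.sum_congr rfl fun r _ => ?_
    ring
  rw [chernFinsler_eq hsm hhom, sum_flatCoeff hU hφ hz]
  simp only [hm]
  exact sum_inv_mul_sum (hF.posDef z (hUD hz) η hη).isUnit X i

/-- Around every point, the spray of a locally Minkowski metric is that of a torsion free
holomorphic linear connection. -/
theorem IsLocallyMinkowski.exists_coeff (hF : IsLocallyMinkowski D F) (hD : IsOpen D)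
    (hz : z ∈ D) :
    ∃ (U : Set (Fin n → ℂ)) (Γ : (Fin n → ℂ) → Fin n → Fin n → Fin n → ℂ), IsOpen U ∧ z ∈ U ∧
      U ⊆ D ∧ (∀ i j l, DifferentiableOn ℂ (fun w => Γ w i j l) U) ∧
      (∀ w ∈ U, ∀ i j l, Γ w i j l = Γ w i l j) ∧
      ∀ w ∈ U, ∀ η, η ≠ 0 → ∀ i, thetaStar F w η i = 0 ∧
        spray F w η i = (1 / 2 : ℂ) * ∑ j, ∑ l, Γ w i j l * η l * η j := by
  obtain ⟨U, φ, B, hU, hzU, hUD, hφ, hBd, hB, hB', hmap⟩ := hF.exists_map hD hz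
  refine ⟨U, flatCoeff φ B, hU, hzU, hUD, differentiableOn_flatCoeff hU hφ hBd,
    fun w hw => flatCoeff_comm hU hφ hw, fun w hw η hη i => ⟨?_, ?_⟩⟩
  · refine thetaStar_eq_zero_of_torsion (fun i j l => ?_) i
    have (a b : Fin n) : connectionCoeff F w η i a b = flatCoeff φ B w i b a := by
      have hev : (fun ξ => chernFinsler F w ξ i b) =ᶠ[𝓝 η]
          fun ξ => ∑ l, flatCoeff φ B w i b l * ξ l := by
        filter_upwards [isOpen_ne.mem_nhds hη] with ξ hξ
        exact chernFinsler_of_map hF.1 hD hU hUD hz hφ hB hB' hmap hw hξ i b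
      rw [connectionCoeff, dz_congr hev, dz_linear]
    rw [torsion, this, this, flatCoeff_comm hU hφ hw, sub_self]
  · simp only [spray, chernFinsler_of_map hF.1 hD hU hUD hz hφ hB hB' hmap hw hη, Finset.sum_mul]

end Coefficients

/-! ### Locally projectively flat Hermitian metrics are Kähler -/

section ProjectivelyFlat

variable {n : ℕ} {D : Set (Fin n → ℂ)} {k : (Fin n → ℂ) → Matrix (Fin n) (Fin n) ℂ}
  {z η : Fin n → ℂ}

/-- Applying ∂ᵢ∂̄ⱼ to the vanishing form isolates the coefficient, which replaces polarization. -/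
theorem sesquilinear_eq_zero {C : Matrix (Fin n) (Fin n) ℂ}
    (H : ∀ η : Fin n → ℂ, ∑ i, ∑ j, C i j * η i * star (η j) = 0) (i j : Fin n) : C i j = 0 := by
  have h1 : (fun η => hermitianForm (fun _ => C) 0 η η) = fun _ => 0 := by
    funext η; exact H η
  have h2 : dzbar (fun η => hermitianForm (fun _ => C) 0 η η) j =
      fun η => ∑ l, C l j * η l := by
    funext η; exact dzbar_hermitianForm (fun _ => C) 0 η j
  have h3 := dz_linear (fun l => C l j) i 0
  rw [← h2, h1] at h3
  have h4 : dzbar (fun _ : Fin n → ℂ => (0 : ℂ)) j = fun _ => 0 := by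
    funext η; exact dzbar_const 0 j
  rw [h4, dz_const] at h3
  exact h3.symm

theorem sum_sum_single_add (V : Fin n → Fin n → ℂ) (i j : Fin n) (t : ℂ) :
    ∑ a, ∑ b, V a b * (Pi.single i 1 + t • Pi.single j 1 : Fin n → ℂ) b *
      (Pi.single i 1 + t • Pi.single j 1 : Fin n → ℂ) a =
      V i i + t * (V i j + V j i) + t ^ 2 * V j j := by
  simp only [Pi.add_apply, Pi.smul_apply, Pi.single_apply, smul_eq_mul, mul_add, add_mul,
    Finset.sum_add_distrib, mul_ite, ite_mul, mul_one, mul_zero, zero_mul]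
  simp [Finset.sum_add_distrib]
  ring

/-- A vector valued quadratic form proportional to the identity is a linear form times the
identity. -/
theorem quadratic_proportional {V : Fin n → Fin n → Fin n → ℂ}
    (hV : ∀ p i j, V p i j = V p j i)
    (H : ∀ η : Fin n → ℂ, η ≠ 0 → ∃ c : ℂ, ∀ p, ∑ a, ∑ b, V p a b * η b * η a = c * η p)
    (p i j : Fin n) :
    V p i j = (1 / 2 * V i i i) * (if p = j then 1 else 0) +
      (1 / 2 * V j j j) * (if p = i then 1 else 0) := by
  have h1 (i p : Fin n) (hp : p ≠ i) : V p i i = 0 := by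
    obtain ⟨c, hc⟩ := H (Pi.single i 1 + (0 : ℂ) • Pi.single i 1) (by simp)
    have := hc p
    rw [sum_sum_single_add] at this
    simpa [hp] using this
  have h2 (t : ℂ) (hij : i ≠ j) : ∃ c : ℂ, ∀ p, V p i i + t * (V p i j + V p j i) + t ^ 2 * V p j j
      = c * (Pi.single i 1 + t • Pi.single j 1 : Fin n → ℂ) p := by
    obtain ⟨c, hc⟩ := H (Pi.single i 1 + t • Pi.single j 1) (by
      intro h0
      have := congrFun h0 i
      simp [hij] at this)
    refine ⟨c, fun p => ?_⟩
    rw [← hc p, sum_sum_single_add]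
  by_cases hij : i = j
  · subst hij
    by_cases hp : p = i
    · subst hp; simp; ring
    · simp [hp, h1 i p hp]
  -- Testing on eᵢ ± eⱼ: the i and j components for the two signs express both mixed coefficients
  -- through the pure ones, and any other component vanishes.
  · obtain ⟨c, hc⟩ := h2 1 hij
    obtain ⟨c', hc'⟩ := h2 (-1) hij
    have a1 := hc i
    have a2 := hc j
    have a3 := hc' i
    have a4 := hc' j
    simp only [Pi.add_apply, Pi.smul_apply, Pi.single_apply, hij, Ne.symm hij, if_true, if_false,
      smul_eq_mul, h1 j i hij, h1 i j (Ne.symm hij), ← hV i i j, ← hV j i j] at a1 a2 a3 a4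
    by_cases hpj : p = j
    · subst hpj
      simp only [if_true, Ne.symm hij, if_false]
      linear_combination (1 / 4) * (a2 - a1 - a3 - a4)
    · by_cases hpi : p = i
      · subst hpi
        simp only [if_true, hpj, if_false]
        linear_combination (1 / 4) * (a1 - a2 - a3 - a4)
      · have a5 := hc p
        simp only [Pi.add_apply, Pi.smul_apply, Pi.single_apply, hpi, hpj, if_false, smul_eq_mul,
          h1 j p hpj, h1 i p hpi, ← hV p i j] at a5
        simp only [hpj, hpi, if_false]
        linear_combination (1 / 2) * a5

/-- For a Hermitian metric θ* has bidegree (1,1) in η, and i · ī = 1. -/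
theorem thetaStar_I_smul (hk : IsHermitianMetric D k) (hD : IsOpen D) (hz : z ∈ D)
    (η : Fin n → ℂ) (i : Fin n) :
    thetaStar (hermitianNorm k) z (Complex.I • η) i = thetaStar (hermitianNorm k) z η i := by
  simp only [thetaStar, torsion_hermitianNorm hk hD hz,
    fundamentalTensor_hermitianNorm (hk.posDef z hz)]
  refine Finset.sum_congr rfl fun _ _ => Finset.sum_congr rfl fun _ _ =>
    Finset.sum_congr rfl fun _ _ => Finset.sum_congr rfl fun _ _ => ?_
  simp only [Pi.smul_apply, smul_eq_mul, star_mul', Complex.star_def, Complex.conj_I]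
  ring_nf
  simp

/-- The two bihomogeneous parts of projective flatness. -/
theorem exists_proportional (hk : IsHermitianMetric D k) (hD : IsOpen D) (hz : z ∈ D)
    {Γ : Fin n → Fin n → Fin n → ℂ} {P : (Fin n → ℂ) → ℂ}
    (H : ∀ η, η ≠ 0 → ∀ i, spray (hermitianNorm k) z η i =
      (1 / 2 : ℂ) * (∑ j, ∑ l, Γ i j l * η l * η j) +
        (1 / 2 : ℂ) * thetaStar (hermitianNorm k) z η i + P η * η i) (hη : η ≠ 0) :
    (∃ c : ℂ, ∀ i, thetaStar (hermitianNorm k) z η i = c * η i) ∧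
    ∃ c : ℂ, ∀ i, ∑ j, ∑ l, (christoffel k z i j l - Γ i j l) * η l * η j = c * η i := by
  have h1 := H η hη
  -- Under η ↦ iη the quadratic terms change sign, θ* is unchanged, and P η remains some multiple of
  -- η. Sum and difference of the two relations separate the two parts.
  have h2 := H (Complex.I • η) (by simpa using hη)
  have hI (T : Fin n → Fin n → ℂ) : ∑ j, ∑ l, T j l * (Complex.I • η) l * (Complex.I • η) j =
      -∑ j, ∑ l, T j l * η l * η j := by
    rw [← Finset.sum_neg_distrib]
    refine Finset.sum_congr rfl fun j _ => ?_
    rw [← Finset.sum_neg_distrib]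
    refine Finset.sum_congr rfl fun l _ => ?_
    simp only [Pi.smul_apply, smul_eq_mul]
    linear_combination (T j l * η l * η j) * Complex.I_mul_I
  simp only [spray_hermitianNorm hk hD hz, thetaStar_I_smul hk hD hz, hI] at h1 h2
  refine ⟨⟨-(P η + P (Complex.I • η) * Complex.I), fun i => ?_⟩,
    ⟨P η - P (Complex.I • η) * Complex.I, fun i => ?_⟩⟩
  · have a := h1 i
    have b := h2 i
    simp only [Pi.smul_apply, smul_eq_mul] at b
    linear_combination -a - b
  · have a := h1 i
    have b := h2 i
    simp only [Pi.smul_apply, smul_eq_mul] at b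
    simp only [sub_mul, Finset.sum_sub_distrib]
    linear_combination a - b

/-- If `θ*` is proportional to the direction then `k` is torsion free. -/
theorem dz_symm_of_thetaStar (hk : IsHermitianMetric D k) (hD : IsOpen D) (hz : z ∈ D)
    (H : ∀ η, η ≠ 0 → ∃ c : ℂ, ∀ i, thetaStar (hermitianNorm k) z η i = c * η i)
    (j l m : Fin n) : dz (fun w => k w l m) j z = dz (fun w => k w j m) l z := by
  have hp := hk.posDef z hz
  have hY (η : Fin n → ℂ) (q : Fin n) : ∑ i, thetaStar (hermitianNorm k) z η i * k z i q =
      ∑ a, ∑ b, star (dz (fun w => k w b a) q z - dz (fun w => k w q a) b z) *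
        η a * star (η b) := by
    have h1 (i : Fin n) : thetaStar (hermitianNorm k) z η i = ∑ m, (k z)⁻¹ m i *
        ∑ a, ∑ p, ∑ b, k z a p * star (torsion (hermitianNorm k) z η p b m) * η a * star (η b) := by
      simp only [thetaStar, fundamentalTensor_hermitianNorm hp, Finset.mul_sum]
      refine Finset.sum_congr rfl fun _ _ => Finset.sum_congr rfl fun _ _ =>
        Finset.sum_congr rfl fun _ _ => Finset.sum_congr rfl fun _ _ => by ring
    simp only [h1]
    rw [sum_sum_inv_mul hp.isUnit (fun m => ∑ a, ∑ p, ∑ b, k z a p *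
      star (torsion (hermitianNorm k) z η p b m) * η a * star (η b)) q]
    refine Finset.sum_congr rfl fun a _ => ?_
    rw [Finset.sum_comm]
    refine Finset.sum_congr rfl fun b _ => ?_
    rw [← Finset.sum_mul, ← Finset.sum_mul, ← sum_christoffel_mul hp, ← sum_christoffel_mul hp,
      ← Finset.sum_sub_distrib, star_sum]
    congr 2
    refine Finset.sum_congr rfl fun p _ => ?_
    rw [torsion_hermitianNorm hk hD hz, ← sub_mul, star_mul', hp.isHermitian.apply]
    ring
  have hzero (η : Fin n → ℂ) (q : Fin n) :
      ∑ a, ∑ b, star (dz (fun w => k w b a) q z - dz (fun w => k w q a) b z) *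
        η a * star (η b) = 0 := by
    rcases eq_or_ne η 0 with rfl | hη
    · simp
    obtain ⟨c, hc⟩ := H η hη
    -- This is k(θ*, η). The bracket is antisymmetric in b and q while the weights η̄ᵇη̄^q are
    -- symmetric. For θ* = cη it follows that c k(η, η) = 0, hence c = 0.
    have h1 : ∑ q, star (η q) *
        (∑ a, ∑ b, star (dz (fun w => k w b a) q z - dz (fun w => k w q a) b z) *
        η a * star (η b)) = 0 := by
      have hanti : ∀ x : ℂ, x = -x → x = 0 := fun x hx => by
        linear_combination (1 / 2 : ℂ) * hx
      apply hanti
      simp only [Finset.mul_sum]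
      rw [← Finset.sum_neg_distrib]
      conv_lhs =>
        enter [2, q]
        rw [Finset.sum_comm]
      rw [Finset.sum_comm]
      refine Finset.sum_congr rfl fun q _ => ?_
      rw [← Finset.sum_neg_distrib, Finset.sum_comm]
      refine Finset.sum_congr rfl fun a _ => ?_
      rw [← Finset.sum_neg_distrib]
      refine Finset.sum_congr rfl fun b _ => ?_
      rw [star_sub, star_sub]; ring
    simp only [← hY, hc] at h1 ⊢
    have h2 : ∑ q, star (η q) * ∑ i, c * η i * k z i q = c * hermitianForm k z η η := by
      simp only [hermitianForm_eq_sum_mul', Finset.mul_sum, Finset.sum_mul]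
      exact Finset.sum_congr rfl fun _ _ => Finset.sum_congr rfl fun _ _ => by ring
    rw [h2] at h1
    have h3 : c = 0 := (mul_eq_zero.1 h1).resolve_right (hermitianForm_pos hp hη).ne'
    simp [h3]
  have h4 := sesquilinear_eq_zero (C := Matrix.of fun a b =>
    star (dz (fun w => k w b a) j z - dz (fun w => k w j a) b z)) (fun η => hzero η j) m l
  simp only [Matrix.of_apply, star_eq_zero] at h4
  exact sub_eq_zero.1 h4

/-- The Minkowski model has no θ* and its spray is given by Γ, so the projective relation has the
form that `exists_proportional` splits. -/
theorem IsLocallyProjectivelyFlat.exists_coeff (hk : IsHermitianMetric D k) (hD : IsOpen D)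
    (hflat : IsLocallyProjectivelyFlat D (hermitianNorm k)) (hz : z ∈ D) :
    ∃ (U : Set (Fin n → ℂ)) (Γ : (Fin n → ℂ) → Fin n → Fin n → Fin n → ℂ), IsOpen U ∧ z ∈ U ∧
      U ⊆ D ∧ (∀ i j l, DifferentiableOn ℂ (fun w => Γ w i j l) U) ∧
      (∀ w ∈ U, ∀ i j l, Γ w i j l = Γ w i l j) ∧
      ∀ w ∈ U, ∀ η, η ≠ 0 → (∃ c : ℂ, ∀ i, thetaStar (hermitianNorm k) w η i = c * η i) ∧
        ∃ c : ℂ, ∀ i, ∑ j, ∑ l, (christoffel k w i j l - Γ w i j l) * η l * η j = c * η i := by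
  obtain ⟨F', hF', P, -, hP⟩ := hflat
  obtain ⟨U, Γ, hU, hzU, hUD, hd, hs, hΓ⟩ := hF'.exists_coeff hD hz
  refine ⟨U, Γ, hU, hzU, hUD, hd, hs, fun w hw η hη => ?_⟩
  refine exists_proportional hk hD (hUD hw) (P := P w) (fun ξ hξ i => ?_) hη
  rw [hP w (hUD hw) ξ hξ i, (hΓ w hw ξ hξ i).1, (hΓ w hw ξ hξ i).2, sub_zero]

/-- A locally projectively flat Hermitian metric is Kähler. -/
theorem IsLocallyProjectivelyFlat.isKahler (hk : IsHermitianMetric D k) (hD : IsOpen D)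
    (hflat : IsLocallyProjectivelyFlat D (hermitianNorm k)) : IsKahler D (hermitianNorm k) := by
  rw [isKahler_iff_dz hk hD]
  intro z hz
  obtain ⟨U, Γ, hU, hzU, hUD, hd, hs, H⟩ := hflat.exists_coeff hk hD hz
  exact dz_symm_of_thetaStar hk hD hz fun η hη => (H z hzU η hη).1

/-- The coefficients `½ ∂Γ^i_{ii} / ∂z̄ᵐ`. -/
noncomputable def projCurv (k : (Fin n → ℂ) → Matrix (Fin n) (Fin n) ℂ) (z : Fin n → ℂ)
    (i m : Fin n) : ℂ :=
  1 / 2 * dzbar (fun w => christoffel k w i i i) m z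

/-- Both connections are symmetric and their difference is proportional to the identity as a
quadratic form, so `quadratic_proportional` determines it from diagonal coefficients. The flat part
is holomorphic and disappears under ∂̄. -/
theorem IsLocallyProjectivelyFlat.dzbar_christoffel (hk : IsHermitianMetric D k) (hD : IsOpen D)
    (hflat : IsLocallyProjectivelyFlat D (hermitianNorm k)) (hz : z ∈ D) (p i j m : Fin n) :
    dzbar (fun w => christoffel k w p i j) m z =
      projCurv k z i m * (if p = j then 1 else 0) + projCurv k z j m * (if p = i then 1 else 0) := by
  have hsymm := (isKahler_iff_christoffel hk hD).1 (hflat.isKahler hk hD)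
  obtain ⟨U, Γ, hU, hzU, hUD, hd, hs, H⟩ := hflat.exists_coeff hk hD hz
  have hdΓ (i j l : Fin n) : DifferentiableAt ℂ (fun w => Γ w i j l) z :=
    (hd i j l).differentiableAt (hU.mem_nhds hzU)
  have hdΓ' (i j l : Fin n) : DifferentiableAt ℝ (fun w => Γ w i j l) z :=
    (hdΓ i j l).restrictScalars ℝ
  have hdk (i j l : Fin n) : DifferentiableAt ℝ (fun w => christoffel k w i j l) z :=
    (hk.contDiffAt_christoffel hD hz i j l).differentiableAt (by simp)
  have hV (i j l : Fin n) : DifferentiableAt ℝ (fun w => christoffel k w i j l - Γ w i j l) z :=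
    (hdk i j l).fun_sub (hdΓ' i j l)
  have hzV (i j l : Fin n) : dzbar (fun w => christoffel k w i j l - Γ w i j l) m z =
      dzbar (fun w => christoffel k w i j l) m z := by
    rw [dzbar_sub (hdk i j l) (hdΓ' i j l), dzbar_of_differentiableAt (hdΓ i j l), sub_zero]
  have hev : (fun w => christoffel k w p i j - Γ w p i j) =ᶠ[𝓝 z] fun w =>
      (1 / 2 * (christoffel k w i i i - Γ w i i i)) * (if p = j then 1 else 0) +
      (1 / 2 * (christoffel k w j j j - Γ w j j j)) * (if p = i then 1 else 0) := by
    filter_upwards [hU.mem_nhds hzU] with w hw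
    exact quadratic_proportional (V := fun p i j => christoffel k w p i j - Γ w p i j)
      (fun p i j => by rw [hsymm w (hUD hw), hs w hw]) (fun η hη => (H w hw η hη).2) p i j
  rw [← hzV, dzbar_congr hev, dzbar_add (((hV i i i).const_mul _).mul_const _)
    (((hV j j j).const_mul _).mul_const _), dzbar_mul_const ((hV i i i).const_mul _),
    dzbar_mul_const ((hV j j j).const_mul _), dzbar_const_mul (hV i i i),
    dzbar_const_mul (hV j j j), hzV, hzV]
  rfl

end ProjectivelyFlat

/-! ### Curvature of locally projectively flat metrics and Schur's lemma -/

section Curvature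

variable {n : ℕ} {D : Set (Fin n → ℂ)} {k : (Fin n → ℂ) → Matrix (Fin n) (Fin n) ℂ}
  {z η : Fin n → ℂ}

theorem IsHermitianMetric.dzbar_eq_star (hk : IsHermitianMetric D k) (hD : IsOpen D) (hz : z ∈ D)
    (i j m : Fin n) : dzbar (fun w => k w i j) m z = star (dz (fun w => k w j i) m z) := by
  rw [← dzbar_star]
  refine dzbar_congr ?_ m
  filter_upwards [hD.mem_nhds hz] with w hw using ((hk.posDef w hw).isHermitian.apply i j).symm

theorem IsKahler.dzbar_comm (hk : IsHermitianMetric D k) (hD : IsOpen D)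
    (hK : IsKahler D (hermitianNorm k)) (hz : z ∈ D) (i l m : Fin n) :
    dzbar (fun w => k w i l) m z = dzbar (fun w => k w i m) l z := by
  rw [hk.dzbar_eq_star hD hz, hk.dzbar_eq_star hD hz, (isKahler_iff_dz hk hD).1 hK z hz]

/-- The Leibniz rule for ∂̄ applied to the defining relation of the Chern connection with its upper
index lowered. -/
theorem sum_dzbar_christoffel_mul (hk : IsHermitianMetric D k) (hD : IsOpen D) (hz : z ∈ D)
    (i j l m : Fin n) :
    ∑ p, dzbar (fun w => christoffel k w p j i) m z * k z p l =
      dzbar (dz (fun w => k w i l) j) m z -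
        ∑ p, christoffel k z p j i * dzbar (fun w => k w p l) m z := by
  have hev : dz (fun w => k w i l) j =ᶠ[𝓝 z] fun w => ∑ p, christoffel k w p j i * k w p l := by
    filter_upwards [hD.mem_nhds hz] with w hw using (sum_christoffel_mul (hk.posDef w hw) j i l).symm
  have hdΓ (p : Fin n) : DifferentiableAt ℝ (fun w => christoffel k w p j i) z :=
    (hk.contDiffAt_christoffel hD hz p j i).differentiableAt (by simp)
  have hdk (p : Fin n) := hk.differentiableAt hD hz p l
  rw [dzbar_congr hev, dzbar_sum fun p _ => (hdΓ p).fun_mul (hdk p), ← Finset.sum_sub_distrib]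
  exact Finset.sum_congr rfl fun p _ => by rw [dzbar_mul (hdΓ p) (hdk p)]; ring

/-- The curvature tensor of a Kähler metric is symmetric in its conjugate indices. -/
theorem sum_dzbar_christoffel_mul_comm (hk : IsHermitianMetric D k) (hD : IsOpen D)
    (hK : IsKahler D (hermitianNorm k)) (hz : z ∈ D) (i j l m : Fin n) :
    ∑ p, dzbar (fun w => christoffel k w p j i) m z * k z p l =
      ∑ p, dzbar (fun w => christoffel k w p j i) l z * k z p m := by
  rw [sum_dzbar_christoffel_mul hk hD hz, sum_dzbar_christoffel_mul hk hD hz,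
    dzbar_dz_comm (hk.contDiffAt hD hz i l), dzbar_dz_comm (hk.contDiffAt hD hz i m)]
  have hev : dzbar (fun w => k w i l) m =ᶠ[𝓝 z] dzbar (fun w => k w i m) l := by
    filter_upwards [hD.mem_nhds hz] with w hw using hK.dzbar_comm hk hD hw i l m
  rw [dz_congr hev]
  congr 1
  exact Finset.sum_congr rfl fun p _ => by rw [hK.dzbar_comm hk hD hz p l m]

/-- The holomorphic sectional curvature, divided by `-4`, of a locally projectively flat metric. -/
noncomputable def curvFactor (k : (Fin n → ℂ) → Matrix (Fin n) (Fin n) ℂ) (z : Fin n → ℂ) : ℂ :=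
  1 / n * ∑ i, ∑ l, (k z)⁻¹ l i * projCurv k z i l

theorem IsLocallyProjectivelyFlat.sum_projCurv (hk : IsHermitianMetric D k) (hD : IsOpen D)
    (hflat : IsLocallyProjectivelyFlat D (hermitianNorm k)) (hz : z ∈ D) (i j l m : Fin n) :
    ∑ p, dzbar (fun w => christoffel k w p j i) m z * k z p l =
      projCurv k z j m * k z i l + projCurv k z i m * k z j l := by
  simp only [hflat.dzbar_christoffel hk hD hz, add_mul, Finset.sum_add_distrib]
  simp

theorem sum_inv_mul_sum_swap {A : Matrix (Fin n) (Fin n) ℂ} (hA : IsUnit A) :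
    ∑ i, ∑ l, A⁻¹ l i * A i l = n := by
  rw [Finset.sum_comm]
  simp [sum_inv_mul hA]

/-- Write c for `projCurv` and κ for `curvFactor`. The curvature tensor is c ⊗ k symmetrized in its
unbarred indices, and it is also symmetric in the barred ones because k is Kähler. Tracing the
latter symmetry with the inverse of k gives (n + 1)c = c + nκk. -/
theorem IsLocallyProjectivelyFlat.projCurv_eq (hk : IsHermitianMetric D k) (hD : IsOpen D)
    (hflat : IsLocallyProjectivelyFlat D (hermitianNorm k)) (hz : z ∈ D) (j m : Fin n) :
    projCurv k z j m = curvFactor k z * k z j m := by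
  have hu := (hk.posDef z hz).isUnit
  have hsym (i l : Fin n) : projCurv k z j m * k z i l + projCurv k z i m * k z j l =
      projCurv k z j l * k z i m + projCurv k z i l * k z j m := by
    rw [← hflat.sum_projCurv hk hD hz, ← hflat.sum_projCurv hk hD hz]
    exact sum_dzbar_christoffel_mul_comm hk hD (hflat.isKahler hk hD) hz i j l m
  have h1 : ∑ i, ∑ l, (k z)⁻¹ l i *
      (projCurv k z j m * k z i l + projCurv k z i m * k z j l) = n * projCurv k z j m +
      projCurv k z j m := by
    simp only [mul_add, Finset.sum_add_distrib]
    congr 1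
    · rw [← sum_inv_mul_sum_swap hu, Finset.sum_mul]
      refine Finset.sum_congr rfl fun i _ => ?_
      rw [Finset.sum_mul]
      exact Finset.sum_congr rfl fun l _ => by ring
    · calc _ = ∑ i, projCurv k z i m * ∑ l, k z j l * (k z)⁻¹ l i := by
            simp only [Finset.mul_sum]
            exact Finset.sum_congr rfl fun i _ => Finset.sum_congr rfl fun l _ => by ring
        _ = _ := by simp [sum_mul_inv hu]
  have h2 : ∑ i, ∑ l, (k z)⁻¹ l i *
      (projCurv k z j l * k z i m + projCurv k z i l * k z j m) = projCurv k z j m +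
      n * (curvFactor k z * k z j m) := by
    have hn : (n : ℂ) ≠ 0 := by
      have : 0 < n := Fin.pos j
      exact_mod_cast this.ne'
    simp only [mul_add, Finset.sum_add_distrib]
    congr 1
    · rw [Finset.sum_comm]
      calc _ = ∑ l, projCurv k z j l * ∑ i, (k z)⁻¹ l i * k z i m := by
            simp only [Finset.mul_sum]
            exact Finset.sum_congr rfl fun i _ => Finset.sum_congr rfl fun l _ => by ring
        _ = _ := by simp [sum_inv_mul hu]
    · have : (n : ℂ) * (curvFactor k z * k z j m) =
          (∑ i, ∑ l, (k z)⁻¹ l i * projCurv k z i l) * k z j m := by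
        rw [curvFactor]; field_simp
      rw [this, Finset.sum_mul]
      refine Finset.sum_congr rfl fun i _ => ?_
      rw [Finset.sum_mul]
      exact Finset.sum_congr rfl fun l _ => by ring
  simp only [hsym] at h1
  have hn : (n : ℂ) ≠ 0 := by
    have : 0 < n := Fin.pos j
    exact_mod_cast this.ne'
  apply mul_left_cancel₀ hn
  linear_combination h2 - h1

/-- The purely diagonal curvature component equals 2κ(k_{jj̄})². It is also ∂ⱼ∂̄ⱼ of the real
function k_{jj̄} minus a Hermitian square, hence real. -/
theorem IsLocallyProjectivelyFlat.star_curvFactor (hk : IsHermitianMetric D k) (hD : IsOpen D)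
    (hflat : IsLocallyProjectivelyFlat D (hermitianNorm k)) (hz : z ∈ D) :
    star (curvFactor k z) = curvFactor k z := by
  rcases isEmpty_or_nonempty (Fin n) with hn | ⟨⟨j⟩⟩
  · simp [curvFactor]
  have hp := hk.posDef z hz
  have hH := hp.isHermitian
  have h1 : 2 * curvFactor k z * k z j j ^ 2 = dzbar (dz (fun w => k w j j) j) j z -
      ∑ p, christoffel k z p j j * dzbar (fun w => k w p j) j z := by
    rw [← sum_dzbar_christoffel_mul hk hD hz, hflat.sum_projCurv hk hD hz,
      hflat.projCurv_eq hk hD hz]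
    ring
  have h2 : ∑ p, christoffel k z p j j * dzbar (fun w => k w p j) j z =
      hermitianForm k z (fun p => christoffel k z p j j) (fun p => christoffel k z p j j) := by
    rw [hermitianForm_eq_sum_mul]
    refine Finset.sum_congr rfl fun p _ => ?_
    rw [hk.dzbar_eq_star hD hz, ← sum_christoffel_mul hp, star_sum]
    congr 1
    refine Finset.sum_congr rfl fun q _ => ?_
    rw [star_mul', hH.apply, mul_comm]
  have h3 : star (dzbar (dz (fun w => k w j j) j) j z) = dzbar (dz (fun w => k w j j) j) j z := by
    have hev : (fun w => k w j j) =ᶠ[𝓝 z] fun w => (((k w j j).re : ℝ) : ℂ) := by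
      filter_upwards [hD.mem_nhds hz] with w hw
      exact (Complex.conj_eq_iff_re.1 ((hk.posDef w hw).isHermitian.apply j j)).symm
    have hs : ContDiffAt ℝ ∞ (fun w => (((k w j j).re : ℝ) : ℂ)) z :=
      (hk.contDiffAt hD hz j j).congr_of_eventuallyEq hev.symm
    have hev' : dzbar (fun w => k w j j) j =ᶠ[𝓝 z]
        dzbar (fun w => (((k w j j).re : ℝ) : ℂ)) j := by
      filter_upwards [hev.eventuallyEq_nhds] with w hw using dzbar_congr hw j
    rw [dzbar_dz_comm (hk.contDiffAt hD hz j j), dz_congr hev']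
    exact star_dz_dzbar hs j j
  have h4 := congrArg star h1
  rw [star_sub, h3, h2, hermitianForm_star hH, ← h2, ← h1] at h4
  have hjj : k z j j ≠ 0 := hp.diag_pos.ne'
  rw [star_mul', star_mul', star_pow, hH.apply] at h4
  have h5 : (2 : ℂ) * k z j j ^ 2 ≠ 0 := mul_ne_zero two_ne_zero (pow_ne_zero 2 hjj)
  apply mul_left_cancel₀ h5
  have : star (2 : ℂ) = 2 := by simp
  rw [this] at h4
  linear_combination h4

theorem contDiffAt_curvFactor (hk : IsHermitianMetric D k) (hD : IsOpen D) (hz : z ∈ D) :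
    ContDiffAt ℝ ∞ (curvFactor k) z :=
  contDiffAt_const.mul (ContDiffAt.sum fun i _ => ContDiffAt.sum fun l _ =>
    (contDiffAt_inv_apply (hk.contDiffAt hD hz) (hk.posDef z hz).det_pos.ne' l i).mul
      (contDiffAt_const.mul (contDiffAt_dzbar (hk.contDiffAt_christoffel hD hz i i i) l)))

/-- Schur's lemma. -/
theorem IsLocallyProjectivelyFlat.dzbar_curvFactor (hk : IsHermitianMetric D k) (hD : IsOpen D)
    (hflat : IsLocallyProjectivelyFlat D (hermitianNorm k)) (hn : 2 ≤ n) (hz : z ∈ D)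
    (s : Fin n) : dzbar (curvFactor k) s z = 0 := by
  have hu := (hk.posDef z hz).isUnit
  have hdc : DifferentiableAt ℝ (curvFactor k) z :=
    (contDiffAt_curvFactor hk hD hz).differentiableAt (by simp)
  have h1 (j m s : Fin n) : 1 / 2 * dzbar (dzbar (fun w => christoffel k w j j j) m) s z =
      dzbar (curvFactor k) s z * k z j m + curvFactor k z * dzbar (fun w => k w j m) s z := by
    rw [← dzbar_mul hdc (hk.differentiableAt hD hz j m), ← dzbar_const_mul
      ((contDiffAt_dzbar (hk.contDiffAt_christoffel hD hz j j j) m).differentiableAt (by simp))]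
    refine dzbar_congr ?_ s
    filter_upwards [hD.mem_nhds hz] with w hw using hflat.projCurv_eq hk hD hw j m
  -- By construction κk is ½∂̄ of a connection coefficient, so its ∂̄ derivative is symmetric in the
  -- two barred indices. The same holds for ∂̄k by the Kähler condition, leaving this symmetry for
  -- ∂̄κ ⊗ k. Its trace is n∂̄κ = ∂̄κ.
  have h2 (j m : Fin n) : dzbar (curvFactor k) s z * k z j m =
      dzbar (curvFactor k) m z * k z j s := by
    have a := h1 j m s
    have b := h1 j s m
    rw [dzbar_dzbar_comm (hk.contDiffAt_christoffel hD hz j j j),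
      (hflat.isKahler hk hD).dzbar_comm hk hD hz] at a
    linear_combination b - a
  have h3 : (n : ℂ) * dzbar (curvFactor k) s z = dzbar (curvFactor k) s z := by
    calc (n : ℂ) * dzbar (curvFactor k) s z =
        ∑ j, ∑ m, (k z)⁻¹ m j * (dzbar (curvFactor k) s z * k z j m) := by
          rw [← sum_inv_mul_sum_swap hu, Finset.sum_mul]
          refine Finset.sum_congr rfl fun i _ => ?_
          rw [Finset.sum_mul]
          exact Finset.sum_congr rfl fun l _ => by ring
      _ = ∑ m, dzbar (curvFactor k) m z * ∑ j, (k z)⁻¹ m j * k z j s := by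
          simp only [h2, Finset.mul_sum]
          rw [Finset.sum_comm]
          exact Finset.sum_congr rfl fun i _ => Finset.sum_congr rfl fun l _ => by ring
      _ = _ := by simp [sum_inv_mul hu]
  have h4 : ((n : ℂ) - 1) * dzbar (curvFactor k) s z = 0 := by linear_combination h3
  refine (mul_eq_zero.1 h4).resolve_left (sub_ne_zero.2 ?_)
  exact_mod_cast (by omega : n ≠ 1)

/-- As κ is real, ∂̄κ = 0 also gives ∂κ = 0, so the real differential vanishes on a connected open
set. -/
theorem IsLocallyProjectivelyFlat.exists_curvFactor_eq (hk : IsHermitianMetric D k)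
    (hD : IsOpen D) (hconn : IsConnected D)
    (hflat : IsLocallyProjectivelyFlat D (hermitianNorm k)) (hn : 2 ≤ n) :
    ∃ c : ℝ, ∀ z ∈ D, curvFactor k z = c := by
  obtain ⟨z₀, hz₀⟩ := hconn.nonempty
  refine ⟨(curvFactor k z₀).re, fun z hz => ?_⟩
  rw [Complex.conj_eq_iff_re.1 (hflat.star_curvFactor hk hD hz₀)]
  refine hD.is_const_of_fderiv_eq_zero (𝕜 := ℝ) hconn.isPreconnected (fun w hw =>
    ((contDiffAt_curvFactor hk hD hw).differentiableAt (by simp)).differentiableWithinAt) ?_ hz hz₀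
  intro w hw
  ext v
  rw [fderiv_eq_sum]
  have h1 (s : Fin n) : dz (curvFactor k) s w = 0 := by
    have hev : curvFactor k =ᶠ[𝓝 w] fun u => star (curvFactor k u) := by
      filter_upwards [hD.mem_nhds hw] with u hu using (hflat.star_curvFactor hk hD hu).symm
    rw [dz_congr hev, dz_star, hflat.dzbar_curvFactor hk hD hn hw, star_zero]
  simp [h1, hflat.dzbar_curvFactor hk hD hn hw]

/-- The conjugate derivative of the spray is κ times the lowered η times η itself, so the full
contraction is κ times the fourth power of the norm. -/
theorem IsLocallyProjectivelyFlat.holCurvature_eq (hk : IsHermitianMetric D k) (hD : IsOpen D)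
    (hflat : IsLocallyProjectivelyFlat D (hermitianNorm k)) (hz : z ∈ D) (hη : η ≠ 0) :
    holCurvature (hermitianNorm k) z η = -4 * curvFactor k z := by
  have hp := hk.posDef z hz
  have hG (i m : Fin n) : dzbar (fun w => spray (hermitianNorm k) w η i) m z =
      curvFactor k z * (∑ j, k z j m * η j) * η i := by
    have hev : (fun w => spray (hermitianNorm k) w η i) =ᶠ[𝓝 z]
        fun w => (1 / 2 : ℂ) * ∑ j, ∑ l, christoffel k w i j l * (η l * η j) := by
      filter_upwards [hD.mem_nhds hz] with w hw
      rw [spray_hermitianNorm hk hD hw]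
      simp only [mul_assoc]
    have hdΓ (j l : Fin n) : DifferentiableAt ℝ (fun w => christoffel k w i j l * (η l * η j)) z :=
      ((hk.contDiffAt_christoffel hD hz i j l).differentiableAt (by simp)).mul_const _
    have hdΓ' (j : Fin n) :
        DifferentiableAt ℝ (fun w => ∑ l, christoffel k w i j l * (η l * η j)) z :=
      DifferentiableAt.fun_sum fun l _ => hdΓ j l
    rw [dzbar_congr hev, dzbar_const_mul (DifferentiableAt.fun_sum fun j _ => hdΓ' j),
      dzbar_sum fun j _ => hdΓ' j]
    have h1 (j : Fin n) : dzbar (fun w => ∑ l, christoffel k w i j l * (η l * η j)) m z =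
        curvFactor k z * k z j m * η j * η i +
          (if i = j then 1 else 0) * (curvFactor k z * ∑ l, k z l m * η l) * η j := by
      rw [dzbar_sum fun l _ => hdΓ j l]
      have (l : Fin n) : dzbar (fun w => christoffel k w i j l * (η l * η j)) m z =
          (if i = l then 1 else 0) * η l * (curvFactor k z * k z j m * η j) +
          (if i = j then 1 else 0) * curvFactor k z * η j * (k z l m * η l) := by
        rw [dzbar_mul_const ((hk.contDiffAt_christoffel hD hz i j l).differentiableAt (by simp)),
          hflat.dzbar_christoffel hk hD hz, hflat.projCurv_eq hk hD hz, hflat.projCurv_eq hk hD hz]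
        ring
      simp only [this, Finset.sum_add_distrib, ← Finset.sum_mul, ← Finset.mul_sum]
      simp only [ite_mul, one_mul, zero_mul, Finset.sum_ite_eq, Finset.mem_univ, if_true]
      split_ifs <;> ring
    simp only [h1, Finset.sum_add_distrib, ← Finset.sum_mul]
    simp only [ite_mul, one_mul, zero_mul, Finset.sum_ite_eq, Finset.mem_univ, if_true,
      mul_assoc, ← Finset.mul_sum]
    ring
  have hA := hermitianForm_pos hp hη
  have hF : (hermitianNorm k z η : ℂ) ^ 4 = hermitianForm k z η η ^ 2 := by
    rw [← hermitianNorm_sq hp]; push_cast; ring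
  rw [holCurvature, hF]
  have hsum : ∑ i, ∑ m, ∑ l, fundamentalTensor (hermitianNorm k) z η i m *
      dzbar (fun w => spray (hermitianNorm k) w η i) l z * star (η l) * star (η m) =
      curvFactor k z * (hermitianForm k z η η * hermitianForm k z η η) := by
    calc _ = ∑ i, ∑ m, (k z i m * η i * star (η m)) *
          (curvFactor k z * ∑ l, (∑ p, k z p l * η p) * star (η l)) := by
          simp only [hG, fundamentalTensor_hermitianNorm hp]
          refine Finset.sum_congr rfl fun i _ => Finset.sum_congr rfl fun m _ => ?_
          rw [Finset.mul_sum, Finset.mul_sum]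
          exact Finset.sum_congr rfl fun l _ => by ring
      _ = _ := by
          rw [← hermitianForm_eq_sum_mul']
          simp only [← Finset.sum_mul]
          rw [← hermitianForm]
          ring
  rw [hsum]
  field_simp [hA.ne']

end Curvature

/-! ### Irrationality of √(p + q|t|²) in one complex variable -/

section OneVariable

/-- Two polynomials in r that agree on a half-line coincide. The left one has odd degree unless x +
ry vanishes identically, and the right one is a square. -/
theorem quadratic_sqrt_rigidity {p q x y x' y' : ℂ} (hq : q ≠ 0) {M : ℝ}
    (H : ∀ r : ℝ, M < r → (p + q * r) * (x + r * y) ^ 2 = (x' + r * y') ^ 2) :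
    x = 0 ∧ y = 0 ∧ x' = 0 ∧ y' = 0 := by
  open Polynomial in
  set U : ℂ[X] := C x + C y * X with hU
  set V : ℂ[X] := C x' + C y' * X with hV
  set S : ℂ[X] := C q * X + C p with hS
  have hpoly : S * U ^ 2 = V ^ 2 := by
    refine Polynomial.eq_of_infinite_eval_eq _ _ ?_
    have hinf : ((fun r : ℝ => (r : ℂ)) '' Ioi M).Infinite :=
      (Ioi_infinite M).image Complex.ofReal_injective.injOn
    refine hinf.mono ?_
    rintro _ ⟨r, hr, rfl⟩
    have := H r hr
    simp only [Set.mem_ofPred_eq, hU, hV, hS, Polynomial.eval_mul, Polynomial.eval_pow,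
      Polynomial.eval_add, Polynomial.eval_C, Polynomial.eval_X]
    linear_combination this
  have hS1 : S.natDegree = 1 := Polynomial.natDegree_linear hq
  have hS0 : S ≠ 0 := by
    intro h0; rw [h0] at hS1; simp at hS1
  have hU0 : U = 0 := by
    by_contra hne
    have h1 := congrArg Polynomial.natDegree hpoly
    rw [Polynomial.natDegree_mul hS0 (pow_ne_zero 2 hne), Polynomial.natDegree_pow,
      Polynomial.natDegree_pow, hS1] at h1
    omega
  have hV0 : V = 0 := by
    rw [hU0] at hpoly
    simpa using hpoly.symm
  have key (x y : ℂ) (h : (C x + C y * X : ℂ[X]) = 0) : x = 0 ∧ y = 0 := by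
    have h0 := congrArg (fun P : ℂ[X] => P.coeff 0) h
    have h1 := congrArg (fun P : ℂ[X] => P.coeff 1) h
    simp at h0 h1
    exact ⟨h0, h1⟩
  exact ⟨(key x y hU0).1, (key x y hU0).2, (key x' y' hV0).1, (key x' y' hV0).2⟩

/-- The square root of `p + q|t|²` is not a quotient of functions that are affine in `t̄` with
entire coefficients. -/
theorem sqrt_norm_sq_rigidity {A C A' C' : ℂ → ℂ} (hA : Differentiable ℂ A)
    (hC : Differentiable ℂ C) (hA' : Differentiable ℂ A') (hC' : Differentiable ℂ C') {p q : ℝ}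
    (hp : 0 < p) (hq : 0 < q)
    (H : ∀ t : ℂ, (√(p + q * ‖t‖ ^ 2) : ℂ) * (A t + star t * C t) = A' t + star t * C' t)
    (t : ℂ) : A t = 0 ∧ C t = 0 ∧ A' t = 0 ∧ C' t = 0 := by
  -- On the circle |u| = r one has uū = r², so multiplying the hypothesis by u makes both sides
  -- entire in u. Agreement on the circle extends to the disc.
  have hball : ∀ r : ℝ, 0 < r → ∀ u ∈ closedBall (0 : ℂ) r,
      (√(p + q * r ^ 2) : ℂ) * (u * A u + r ^ 2 * C u) = u * A' u + r ^ 2 * C' u := by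
    intro r hr u hu
    have hd1 : Differentiable ℂ fun u =>
        (√(p + q * r ^ 2) : ℂ) * (u * A u + r ^ 2 * C u) := by fun_prop
    have hd2 : Differentiable ℂ fun u => u * A' u + r ^ 2 * C' u := by fun_prop
    have := Complex.eqOn_closure_of_eqOn_frontier (U := ball (0 : ℂ) r) isBounded_ball
      hd1.diffContOnCl hd2.diffContOnCl ?_
    · rw [closure_ball _ hr.ne'] at this
      exact this hu
    · intro v hv
      rw [frontier_ball _ hr.ne'] at hv
      have hv' : ‖v‖ = r := by simpa using hv
      have h1 := H v
      rw [hv'] at h1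
      have h2 : v * star v = (r : ℂ) ^ 2 := by
        rw [Complex.star_def, Complex.mul_conj, Complex.normSq_eq_norm_sq, hv']; push_cast; rfl
      simp only
      rw [← h2]
      linear_combination v * h1
  -- With t fixed the radius √r is free beyond |t|, and squaring gives a polynomial identity in r.
  -- The spurious factor t is removed afterwards by continuity.
  have hfix (t : ℂ) : t * A t = 0 ∧ C t = 0 ∧ t * A' t = 0 ∧ C' t = 0 := by
    refine quadratic_sqrt_rigidity (p := p) (q := q) (M := ‖t‖ ^ 2) (by exact_mod_cast hq.ne')
      fun r hr => ?_
    have hr0 : 0 < r := lt_of_le_of_lt (by positivity) hr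
    have h1 := hball (√r) (Real.sqrt_pos.2 hr0) t (by
      simpa using Real.le_sqrt_of_sq_le hr.le)
    have h2 : ((√r : ℝ) : ℂ) ^ 2 = r := by
      rw [← Complex.ofReal_pow, Real.sq_sqrt hr0.le]
    rw [h2, Real.sq_sqrt hr0.le] at h1
    have h3 : ((√(p + q * r) : ℝ) : ℂ) ^ 2 = p + q * r := by
      rw [← Complex.ofReal_pow, Real.sq_sqrt (by positivity)]; push_cast; rfl
    rw [← h1, mul_pow, h3]
  have hzero {A : ℂ → ℂ} (hA : Differentiable ℂ A) (h : ∀ t, t * A t = 0) : A t = 0 := by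
    have : A = fun _ => 0 := by
      refine Continuous.ext_on (dense_compl_singleton (0 : ℂ)) hA.continuous continuous_const ?_
      intro u hu
      exact (mul_eq_zero.1 (h u)).resolve_left hu
    rw [this]
  exact ⟨hzero hA fun t => (hfix t).1, (hfix t).2.1, hzero hA' fun t => (hfix t).2.2.1,
    (hfix t).2.2.2⟩

end OneVariable

/-! ### Linear algebra of the generalized Berwald condition on slices of a fibre -/

section Slices

variable {n : ℕ} {a : Matrix (Fin n) (Fin n) ℂ} {b η₀ : Fin n → ℂ}

theorem hermitianForm_add_left (h : (Fin n → ℂ) → Matrix (Fin n) (Fin n) ℂ)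
    (z η η' ζ : Fin n → ℂ) :
    hermitianForm h z (η + η') ζ = hermitianForm h z η ζ + hermitianForm h z η' ζ := by
  simp only [hermitianForm_eq_sum_mul, Pi.add_apply, add_mul, Finset.sum_add_distrib]

theorem hermitianForm_smul_left (h : (Fin n → ℂ) → Matrix (Fin n) (Fin n) ℂ)
    (c : ℂ) (z η ζ : Fin n → ℂ) :
    hermitianForm h z (c • η) ζ = c * hermitianForm h z η ζ := by
  simp only [hermitianForm_eq_sum_mul, Pi.smul_apply, smul_eq_mul, Finset.mul_sum, mul_assoc]

theorem hermitianForm_add_right (h : (Fin n → ℂ) → Matrix (Fin n) (Fin n) ℂ)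
    (z η ζ ζ' : Fin n → ℂ) :
    hermitianForm h z η (ζ + ζ') = hermitianForm h z η ζ + hermitianForm h z η ζ' := by
  simp only [hermitianForm_eq_sum_mul', Pi.add_apply, star_add, mul_add, Finset.sum_add_distrib]

theorem hermitianForm_smul_right (h : (Fin n → ℂ) → Matrix (Fin n) (Fin n) ℂ)
    (c : ℂ) (z η ζ : Fin n → ℂ) :
    hermitianForm h z η (c • ζ) = star c * hermitianForm h z η ζ := by
  simp only [hermitianForm_eq_sum_mul', Pi.smul_apply, smul_eq_mul, star_mul', Finset.mul_sum]
  exact Finset.sum_congr rfl fun _ _ => by ring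

/-- The pairing `x_l ζ̄ˡ`. -/
noncomputable def pairing (x ζ : Fin n → ℂ) : ℂ := ∑ l, x l * star (ζ l)

theorem pairing_add_right (x ζ ζ' : Fin n → ℂ) :
    pairing x (ζ + ζ') = pairing x ζ + pairing x ζ' := by
  simp [pairing, mul_add, Finset.sum_add_distrib]

theorem pairing_smul_right (c : ℂ) (x ζ : Fin n → ℂ) :
    pairing x (c • ζ) = star c * pairing x ζ := by
  simp only [pairing, Pi.smul_apply, smul_eq_mul, star_mul', Finset.mul_sum]
  exact Finset.sum_congr rfl fun _ _ => by ring

theorem pairing_add_left (x x' ζ : Fin n → ℂ) :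
    pairing (x + x') ζ = pairing x ζ + pairing x' ζ := by
  simp [pairing, add_mul, Finset.sum_add_distrib]

theorem pairing_smul_left (c : ℂ) (x ζ : Fin n → ℂ) :
    pairing (c • x) ζ = c * pairing x ζ := by
  simp only [pairing, Pi.smul_apply, smul_eq_mul, Finset.mul_sum, mul_assoc]

theorem pairing_slice {G : (Fin n → ℂ) → (Fin n → ℂ)} {η₀ ζ : Fin n → ℂ}
    (hG : ∀ t : ℂ, DifferentiableAt ℂ G (η₀ + t • ζ)) (ξ : Fin n → ℂ) :
    Differentiable ℂ fun t : ℂ => pairing (G (η₀ + t • ζ)) ξ := by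
  intro t
  have h1 : DifferentiableAt ℂ (fun t : ℂ => η₀ + t • ζ) t := by fun_prop
  have h2 : DifferentiableAt ℂ (fun t : ℂ => G (η₀ + t • ζ)) t :=
    DifferentiableAt.comp (g := G) (f := fun t : ℂ => η₀ + t • ζ) t (hG t) h1
  exact DifferentiableAt.fun_sum fun l _ => (differentiableAt_pi.1 h2 l).mul_const _

/-- The line η₀ + tζ runs a-orthogonally to η₀, so β is a positive constant on it and α² = a(η₀, η₀)
+ |t|² a(ζ, ζ). Both brackets are affine in t̄ with entire coefficients, and `sqrt_norm_sq_rigidity`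
makes the coefficients vanish. -/
theorem slice_vanishing (ha : a.PosDef) (hη₀ : η₀ ≠ 0)
    (hdual : ∀ i, ∑ m, a i m * star (η₀ m) = b i) {p : (Fin n → ℂ) → ℂ}
    {E Y : (Fin n → ℂ) → (Fin n → ℂ)}
    (hp : ∀ η, ∑ i, b i * η i ≠ 0 → DifferentiableAt ℂ p η)
    (hE : ∀ η, ∑ i, b i * η i ≠ 0 → DifferentiableAt ℂ E η)
    (hY : ∀ η, ∑ i, b i * η i ≠ 0 → DifferentiableAt ℂ Y η)
    (H : ∀ η, ∑ i, b i * η i ≠ 0 →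
      (√(hermitianForm (fun _ => a) 0 η η).re : ℂ) * (star (∑ i, b i * η i) * p η +
        (∑ i, b i * η i) * pairing (Y η) η) = ‖∑ i, b i * η i‖ * pairing (E η) η)
    {ζ : Fin n → ℂ} (hζ : ζ ≠ 0) (hbζ : ∑ i, b i * ζ i = 0) (t : ℂ) :
    p (η₀ + t • ζ) + pairing (Y (η₀ + t • ζ)) η₀ = 0 ∧ pairing (Y (η₀ + t • ζ)) ζ = 0 ∧
      pairing (E (η₀ + t • ζ)) η₀ = 0 := by
  set A := hermitianForm (fun _ : Fin n → ℂ => a) 0 with hA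
  have hA0 (η : Fin n → ℂ) : A η η₀ = ∑ i, b i * η i := by
    rw [hA, hermitianForm_eq_sum_mul]
    exact Finset.sum_congr rfl fun i _ => by rw [hdual, mul_comm]
  have hpos : 0 < (A η₀ η₀).re := hermitianForm_re_pos (k := fun _ => a) ha hη₀
  have hqos : 0 < (A ζ ζ).re := hermitianForm_re_pos (k := fun _ => a) ha hζ
  have hre (η : Fin n → ℂ) : ((A η η).re : ℂ) = A η η :=
    hermitianForm_ofReal_re (k := fun _ => a) ha.isHermitian η
  have hβ (t : ℂ) : ∑ i, b i * (η₀ + t • ζ) i = (A η₀ η₀).re := by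
    rw [hre, hA0]
    have : ∑ i, b i * (η₀ + t • ζ) i = (∑ i, b i * η₀ i) + t * ∑ i, b i * ζ i := by
      simp only [Pi.add_apply, Pi.smul_apply, smul_eq_mul, mul_add, Finset.sum_add_distrib,
        Finset.mul_sum]
      congr 1
      exact Finset.sum_congr rfl fun _ _ => by ring
    rw [this, hbζ]; ring
  have hβ0 : ((A η₀ η₀).re : ℂ) ≠ 0 := by exact_mod_cast hpos.ne'
  have hne (t : ℂ) : ∑ i, b i * (η₀ + t • ζ) i ≠ 0 := by rw [hβ]; exact hβ0
  have hnorm (t : ℂ) : (A (η₀ + t • ζ) (η₀ + t • ζ)).re =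
      (A η₀ η₀).re + (A ζ ζ).re * ‖t‖ ^ 2 := by
    have h1 : A ζ η₀ = 0 := by rw [hA0, hbζ]
    have h2 : A η₀ ζ = 0 := by
      rw [hA, ← hermitianForm_star (k := fun _ => a) (z := 0) ha.isHermitian, ← hA, h1, star_zero]
    have h3 : A (η₀ + t • ζ) (η₀ + t • ζ) = A η₀ η₀ + (t * star t) * A ζ ζ := by
      rw [hA, hermitianForm_add_left, hermitianForm_add_right, hermitianForm_add_right,
        hermitianForm_smul_left, hermitianForm_smul_left, hermitianForm_smul_right,
        hermitianForm_smul_right, ← hA, h1, h2]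
      ring
    rw [h3, Complex.star_def, Complex.mul_conj, Complex.add_re, Complex.re_ofReal_mul,
      Complex.normSq_eq_norm_sq, mul_comm (‖t‖ ^ 2)]
  have hline : Differentiable ℂ fun t : ℂ => η₀ + t • ζ := by fun_prop
  have key := sqrt_norm_sq_rigidity
    (A := fun t => p (η₀ + t • ζ) + pairing (Y (η₀ + t • ζ)) η₀)
    (C := fun t => pairing (Y (η₀ + t • ζ)) ζ)
    (A' := fun t => pairing (E (η₀ + t • ζ)) η₀) (C' := fun t => pairing (E (η₀ + t • ζ)) ζ)
    (Differentiable.fun_add (fun t => DifferentiableAt.comp (g := p)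
      (f := fun t : ℂ => η₀ + t • ζ) t (hp _ (hne t)) (hline t))
      (pairing_slice (fun t => hY _ (hne t)) η₀))
    (pairing_slice (fun t => hY _ (hne t)) ζ) (pairing_slice (fun t => hE _ (hne t)) η₀)
    (pairing_slice (fun t => hE _ (hne t)) ζ) hpos hqos ?_ t
  · exact ⟨key.1, key.2.1, key.2.2.1⟩
  · intro t
    have h1 := H _ (hne t)
    rw [hnorm, hβ, pairing_add_right, pairing_add_right, pairing_smul_right,
      pairing_smul_right, Complex.norm_real, Real.norm_of_nonneg hpos.le, Complex.star_def,
      Complex.conj_ofReal] at h1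
    apply mul_left_cancel₀ hβ0
    rw [Complex.star_def]
    linear_combination h1

/-- Dimension at least two enters the rigidity argument here: without a kernel direction there is no
slice. -/
theorem exists_ne_zero_of_two_le (hn : 2 ≤ n) (b : Fin n → ℂ) :
    ∃ ζ : Fin n → ℂ, ζ ≠ 0 ∧ ∑ i, b i * ζ i = 0 := by
  let ℓ : (Fin n → ℂ) →ₗ[ℂ] ℂ := ∑ i, b i • LinearMap.proj i
  have hℓ (ζ : Fin n → ℂ) : ℓ ζ = ∑ i, b i * ζ i := by simp [ℓ]
  have h1 : LinearMap.ker ℓ ≠ ⊥ := LinearMap.ker_ne_bot_of_finrank_lt (by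
    simp only [Module.finrank_self, Module.finrank_fin_fun]; omega)
  obtain ⟨ζ, hζ, hne⟩ := (Submodule.ne_bot_iff _).1 h1
  exact ⟨ζ, hne, by rw [← hℓ]; exact hζ⟩

/-- The algebraic content of the generalized Berwald condition for a complex Randers metric. -/
theorem berwald_algebra (hn : 2 ≤ n) (ha : a.PosDef) (hη₀ : η₀ ≠ 0)
    (hdual : ∀ i, ∑ m, a i m * star (η₀ m) = b i) {Q : (Fin n → ℂ) → ℂ}
    {X G : (Fin n → ℂ) → (Fin n → ℂ)} {Y : (Fin n → ℂ) →L[ℂ] (Fin n → ℂ)}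
    (hQ : Differentiable ℂ Q) (hX : Differentiable ℂ X)
    (hQ2 : ∀ (c : ℂ) η, Q (c • η) = c ^ 2 * Q η) (hX2 : ∀ (c : ℂ) η, X (c • η) = c ^ 2 • X η)
    (hG : ∀ η, ∑ i, b i * η i ≠ 0 → DifferentiableAt ℂ G η)
    (H : ∀ η, ∑ i, b i * η i ≠ 0 →
      (√(hermitianForm (fun _ => a) 0 η η).re : ℂ) *
        (star (∑ i, b i * η i) * (Q η - 2 * ∑ i, b i * G η i) +
        (∑ i, b i * η i) * pairing (Y η) η) =
      ‖∑ i, b i * η i‖ * (2 * hermitianForm (fun _ => a) 0 (G η) η - pairing (X η) η))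
    (η ζ : Fin n → ℂ) :
    (∑ i, b i * η i) * pairing (Y η) ζ = (pairing (X η) η₀ - Q η) * star (∑ i, b i * ζ i) := by
  set B : (Fin n → ℂ) → ℂ := fun η => ∑ i, b i * η i with hB
  have hBd : Differentiable ℂ B := by simp only [hB]; fun_prop
  have hBadd (η ξ : Fin n → ℂ) : B (η + ξ) = B η + B ξ := by
    simp [hB, mul_add, Finset.sum_add_distrib]
  have hBsmul (c : ℂ) (η : Fin n → ℂ) : B (c • η) = c * B η := by
    simp only [hB, Pi.smul_apply, smul_eq_mul, Finset.mul_sum]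
    exact Finset.sum_congr rfl fun _ _ => by ring
  have hA0 (η : Fin n → ℂ) : hermitianForm (fun _ => a) 0 η η₀ = B η := by
    rw [hermitianForm_eq_sum_mul]
    exact Finset.sum_congr rfl fun i _ => by rw [hdual, mul_comm]
  have hβ0 : B η₀ ≠ 0 := by
    rw [← hA0]; exact (hermitianForm_pos (k := fun _ => a) ha hη₀).ne'
  have hβreal : star (B η₀) = B η₀ := by
    rw [← hA0]; exact hermitianForm_star (k := fun _ => a) ha.isHermitian η₀ η₀
  have hE (η ξ : Fin n → ℂ) : pairing (fun l => 2 * ∑ i, a i l * G η i - X η l) ξ =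
      2 * hermitianForm (fun _ => a) 0 (G η) ξ - pairing (X η) ξ := by
    rw [pairing, pairing, hermitianForm_eq_sum_mul', Finset.mul_sum, ← Finset.sum_sub_distrib]
    exact Finset.sum_congr rfl fun _ _ => by ring
  have key {ξ : Fin n → ℂ} (hξ : ξ ≠ 0) (hbξ : B ξ = 0) (t : ℂ) :=
    slice_vanishing (a := a) (b := b) (p := fun η => Q η - 2 * B (G η))
      (E := fun η l => 2 * ∑ i, a i l * G η i - X η l) (Y := Y) ha hη₀ hdual
      (fun η hη => (hQ η).fun_sub
        ((DifferentiableAt.comp (g := B) (f := G) η (hBd _) (hG η hη)).const_mul 2))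
      (fun η hη => differentiableAt_pi.2 fun l =>
        (DifferentiableAt.const_mul (DifferentiableAt.fun_sum fun i _ =>
          (differentiableAt_pi.1 (hG η hη) i).const_mul _) _).fun_sub
          (differentiableAt_pi.1 (hX η) l))
      (fun η _ => Y.differentiableAt)
      (fun η hη => by rw [hE]; exact H η hη) hξ hbξ t
  simp only [hE, hA0] at key
  -- Since a(G, η₀) = β(G), adding the first and third conclusions of `slice_vanishing` eliminates
  -- the unknown G. For ξ = 0 any kernel direction will do, at t = 0.
  have hker {ξ : Fin n → ℂ} (hbξ : B ξ = 0) :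
      Q (η₀ + ξ) - pairing (X (η₀ + ξ)) η₀ + pairing (Y (η₀ + ξ)) η₀ = 0 := by
    rcases eq_or_ne ξ 0 with rfl | hξ
    · obtain ⟨ξ₁, h1, h2⟩ := exists_ne_zero_of_two_le hn b
      have h3 := key h1 h2 0
      rw [zero_smul] at h3
      linear_combination h3.1 + h3.2.2
    · have h3 := key hξ hbξ 1
      rw [one_smul] at h3
      linear_combination h3.1 + h3.2.2
  -- Every η off the kernel of β is a multiple of a point of the affine hyperplane η₀ + ker β, and
  -- all terms here are homogeneous of degree two.
  have hZ1 (η : Fin n → ℂ) (hη : B η ≠ 0) :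
      B η₀ * (Q η - pairing (X η) η₀) + B η * pairing (Y η) η₀ = 0 := by
    set c : ℂ := B η / B η₀ with hc
    have hc0 : c ≠ 0 := div_ne_zero hη hβ0
    have h1 : η = c • (η₀ + (c⁻¹ • η - η₀)) := by
      rw [add_sub_cancel, smul_inv_smul₀ hc0]
    have h2 : B (c⁻¹ • η - η₀) = 0 := by
      rw [sub_eq_add_neg, ← neg_one_smul ℂ η₀, hBadd, hBsmul, hBsmul, hc]
      field_simp
      ring
    have h3 := hker h2
    have h4 : B η = c * B η₀ := by rw [hc]; field_simp
    rw [h4]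
    conv_lhs => rw [h1]
    rw [hQ2, hX2, map_smul, pairing_smul_left, pairing_smul_left]
    linear_combination (c ^ 2 * B η₀) * h3
  have hZ (η : Fin n → ℂ) :
      B η₀ * (Q η - pairing (X η) η₀) + B η * pairing (Y η) η₀ = 0 := by
    rcases eq_or_ne (B η) 0 with hη | hη
    -- Vectors in the kernel of β are reached as limits along the direction η₀.
    · have hcont : Continuous fun t : ℂ => B η₀ * (Q (η + t • η₀) - pairing (X (η + t • η₀)) η₀) +
          B (η + t • η₀) * pairing (Y (η + t • η₀)) η₀ := by
        have hl : Continuous fun t : ℂ => η + t • η₀ := by fun_prop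
        refine Continuous.add (continuous_const.mul ((hQ.continuous.comp hl).sub ?_))
          ((hBd.continuous.comp hl).mul ?_)
        · exact (pairing_slice (fun t => hX _) η₀).continuous
        · exact (pairing_slice (fun t => Y.differentiableAt) η₀).continuous
      have hfun := Continuous.ext_on (dense_compl_singleton (0 : ℂ)) hcont
        (continuous_const (y := (0 : ℂ))) fun t ht => hZ1 _ (by
          rw [hBadd, hBsmul, hη, zero_add]
          exact mul_ne_zero ht hβ0)
      simpa using congrFun hfun 0
    · exact hZ1 η hη
  have hYker {ξ : Fin n → ℂ} (hbξ : B ξ = 0) :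
      pairing (Y η₀) ξ = 0 ∧ pairing (Y ξ) ξ = 0 := by
    rcases eq_or_ne ξ 0 with rfl | hξ
    · simp [pairing]
    · have h0 := (key hξ hbξ 0).2.1
      have h1 := (key hξ hbξ 1).2.1
      rw [zero_smul, add_zero] at h0
      rw [one_smul, map_add, pairing_add_left, h0, zero_add] at h1
      exact ⟨h0, h1⟩
  -- The sesquilinear form (ξ', ξ) ↦ ⟨Y ξ', ξ⟩ vanishes on the diagonal of ker β; polarize with the
  -- coefficients 1 and i.
  have hpol {ξ ξ' : Fin n → ℂ} (h : B ξ = 0) (h' : B ξ' = 0) : pairing (Y ξ') ξ = 0 := by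
    have h1 := (hYker (ξ := ξ + (1 : ℂ) • ξ') (by rw [hBadd, hBsmul, h, h']; ring)).2
    have h2 := (hYker (ξ := ξ + Complex.I • ξ') (by rw [hBadd, hBsmul, h, h']; ring)).2
    simp only [map_add, map_smul, pairing_add_left, pairing_add_right, pairing_smul_left,
      pairing_smul_right, (hYker h).2, (hYker h').2, Complex.star_def, Complex.conj_I,
      map_one] at h1 h2
    linear_combination (1 / 2) * h1 - (1 / 2) * Complex.I * h2 +
      (1 / 2) * (pairing (Y ξ') ξ - pairing (Y ξ) ξ') * Complex.I_mul_I
  have hsplit (η : Fin n → ℂ) :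
      η = (B η / B η₀) • η₀ + (η - (B η / B η₀) • η₀) := by abel
  have hsplit' (η : Fin n → ℂ) : B (η - (B η / B η₀) • η₀) = 0 := by
    rw [sub_eq_add_neg, ← neg_one_smul ℂ, hBadd, hBsmul, hBsmul]
    field_simp
    ring
  have hYgen (η : Fin n → ℂ) {ξ : Fin n → ℂ} (h : B ξ = 0) : pairing (Y η) ξ = 0 := by
    rw [hsplit η, map_add, map_smul, pairing_add_left, pairing_smul_left, (hYker h).1,
      hpol h (hsplit' η)]
    ring
  have h1 : pairing (Y η) ζ = star (B ζ) / B η₀ * pairing (Y η) η₀ := by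
    conv_lhs => rw [hsplit ζ]
    rw [pairing_add_right, pairing_smul_right, hYgen η (hsplit' ζ), star_div₀, hβreal, add_zero]
  rw [h1]
  have h2 := hZ η
  field_simp
  linear_combination star (B ζ) * h2

end Slices

/-! ### Complex Randers metrics: smoothness off ker β and the fundamental tensor -/

section Randers

variable {n : ℕ} {D : Set (Fin n → ℂ)} {a : (Fin n → ℂ) → Matrix (Fin n) (Fin n) ℂ}
  {b : (Fin n → ℂ) → (Fin n → ℂ)} {z η : Fin n → ℂ}

/-- `β(z, η) = b_i ηⁱ`. -/
noncomputable def oneForm (b : (Fin n → ℂ) → (Fin n → ℂ)) (z η : Fin n → ℂ) : ℂ :=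
  ∑ i, b z i * η i

/-- The complex Randers metric `α + |β|`. -/
noncomputable def randers (a : (Fin n → ℂ) → Matrix (Fin n) (Fin n) ℂ)
    (b : (Fin n → ℂ) → (Fin n → ℂ)) (z η : Fin n → ℂ) : ℝ :=
  hermitianNorm a z η + ‖oneForm b z η‖

/-- `α |β|`. -/
noncomputable def randersCross (a : (Fin n → ℂ) → Matrix (Fin n) (Fin n) ℂ)
    (b : (Fin n → ℂ) → (Fin n → ℂ)) (z η : Fin n → ℂ) : ℂ :=
  ((hermitianNorm a z η * ‖oneForm b z η‖ : ℝ) : ℂ)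

theorem oneForm_smul (c : ℂ) (z η : Fin n → ℂ) : oneForm b z (c • η) = c * oneForm b z η := by
  simp only [oneForm, Pi.smul_apply, smul_eq_mul, Finset.mul_sum]
  exact Finset.sum_congr rfl fun _ _ => by ring

theorem ne_zero_of_oneForm (hη : oneForm b z η ≠ 0) : η ≠ 0 := by
  rintro rfl; simp [oneForm] at hη

theorem oneForm_mul_star (z η : Fin n → ℂ) :
    oneForm b z η * star (oneForm b z η) = ((‖oneForm b z η‖ ^ 2 : ℝ) : ℂ) := by
  rw [Complex.star_def, Complex.mul_conj, Complex.normSq_eq_norm_sq]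

/-- The product α|β| involves roots but its square is polynomial in η and η̄. All derivatives of
α|β| are obtained by differentiating this identity. -/
theorem randersCross_sq (ha : (a z).PosDef) (η : Fin n → ℂ) :
    randersCross a b z η * randersCross a b z η =
      hermitianForm a z η η * (oneForm b z η * star (oneForm b z η)) := by
  rw [oneForm_mul_star, ← hermitianNorm_sq ha, randersCross]
  push_cast; ring

theorem energy_randers (ha : (a z).PosDef) (η : Fin n → ℂ) :
    energy (randers a b) z η = hermitianForm a z η η +
      oneForm b z η * star (oneForm b z η) + 2 * randersCross a b z η := by
  rw [oneForm_mul_star, ← hermitianNorm_sq ha, randersCross, energy, randers]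
  push_cast; ring

theorem hermitianNorm_smul (c : ℂ) (z η : Fin n → ℂ) :
    hermitianNorm a z (c • η) = ‖c‖ * hermitianNorm a z η := by
  rw [hermitianNorm, hermitianForm_smul_left, hermitianForm_smul_right, ← mul_assoc,
    Complex.star_def, Complex.mul_conj, Complex.re_ofReal_mul, Complex.normSq_eq_norm_sq,
    Real.sqrt_mul (sq_nonneg _), Real.sqrt_sq (norm_nonneg c), hermitianNorm]

theorem randers_smul (c : ℂ) (z η : Fin n → ℂ) :
    randers a b z (c • η) = ‖c‖ * randers a b z η := by
  rw [randers, randers, hermitianNorm_smul, oneForm_smul, norm_mul]; ring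

/-! ### Smoothness -/

theorem contDiffAt_hermitianForm (ha : IsHermitianMetric D a) (hD : IsOpen D) (hz : z ∈ D) :
    ContDiffAt ℝ ∞ (fun p : (Fin n → ℂ) × (Fin n → ℂ) => hermitianForm a p.1 p.2 p.2) (z, η) := by
  have hproj (i : Fin n) :
      ContDiffAt ℝ ∞ (fun p : (Fin n → ℂ) × (Fin n → ℂ) => p.2 i) (z, η) := by fun_prop
  have hstar (i : Fin n) :
      ContDiffAt ℝ ∞ (fun p : (Fin n → ℂ) × (Fin n → ℂ) => star (p.2 i)) (z, η) :=
    ContDiffAt.comp (g := fun x : ℂ => star x) (z, η)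
      (starL' (R := ℝ) (A := ℂ) : ℂ ≃L[ℝ] ℂ).contDiff.contDiffAt (hproj i)
  refine ContDiffAt.sum fun i _ => ContDiffAt.sum fun j _ => ?_
  exact (((ha.contDiffAt hD hz i j).comp (f := Prod.fst) (z, η) contDiffAt_fst).mul
    (hproj i)).mul (hstar j)

theorem contDiffAt_oneForm (hb : ∀ i, ContDiffAt ℝ ∞ (fun w => b w i) z) :
    ContDiffAt ℝ ∞ (fun p : (Fin n → ℂ) × (Fin n → ℂ) => oneForm b p.1 p.2) (z, η) := by
  have hproj (i : Fin n) :
      ContDiffAt ℝ ∞ (fun p : (Fin n → ℂ) × (Fin n → ℂ) => p.2 i) (z, η) := by fun_prop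
  exact ContDiffAt.sum fun i _ => ((hb i).comp (f := Prod.fst) (z, η) contDiffAt_fst).mul (hproj i)

theorem contDiffAt_hermitianNorm (ha : IsHermitianMetric D a) (hD : IsOpen D) (hz : z ∈ D)
    (hη : η ≠ 0) :
    ContDiffAt ℝ ∞ (fun p : (Fin n → ℂ) × (Fin n → ℂ) => hermitianNorm a p.1 p.2) (z, η) := by
  refine ContDiffAt.sqrt ?_ (hermitianForm_re_pos (ha.posDef z hz) hη).ne'
  exact ContDiffAt.comp (g := Complex.re) (z, η) Complex.reCLM.contDiff.contDiffAt
    (contDiffAt_hermitianForm ha hD hz)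

theorem contDiffAt_randers (ha : IsHermitianMetric D a) (hD : IsOpen D) (hz : z ∈ D)
    (hb : ∀ i, ContDiffAt ℝ ∞ (fun w => b w i) z) (hη : oneForm b z η ≠ 0) :
    ContDiffAt ℝ ∞ (Function.uncurry (randers a b)) (z, η) :=
  (contDiffAt_hermitianNorm ha hD hz (ne_zero_of_oneForm hη)).add
    ((contDiffAt_oneForm hb).norm ℝ hη)

theorem contDiffAt_energy_randers (ha : IsHermitianMetric D a) (hD : IsOpen D) (hz : z ∈ D)
    (hb : ∀ i, ContDiffAt ℝ ∞ (fun w => b w i) z) (hη : oneForm b z η ≠ 0) :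
    ContDiffAt ℝ ∞ (Function.uncurry (energy (randers a b))) (z, η) :=
  Complex.ofRealCLM.contDiff.contDiffAt.comp (z, η) ((contDiffAt_randers ha hD hz hb hη).pow 2)

theorem contDiffAt_randersCross (ha : IsHermitianMetric D a) (hD : IsOpen D) (hz : z ∈ D)
    (hb : ∀ i, ContDiffAt ℝ ∞ (fun w => b w i) z) (hη : oneForm b z η ≠ 0) :
    ContDiffAt ℝ ∞ (Function.uncurry (randersCross a b)) (z, η) :=
  Complex.ofRealCLM.contDiff.contDiffAt.comp (z, η)
    ((contDiffAt_hermitianNorm ha hD hz (ne_zero_of_oneForm hη)).mul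
    ((contDiffAt_oneForm hb).norm ℝ hη))

theorem ContDiffAt.fiber {Φ : (Fin n → ℂ) → (Fin n → ℂ) → ℂ}
    (h : ContDiffAt ℝ ∞ (Function.uncurry Φ) (z, η)) : DifferentiableAt ℝ (Φ z) η :=
  (h.comp (f := fun ξ => (z, ξ)) η (contDiffAt_const.prodMk contDiffAt_id)).differentiableAt
    (by simp)

theorem ContDiffAt.base {Φ : (Fin n → ℂ) → (Fin n → ℂ) → ℂ}
    (h : ContDiffAt ℝ ∞ (Function.uncurry Φ) (z, η)) :
    DifferentiableAt ℝ (fun w => Φ w η) z :=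
  (h.comp (f := fun w => (w, η)) z (contDiffAt_id.prodMk contDiffAt_const)).differentiableAt
    (by simp)

/-! ### Fibre derivatives -/

theorem differentiable_oneForm (z : Fin n → ℂ) : Differentiable ℝ (oneForm b z) := by
  have : Differentiable ℂ (oneForm b z) := by unfold oneForm; fun_prop
  exact fun η => (this η).restrictScalars ℝ

theorem differentiable_star_oneForm (z : Fin n → ℂ) :
    Differentiable ℝ fun ζ => star (oneForm b z ζ) := (differentiable_oneForm z).star

theorem dz_oneForm (z η : Fin n → ℂ) (i : Fin n) : dz (oneForm b z) i η = b z i :=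
  dz_linear (b z) i η

theorem dzbar_oneForm (z η : Fin n → ℂ) (i : Fin n) : dzbar (oneForm b z) i η = 0 :=
  dzbar_linear (b z) i η

/-- `M_m = ∂(α²|β|²)/∂η̄ᵐ`. -/
noncomputable def crossGrad (a : (Fin n → ℂ) → Matrix (Fin n) (Fin n) ℂ)
    (b : (Fin n → ℂ) → (Fin n → ℂ)) (z η : Fin n → ℂ) (m : Fin n) : ℂ :=
  (∑ l, a z l m * η l) * (oneForm b z η * star (oneForm b z η)) +
    hermitianForm a z η η * (oneForm b z η * star (b z m))

theorem two_mul_dzbar_randersCross (ha : (a z).PosDef)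
    (hs : DifferentiableAt ℝ (randersCross a b z) η) (m : Fin n) :
    2 * (randersCross a b z η * dzbar (randersCross a b z) m η) = crossGrad a b z η m := by
  have h1 := dzbar_mul hs hs m
  simp only [randersCross_sq ha] at h1
  rw [dzbar_mul (differentiable_hermitianForm a z η)
    (((differentiable_oneForm z).fun_mul (differentiable_star_oneForm z)) η),
    dzbar_mul (differentiable_oneForm z η) (differentiable_star_oneForm z η), dzbar_star,
    dz_oneForm, dzbar_oneForm, dzbar_hermitianForm] at h1
  rw [crossGrad]
  linear_combination -h1

theorem two_mul_dz_randersCross (ha : (a z).PosDef)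
    (hs : DifferentiableAt ℝ (randersCross a b z) η) (i : Fin n) :
    2 * (randersCross a b z η * dz (randersCross a b z) i η) =
      (∑ m, a z i m * star (η m)) * (oneForm b z η * star (oneForm b z η)) +
        hermitianForm a z η η * (b z i * star (oneForm b z η)) := by
  have h1 := dz_mul hs hs i
  simp only [randersCross_sq ha] at h1
  rw [dz_mul (differentiable_hermitianForm a z η)
    (((differentiable_oneForm z).fun_mul (differentiable_star_oneForm z)) η),
    dz_mul (differentiable_oneForm z η) (differentiable_star_oneForm z η), dz_star,
    dz_oneForm, dzbar_oneForm, dz_hermitianForm, star_zero] at h1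
  linear_combination -h1

theorem dzbar_energy_randers (ha : (a z).PosDef)
    (hs : DifferentiableAt ℝ (randersCross a b z) η) (m : Fin n) :
    dzbar (energy (randers a b) z) m η = (∑ l, a z l m * η l) + oneForm b z η * star (b z m) +
      2 * dzbar (randersCross a b z) m η := by
  have h1 : energy (randers a b) z = fun ζ => hermitianForm a z ζ ζ +
      oneForm b z ζ * star (oneForm b z ζ) + 2 * randersCross a b z ζ :=
    funext fun ζ => energy_randers ha ζ
  rw [h1, dzbar_add ((differentiable_hermitianForm a z η).fun_add
      (((differentiable_oneForm z).fun_mul (differentiable_star_oneForm z)) η)) (hs.const_mul 2),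
    dzbar_add (differentiable_hermitianForm a z η)
      (((differentiable_oneForm z).fun_mul (differentiable_star_oneForm z)) η),
    dzbar_mul (differentiable_oneForm z η) (differentiable_star_oneForm z η), dzbar_star,
    dz_oneForm, dzbar_oneForm, dzbar_hermitianForm, dzbar_const_mul hs]
  ring

theorem dz_energy_randers (ha : (a z).PosDef)
    (hs : DifferentiableAt ℝ (randersCross a b z) η) (i : Fin n) :
    dz (energy (randers a b) z) i η = (∑ m, a z i m * star (η m)) +
      b z i * star (oneForm b z η) + 2 * dz (randersCross a b z) i η := by
  have h1 : energy (randers a b) z = fun ζ => hermitianForm a z ζ ζ +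
      oneForm b z ζ * star (oneForm b z ζ) + 2 * randersCross a b z ζ :=
    funext fun ζ => energy_randers ha ζ
  rw [h1, dz_add ((differentiable_hermitianForm a z η).fun_add
      (((differentiable_oneForm z).fun_mul (differentiable_star_oneForm z)) η)) (hs.const_mul 2),
    dz_add (differentiable_hermitianForm a z η)
      (((differentiable_oneForm z).fun_mul (differentiable_star_oneForm z)) η),
    dz_mul (differentiable_oneForm z η) (differentiable_star_oneForm z η), dz_star,
    dz_oneForm, dzbar_oneForm, dz_hermitianForm, dz_const_mul hs, star_zero]
  ring

theorem dz_crossGrad (z η : Fin n → ℂ) (i m : Fin n) :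
    dz (fun ζ => crossGrad a b z ζ m) i η =
      a z i m * (oneForm b z η * star (oneForm b z η)) +
      (∑ l, a z l m * η l) * (b z i * star (oneForm b z η)) +
      (∑ l, a z i l * star (η l)) * (oneForm b z η * star (b z m)) +
      hermitianForm a z η η * (b z i * star (b z m)) := by
  have hl : DifferentiableAt ℝ (fun ζ : Fin n → ℂ => ∑ l, a z l m * ζ l) η := by fun_prop
  have hB := differentiable_oneForm (b := b) z η
  have hB' := differentiable_star_oneForm (b := b) z η
  have hA := differentiable_hermitianForm a z η
  unfold crossGrad
  rw [dz_add (hl.fun_mul (hB.fun_mul hB')) (hA.fun_mul (hB.mul_const _)),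
    dz_mul hl (hB.fun_mul hB'), dz_mul hB hB', dz_mul hA (hB.mul_const _), dz_mul_const hB,
    dz_star, dz_oneForm, dzbar_oneForm, dz_linear, dz_hermitianForm, star_zero]
  ring

/-- The fundamental tensor of a complex Randers metric. -/
theorem fundamentalTensor_randers (ha : IsHermitianMetric D a) (hD : IsOpen D) (hz : z ∈ D)
    (hb : ∀ i, ContDiffAt ℝ ∞ (fun w => b w i) z) (hη : oneForm b z η ≠ 0) (i m : Fin n) :
    2 * randersCross a b z η ^ 3 * fundamentalTensor (randers a b) z η i m =
      2 * randersCross a b z η ^ 3 * (a z i m + b z i * star (b z m)) +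
      2 * randersCross a b z η ^ 2 * (a z i m * (oneForm b z η * star (oneForm b z η)) +
      (∑ l, a z l m * η l) * (b z i * star (oneForm b z η)) +
      (∑ l, a z i l * star (η l)) * (oneForm b z η * star (b z m)) +
      hermitianForm a z η η * (b z i * star (b z m))) -
      crossGrad a b z η m * ((∑ m, a z i m * star (η m)) *
        (oneForm b z η * star (oneForm b z η)) +
        hermitianForm a z η η * (b z i * star (oneForm b z η))) := by
  have hp := ha.posDef z hz
  have hev : ∀ᶠ ξ in 𝓝 η, oneForm b z ξ ≠ 0 :=
    (differentiable_oneForm z η).continuousAt.eventually_ne hη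
  have hsm := contDiffAt_randersCross ha hD hz hb hη
  have hs := ContDiffAt.fiber hsm
  have hu : DifferentiableAt ℝ (dzbar (randersCross a b z) m) η :=
    ContDiffAt.fiber (contDiffAt_dzbar_snd hsm m)
  have hl : DifferentiableAt ℝ (fun ζ : Fin n → ℂ => ∑ l, a z l m * ζ l) η := by fun_prop
  have h1 : fundamentalTensor (randers a b) z η i m =
      a z i m + b z i * star (b z m) + 2 * dz (dzbar (randersCross a b z) m) i η := by
    have hev' : dzbar (energy (randers a b) z) m =ᶠ[𝓝 η] fun ξ => (∑ l, a z l m * ξ l) +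
        oneForm b z ξ * star (b z m) + 2 * dzbar (randersCross a b z) m ξ := by
      filter_upwards [hev] with ξ hξ
      exact dzbar_energy_randers hp (ContDiffAt.fiber (contDiffAt_randersCross ha hD hz hb hξ)) m
    rw [fundamentalTensor_apply, dz_congr hev', dz_add (hl.fun_add
      ((differentiable_oneForm z η).mul_const _)) (hu.const_mul 2), dz_add hl
      ((differentiable_oneForm z η).mul_const _), dz_mul_const (differentiable_oneForm z η),
      dz_oneForm, dz_linear, dz_const_mul hu]
  -- With s = α|β|, differentiate 2s ∂̄ₘs = M_m once more. Multiplying by s² turns the remaining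
  -- first derivatives into known terms, which is the reason for the factor 2s³ in the statement.
  have h2 : 2 * (dz (randersCross a b z) i η * dzbar (randersCross a b z) m η +
      randersCross a b z η * dz (dzbar (randersCross a b z) m) i η) =
      dz (fun ζ => crossGrad a b z ζ m) i η := by
    rw [← dz_mul hs hu, ← dz_const_mul (hs.fun_mul hu)]
    refine dz_congr ?_ i
    filter_upwards [hev] with ξ hξ
    exact two_mul_dzbar_randersCross hp
      (ContDiffAt.fiber (contDiffAt_randersCross ha hD hz hb hξ)) m
  rw [dz_crossGrad] at h2
  have h3 := two_mul_dzbar_randersCross hp hs m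
  have h4 := two_mul_dz_randersCross hp hs i
  rw [h1, ← h3, ← h4]
  linear_combination (2 * randersCross a b z η ^ 2) * h2

/-- Cauchy-Schwarz. -/
theorem normSq_hermitianForm_le (ha : (a z).PosDef) (v η : Fin n → ℂ) :
    Complex.normSq (hermitianForm a z v η) ≤
      (hermitianForm a z v v).re * (hermitianForm a z η η).re := by
  rcases eq_or_ne η 0 with rfl | hη
  · rw [← hermitianForm_star ha.isHermitian]; simp
  have hA := hermitianForm_re_pos ha hη
  set x := hermitianForm a z v η with hx
  set A := (hermitianForm a z η η).re with hAdef
  have hAc : hermitianForm a z η η = A := (hermitianForm_ofReal_re ha.isHermitian η).symm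
  have hNc : hermitianForm a z v v = (hermitianForm a z v v).re :=
    (hermitianForm_ofReal_re ha.isHermitian v).symm
  have h1 := hermitianForm_re_nonneg ha ((A : ℂ) • v + (-x) • η)
  have h2 : hermitianForm a z ((A : ℂ) • v + (-x) • η) ((A : ℂ) • v + (-x) • η) =
      ((A * (A * (hermitianForm a z v v).re - Complex.normSq x) : ℝ) : ℂ) := by
    have hx' : hermitianForm a z η v = star x := by
      rw [hx, hermitianForm_star ha.isHermitian]
    have hxx : x * star x = Complex.normSq x := by rw [Complex.star_def, Complex.mul_conj]
    have hAs : star (A : ℂ) = A := Complex.conj_ofReal A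
    rw [hermitianForm_add_left, hermitianForm_add_right, hermitianForm_add_right,
      hermitianForm_smul_left, hermitianForm_smul_left, hermitianForm_smul_left,
      hermitianForm_smul_left, hermitianForm_smul_right, hermitianForm_smul_right,
      hermitianForm_smul_right, hermitianForm_smul_right, hAc, ← hx, hx', hNc, star_neg, hAs]
    push_cast
    linear_combination (-A : ℂ) * hxx
  rw [h2, Complex.ofReal_re] at h1
  nlinarith [nonneg_of_mul_nonneg_right h1 hA]

/-- Horizontal constancy of F² needs an honest inverse. For v in the kernel, contracting with v̄
gives zero as the sum of 2s³(a(v,v) + |β(v)|²), a Cauchy-Schwarz defect 2|β|⁴(α²a(v,v) - |a(v,η)|²)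
and |β|² |a(v,η)β + α²β(v)|². The first is positive when v ≠ 0 and the others are nonnegative. -/
theorem isUnit_fundamentalTensor_randers (ha : IsHermitianMetric D a) (hD : IsOpen D)
    (hz : z ∈ D) (hb : ∀ i, ContDiffAt ℝ ∞ (fun w => b w i) z) (hη : oneForm b z η ≠ 0) :
    IsUnit (fundamentalTensor (randers a b) z η) := by
  have hp := ha.posDef z hz
  rw [← Matrix.vecMul_injective_iff_isUnit, ← Matrix.coe_vecMulLinear, ← LinearMap.ker_eq_bot,
    LinearMap.ker_eq_bot']
  intro v hv
  by_contra hv0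
  have hη0 := ne_zero_of_oneForm hη
  have hvm (m : Fin n) : ∑ i, v i * fundamentalTensor (randers a b) z η i m = 0 :=
    congrFun hv m
  set s := randersCross a b z η with hs
  set B := oneForm b z η with hB
  set x := hermitianForm a z v η with hx
  set y := oneForm b z v with hy
  set A := (hermitianForm a z η η).re with hA
  set N := (hermitianForm a z v v).re with hN
  have hAc : hermitianForm a z η η = A := (hermitianForm_ofReal_re hp.isHermitian η).symm
  have hNc : hermitianForm a z v v = N := (hermitianForm_ofReal_re hp.isHermitian v).symm
  have hApos : 0 < A := hermitianForm_re_pos hp hη0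
  have hNpos : 0 < N := hermitianForm_re_pos hp hv0
  have key : 0 = 2 * s ^ 3 * (N + y * star y) + 2 * s ^ 2 * (N * (B * star B) +
      star x * y * star B + x * B * star y + A * (y * star y)) -
      (star x * (B * star B) + A * (B * star y)) * (x * (B * star B) + A * (y * star B)) := by
    have e0 : (0 : ℂ) = ∑ m, star (v m) * ∑ i, v i * (2 * s ^ 3 *
        fundamentalTensor (randers a b) z η i m) := by
      have (m : Fin n) : ∑ i, v i * (2 * s ^ 3 * fundamentalTensor (randers a b) z η i m) = 0 := by
        have := congrArg (fun t => 2 * s ^ 3 * t) (hvm m)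
        simp only [mul_zero, Finset.mul_sum] at this
        rw [← this]
        exact Finset.sum_congr rfl fun _ _ => by ring
      simp [this]
    have eN : (N : ℂ) = ∑ m, star (v m) * ∑ i, v i * a z i m := by
      rw [← hNc, hermitianForm_eq_sum_mul']
      refine Finset.sum_congr rfl fun m _ => ?_
      rw [Finset.sum_mul, Finset.mul_sum]
      exact Finset.sum_congr rfl fun _ _ => by ring
    have ey : y = ∑ i, v i * b z i := by
      rw [hy, oneForm]; exact Finset.sum_congr rfl fun _ _ => by ring
    have ey' : star y = ∑ m, star (v m) * star (b z m) := by
      rw [ey, star_sum]; exact Finset.sum_congr rfl fun _ _ => by rw [star_mul', mul_comm]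
    have ex : x = ∑ i, v i * ∑ l, a z i l * star (η l) := by rw [hx, hermitianForm_eq_sum_mul]
    have ex' : star x = ∑ m, star (v m) * ∑ l, a z l m * η l := by
      rw [hx, hermitianForm_star hp.isHermitian, hermitianForm_eq_sum_mul']
      exact Finset.sum_congr rfl fun _ _ => mul_comm _ _
    have eM : star x * (B * star B) + A * (B * star y) =
        ∑ m, star (v m) * crossGrad a b z η m := by
      rw [ex', ey']
      simp only [crossGrad, mul_add, Finset.sum_add_distrib, Finset.sum_mul, hAc, Finset.mul_sum]
      congr 1
      · refine Finset.sum_congr rfl fun _ _ => ?_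
        exact Finset.sum_congr rfl fun _ _ => by ring
      · exact Finset.sum_congr rfl fun _ _ => by ring
    rw [e0]
    have inner (m : Fin n) : ∑ i, v i * (2 * s ^ 3 * fundamentalTensor (randers a b) z η i m) =
        2 * s ^ 3 * (∑ i, v i * a z i m + y * star (b z m)) + 2 * s ^ 2 *
          ((∑ i, v i * a z i m) * (B * star B) + (∑ l, a z l m * η l) * (y * star B) +
          x * (B * star (b z m)) + A * (y * star (b z m))) -
          crossGrad a b z η m * (x * (B * star B) + A * (y * star B)) := by
      calc _ = ∑ i, (v i * a z i m * (2 * s ^ 3 + 2 * s ^ 2 * (B * star B)) +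
            v i * b z i * (2 * s ^ 3 * star (b z m) + 2 * s ^ 2 * ((∑ l, a z l m * η l) * star B +
              A * star (b z m)) - crossGrad a b z η m * (A * star B)) +
            v i * (∑ l, a z i l * star (η l)) * (2 * s ^ 2 * (B * star (b z m)) -
              crossGrad a b z η m * (B * star B))) := by
            refine Finset.sum_congr rfl fun i _ => ?_
            rw [fundamentalTensor_randers ha hD hz hb hη, hAc]
            ring
        _ = _ := by
            simp only [Finset.sum_add_distrib, ← Finset.sum_mul]
            rw [← ey, ← ex]
            ring
    simp only [inner]
    calc _ = ((∑ m, star (v m) * ∑ i, v i * a z i m) * (2 * s ^ 3 + 2 * s ^ 2 * (B * star B)) +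
          (∑ m, star (v m) * star (b z m)) *
            (2 * s ^ 3 * y + 2 * s ^ 2 * (x * B + A * y)) +
          (∑ m, star (v m) * ∑ l, a z l m * η l) * (2 * s ^ 2 * (y * star B))) -
          (∑ m, star (v m) * crossGrad a b z η m) * (x * (B * star B) + A * (y * star B)) := by
          rw [Finset.sum_mul, Finset.sum_mul, Finset.sum_mul, Finset.sum_mul,
            ← Finset.sum_add_distrib, ← Finset.sum_add_distrib, ← Finset.sum_sub_distrib]
          exact Finset.sum_congr rfl fun _ _ => by ring
      _ = _ := by
          rw [← eM, ← eN, ← ey', ← ex']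
          ring
  obtain ⟨S, hS, hSpos⟩ : ∃ S : ℝ, s = S ∧ 0 < S :=
    ⟨_, rfl, mul_pos (hermitianNorm_pos hp hη0) (norm_pos_iff.2 hη)⟩
  have hss : s * s = A * (B * star B) := by rw [← hAc]; exact randersCross_sq hp η
  have hstar (c : ℂ) : c * star c = (Complex.normSq c : ℝ) := by
    rw [Complex.star_def, Complex.mul_conj]
  have hCS : Complex.normSq x ≤ N * A := normSq_hermitianForm_le hp v η
  have hreal : 2 * S ^ 3 * (N + Complex.normSq y) +
      2 * Complex.normSq B ^ 2 * (A * N - Complex.normSq x) +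
      Complex.normSq B * Complex.normSq (x * B + A * y) = 0 := by
    have : ((2 * S ^ 3 * (N + Complex.normSq y) +
      2 * Complex.normSq B ^ 2 * (A * N - Complex.normSq x) +
      Complex.normSq B * Complex.normSq (x * B + A * y) : ℝ) : ℂ) = 0 := by
      push_cast
      rw [← hstar, ← hstar, ← hstar, ← hstar, ← hS]
      have hAs : star (A : ℂ) = A := Complex.conj_ofReal A
      simp only [star_add, star_mul', hAs]
      linear_combination -key - 2 * (N * (B * star B) +
        star x * y * star B + x * B * star y + A * (y * star y)) * hss
    exact_mod_cast this
  have h1 : 0 < 2 * S ^ 3 * (N + Complex.normSq y) := by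
    have := Complex.normSq_nonneg y
    positivity
  have h2 : 0 ≤ 2 * Complex.normSq B ^ 2 * (A * N - Complex.normSq x) :=
    mul_nonneg (by positivity) (by linarith)
  have h3 : 0 ≤ Complex.normSq B * Complex.normSq (x * B + A * y) :=
    mul_nonneg (Complex.normSq_nonneg _) (Complex.normSq_nonneg _)
  linarith

end Randers

/-! ### The generalized Berwald condition and the comparison of the sprays of h and a -/

section Berwald

variable {n : ℕ} {D : Set (Fin n → ℂ)} {a h : (Fin n → ℂ) → Matrix (Fin n) (Fin n) ℂ}
  {b : (Fin n → ℂ) → (Fin n → ℂ)} {z η : Fin n → ℂ}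

/-- `ηʲηᵏ ∂a_{k l̄}/∂zʲ`. -/
noncomputable def metricDeriv (a : (Fin n → ℂ) → Matrix (Fin n) (Fin n) ℂ) (z η : Fin n → ℂ)
    (l : Fin n) : ℂ :=
  ∑ j, ∑ k, dz (fun w => a w k l) j z * η j * η k

/-- `ηʲηᵏ ∂b_k/∂zʲ`. -/
noncomputable def formDeriv (b : (Fin n → ℂ) → (Fin n → ℂ)) (z η : Fin n → ℂ) : ℂ :=
  ∑ j, ∑ k, dz (fun w => b w k) j z * η j * η k

/-- `ηʲ ∂b̄_l/∂zʲ`. -/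
noncomputable def conjFormDeriv (b : (Fin n → ℂ) → (Fin n → ℂ)) (z : Fin n → ℂ) :
    (Fin n → ℂ) →L[ℂ] (Fin n → ℂ) :=
  ContinuousLinearMap.pi fun l =>
    ∑ j, dz (fun w => star (b w l)) j z • ContinuousLinearMap.proj j

theorem conjFormDeriv_apply (z η : Fin n → ℂ) (l : Fin n) :
    conjFormDeriv b z η l = ∑ j, dz (fun w => star (b w l)) j z * η j := by
  simp [conjFormDeriv, _root_.sum_apply]

theorem sum_dz_hermitianForm (ha : IsHermitianMetric D a) (hD : IsOpen D) (hz : z ∈ D)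
    (η ζ : Fin n → ℂ) :
    ∑ j, η j * dz (fun w => hermitianForm a w η ζ) j z = pairing (metricDeriv a z η) ζ := by
  have hd (k l : Fin n) : DifferentiableAt ℝ (fun w => a w k l * η k * star (ζ l)) z :=
    ((ha.differentiableAt hD hz k l).mul_const _).mul_const _
  have h1 (j : Fin n) : dz (fun w => hermitianForm a w η ζ) j z =
      ∑ k, ∑ l, dz (fun w => a w k l) j z * η k * star (ζ l) := by
    unfold hermitianForm
    rw [dz_sum fun k _ => DifferentiableAt.fun_sum fun l _ => hd k l]
    refine Finset.sum_congr rfl fun k _ => ?_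
    rw [dz_sum fun l _ => hd k l]
    refine Finset.sum_congr rfl fun l _ => ?_
    rw [dz_mul_const ((ha.differentiableAt hD hz k l).mul_const _),
      dz_mul_const (ha.differentiableAt hD hz k l)]
  simp only [h1, pairing, metricDeriv, Finset.mul_sum, Finset.sum_mul]
  symm
  rw [Finset.sum_comm]
  refine Finset.sum_congr rfl fun j _ => ?_
  rw [Finset.sum_comm]
  exact Finset.sum_congr rfl fun k _ => Finset.sum_congr rfl fun l _ => by ring

theorem sum_dz_oneForm (hb : ∀ i, ContDiffAt ℝ ∞ (fun w => b w i) z) (η : Fin n → ℂ) :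
    ∑ j, η j * dz (fun w => oneForm b w η) j z = formDeriv b z η := by
  have hd (i : Fin n) : DifferentiableAt ℝ (fun w => b w i) z := (hb i).differentiableAt (by simp)
  unfold formDeriv oneForm
  refine Finset.sum_congr rfl fun j _ => ?_
  rw [dz_sum fun i _ => (hd i).mul_const _, Finset.mul_sum]
  refine Finset.sum_congr rfl fun i _ => ?_
  rw [dz_mul_const (hd i)]; ring

theorem sum_dz_star_oneForm (hb : ∀ i, ContDiffAt ℝ ∞ (fun w => b w i) z) (η ζ : Fin n → ℂ) :
    ∑ j, η j * dz (fun w => star (oneForm b w ζ)) j z = pairing (conjFormDeriv b z η) ζ := by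
  have hd (i : Fin n) : DifferentiableAt ℝ (fun w => star (b w i)) z :=
    ((hb i).differentiableAt (by simp)).star
  simp only [oneForm, pairing, conjFormDeriv_apply, star_sum, star_mul', Finset.sum_mul]
  rw [Finset.sum_comm]
  refine Finset.sum_congr rfl fun j _ => ?_
  rw [dz_sum fun i _ => (hd i).mul_const _, Finset.mul_sum]
  refine Finset.sum_congr rfl fun i _ => ?_
  rw [dz_mul_const (hd i)]; ring

/-- The equation `2 Gⁱ ∂F²/∂ηⁱ = ηʲ ∂F²/∂zʲ` for the complex Randers metric `F = α + |β|`. -/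
theorem randers_spray_equation (ha : IsHermitianMetric D a) (hD : IsOpen D) (hz : z ∈ D)
    (hb : ∀ w ∈ D, ∀ i, ContDiffAt ℝ ∞ (fun w => b w i) w) (hη : oneForm b z η ≠ 0) :
    (hermitianNorm a z η : ℂ) * (star (oneForm b z η) *
      (formDeriv b z η - 2 * ∑ i, b z i * spray (randers a b) z η i) +
      oneForm b z η * pairing (conjFormDeriv b z η) η) =
    ‖oneForm b z η‖ * (2 * hermitianForm a z (spray (randers a b) z η) η -
      pairing (metricDeriv a z η) η) := by
  have hp := ha.posDef z hz
  have hbz := hb z hz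
  have hBcont : ContinuousAt (fun w => oneForm b w η) z :=
    (ContDiffAt.base (Φ := oneForm b) (contDiffAt_oneForm hbz)).continuousAt
  have hev : ∀ᶠ w in 𝓝 z, w ∈ D ∧ oneForm b w η ≠ 0 :=
    Filter.Eventually.and (hD.mem_nhds hz) (hBcont.eventually_ne hη)
  have hN := sum_chernFinsler_mul_dz (F := randers a b) (z := z) (η := η)
    (by filter_upwards [hev] with w hw using contDiffAt_energy_randers ha hD hw.1 (hb w hw.1) hw.2)
    (Eventually.of_forall fun w c ξ => randers_smul c w ξ)
    (isUnit_fundamentalTensor_randers ha hD hz hbz hη)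
  have hsm := contDiffAt_randersCross ha hD hz hbz hη
  have hs := ContDiffAt.fiber hsm
  have hs' := ContDiffAt.base hsm
  have hA' : DifferentiableAt ℝ (fun w => hermitianForm a w η η) z :=
    ContDiffAt.base (Φ := fun w ξ => hermitianForm a w ξ ξ) (contDiffAt_hermitianForm ha hD hz)
  have hB' : DifferentiableAt ℝ (fun w => oneForm b w η) z :=
    ContDiffAt.base (Φ := oneForm b) (contDiffAt_oneForm hbz)
  have hB'' : DifferentiableAt ℝ (fun w => star (oneForm b w η)) z := hB'.star
  set s := randersCross a b z η with hsdef
  set B := oneForm b z η with hB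
  set A := hermitianForm a z η η with hA
  set G := spray (randers a b) z η with hG
  -- the fibre side
  have hl : s * ∑ j, η j * ∑ i, chernFinsler (randers a b) z η i j *
      dz (energy (randers a b) z) i η =
      2 * hermitianForm a z G η * (s + B * star B) +
        2 * (∑ i, b z i * G i) * star B * (s + A) := by
    have h1 : ∑ j, η j * ∑ i, chernFinsler (randers a b) z η i j *
        dz (energy (randers a b) z) i η = ∑ i, 2 * G i * dz (energy (randers a b) z) i η := by
      simp only [Finset.mul_sum]
      rw [Finset.sum_comm]
      refine Finset.sum_congr rfl fun i _ => ?_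
      have : 2 * G i = ∑ j, chernFinsler (randers a b) z η i j * η j := by
        rw [hG, spray]; ring
      rw [this, Finset.sum_mul]
      exact Finset.sum_congr rfl fun j _ => by ring
    rw [h1, hermitianForm_eq_sum_mul, Finset.mul_sum, Finset.mul_sum, Finset.mul_sum,
      Finset.sum_mul, Finset.sum_mul, Finset.sum_mul, ← Finset.sum_add_distrib]
    refine Finset.sum_congr rfl fun i _ => ?_
    rw [dz_energy_randers hp hs]
    linear_combination 2 * G i * two_mul_dz_randersCross hp hs i
  -- the base side
  have hr : s * ∑ j, η j * dz (fun w => energy (randers a b) w η) j z =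
      pairing (metricDeriv a z η) η * (s + B * star B) +
        (formDeriv b z η * star B + B * pairing (conjFormDeriv b z η) η) * (s + A) := by
    have h1 (j : Fin n) : s * dz (fun w => energy (randers a b) w η) j z =
        dz (fun w => hermitianForm a w η η) j z * (s + B * star B) +
        (dz (fun w => oneForm b w η) j z * star B +
          B * dz (fun w => star (oneForm b w η)) j z) * (s + A) := by
      have e1 : (fun w => energy (randers a b) w η) =ᶠ[𝓝 z] fun w => hermitianForm a w η η +
          oneForm b w η * star (oneForm b w η) + 2 * randersCross a b w η := by
        filter_upwards [hD.mem_nhds hz] with w hw using energy_randers (ha.posDef w hw) η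
      have e2 : (fun w => randersCross a b w η * randersCross a b w η) =ᶠ[𝓝 z]
          fun w => hermitianForm a w η η * (oneForm b w η * star (oneForm b w η)) := by
        filter_upwards [hD.mem_nhds hz] with w hw using randersCross_sq (ha.posDef w hw) η
      have e3 := dz_congr e2 j
      rw [dz_mul hs' hs', dz_mul hA' (hB'.fun_mul hB''), dz_mul hB' hB''] at e3
      rw [dz_congr e1, dz_add (hA'.fun_add (hB'.fun_mul hB'')) (hs'.const_mul 2),
        dz_add hA' (hB'.fun_mul hB''), dz_mul hB' hB'', dz_const_mul hs']
      linear_combination e3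
    rw [← sum_dz_hermitianForm ha hD hz, ← sum_dz_oneForm hbz, ← sum_dz_star_oneForm hbz]
    calc _ = ∑ j, (η j * dz (fun w => hermitianForm a w η η) j z * (s + B * star B) +
          (η j * dz (fun w => oneForm b w η) j z * (star B * (s + A)) +
          η j * dz (fun w => star (oneForm b w η)) j z * (B * (s + A)))) := by
          rw [Finset.mul_sum]
          exact Finset.sum_congr rfl fun j _ => by linear_combination η j * h1 j
      _ = _ := by
          rw [Finset.sum_add_distrib, Finset.sum_add_distrib, ← Finset.sum_mul, ← Finset.sum_mul,
            ← Finset.sum_mul]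
          ring
  have heq : s * ∑ j, η j * ∑ i, chernFinsler (randers a b) z η i j *
      dz (energy (randers a b) z) i η =
      s * ∑ j, η j * dz (fun w => energy (randers a b) w η) j z := by
    simp only [hN]
  rw [hl, hr] at heq
  have hα : 0 < hermitianNorm a z η := hermitianNorm_pos hp (ne_zero_of_oneForm hη)
  have hβ : 0 < ‖B‖ := norm_pos_iff.2 hη
  -- Both sides carry the factor α + |β|, because s + |β|² = |β|(α + |β|) and s + α² = α(α + |β|).
  -- Cancelling it leaves the stated equation.
  have hsum : ((hermitianNorm a z η : ℝ) : ℂ) + ((‖B‖ : ℝ) : ℂ) ≠ 0 := by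
    rw [← Complex.ofReal_add, Complex.ofReal_ne_zero]; positivity
  have hsv : s = (hermitianNorm a z η : ℂ) * (‖B‖ : ℂ) := by
    rw [hsdef, randersCross]; push_cast; rfl
  have hAv : A = (hermitianNorm a z η : ℂ) ^ 2 := by
    rw [hA, ← hermitianNorm_sq hp]; push_cast; rfl
  have hBv : B * star B = (‖B‖ : ℂ) ^ 2 := by
    rw [hB, oneForm_mul_star]; push_cast; rfl
  rw [hsv, hAv, hBv] at heq
  apply mul_left_cancel₀ hsum
  linear_combination -heq

theorem differentiable_quadratic (c : Fin n → Fin n → ℂ) :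
    Differentiable ℂ fun η : Fin n → ℂ => ∑ j, ∑ k, c j k * η j * η k :=
  Differentiable.fun_sum fun j _ => Differentiable.fun_sum fun k _ =>
    ((differentiable_apply j).const_mul _).fun_mul (differentiable_apply k)

theorem quadratic_smul (c : Fin n → Fin n → ℂ) (t : ℂ) (η : Fin n → ℂ) :
    ∑ j, ∑ k, c j k * (t • η) j * (t • η) k = t ^ 2 * ∑ j, ∑ k, c j k * η j * η k := by
  simp only [Finset.mul_sum, Pi.smul_apply, smul_eq_mul]
  exact Finset.sum_congr rfl fun _ _ => Finset.sum_congr rfl fun _ _ => by ring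

theorem differentiable_formDeriv (z : Fin n → ℂ) : Differentiable ℂ (formDeriv b z) :=
  differentiable_quadratic fun j k => dz (fun w => b w k) j z

theorem differentiable_metricDeriv (z : Fin n → ℂ) : Differentiable ℂ (metricDeriv a z) :=
  differentiable_pi.2 fun l => differentiable_quadratic fun j k => dz (fun w => a w k l) j z

theorem formDeriv_smul (c : ℂ) (z η : Fin n → ℂ) :
    formDeriv b z (c • η) = c ^ 2 * formDeriv b z η :=
  quadratic_smul (fun j k => dz (fun w => b w k) j z) c η

theorem metricDeriv_smul (c : ℂ) (z η : Fin n → ℂ) :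
    metricDeriv a z (c • η) = c ^ 2 • metricDeriv a z η :=
  funext fun l => quadratic_smul (fun j k => dz (fun w => a w k l) j z) c η

theorem hermitianForm_const (z η ζ : Fin n → ℂ) :
    hermitianForm (fun _ => a z) 0 η ζ = hermitianForm a z η ζ := rfl

/-- The algebraic form of the generalized Berwald condition for `F = α + |β|`. -/
theorem IsGeneralizedBerwald.pairing_eq (hn : 2 ≤ n) (ha : IsHermitianMetric D a) (hD : IsOpen D)
    (hb : ∀ w ∈ D, ∀ i, ContDiffAt ℝ ∞ (fun w => b w i) w)
    (hF : IsGeneralizedBerwald D (randers a b)) (hz : z ∈ D) {η₀ : Fin n → ℂ} (hη₀ : η₀ ≠ 0)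
    (hdual : ∀ i, ∑ m, a z i m * star (η₀ m) = b z i) (η ζ : Fin n → ℂ) :
    oneForm b z η * pairing (conjFormDeriv b z η) ζ =
      (pairing (metricDeriv a z η) η₀ - formDeriv b z η) * star (oneForm b z ζ) := by
  have hG (ξ : Fin n → ℂ) (hξ : oneForm b z ξ ≠ 0) :
      DifferentiableAt ℂ (spray (randers a b) z) ξ :=
    differentiableAt_pi.2 fun i => hF z hz ξ (ne_zero_of_oneForm hξ)
      (contDiffAt_randers ha hD hz (hb z hz) hξ) i
  have H (ξ : Fin n → ℂ) (hξ : oneForm b z ξ ≠ 0) :=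
    randers_spray_equation ha hD hz hb hξ
  simp only [← hermitianForm_const (a := a) z, hermitianNorm] at H
  simp only [oneForm] at H hG ⊢
  -- From here only the holomorphy of G off ker β and the equation H matter, so the problem becomes
  -- one about a single fibre.
  generalize spray (randers a b) z = G at H hG
  have h1 := differentiable_formDeriv (b := b) z
  have h2 := differentiable_metricDeriv (a := a) z
  have h3 := fun c η => formDeriv_smul (b := b) c z η
  have h4 := fun c η => metricDeriv_smul (a := a) c z η
  generalize formDeriv b z = Q at *
  generalize metricDeriv a z = X at *
  generalize conjFormDeriv b z = Y at *
  exact berwald_algebra hn (ha.posDef z hz) hη₀ hdual h1 h2 h3 h4 hG H η ζ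

theorem hermitianForm_christoffel (ha : (a z).PosDef) (η ζ : Fin n → ℂ) :
    hermitianForm a z (fun i => ∑ j, ∑ l, christoffel a z i j l * η l * η j) ζ =
      pairing (metricDeriv a z η) ζ := by
  rw [hermitianForm_eq_sum_mul', pairing]
  refine Finset.sum_congr rfl fun m _ => ?_
  congr 1
  simp only [metricDeriv, Finset.mul_sum]
  rw [Finset.sum_comm]
  refine Finset.sum_congr rfl fun j _ => ?_
  rw [Finset.sum_comm]
  refine Finset.sum_congr rfl fun l _ => ?_
  rw [← sum_christoffel_mul ha, Finset.sum_mul, Finset.sum_mul]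
  exact Finset.sum_congr rfl fun i _ => by ring

/-- The vector η₀ represents the form: a(·, η₀) = c. It is the conjugate of a⁻¹c. -/
theorem exists_dual (ha : (a z).PosDef) (c : Fin n → ℂ) (hc : c ≠ 0) :
    ∃ η₀ : Fin n → ℂ, η₀ ≠ 0 ∧ ∀ i, ∑ m, a z i m * star (η₀ m) = c i := by
  have hdual : ∀ i, ∑ m, a z i m * star (star (∑ p, (a z)⁻¹ m p * c p)) = c i := by
    intro i
    simp only [star_star, Finset.mul_sum]
    rw [Finset.sum_comm]
    calc _ = ∑ p, (∑ m, a z i m * (a z)⁻¹ m p) * c p := by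
          refine Finset.sum_congr rfl fun p _ => ?_
          rw [Finset.sum_mul]
          exact Finset.sum_congr rfl fun m _ => by ring
      _ = c i := by simp [sum_mul_inv ha.isUnit]
  refine ⟨fun m => star (∑ p, (a z)⁻¹ m p * c p), fun h0 => hc (funext fun i => ?_), hdual⟩
  rw [← hdual i]
  exact Finset.sum_eq_zero fun m _ => by
    rw [show star (∑ p, (a z)⁻¹ m p * c p) = 0 from congrFun h0 m, star_zero, mul_zero]

/-- For a generalized Berwald metric `α + |β|`, the sprays of `a` and of `h = ε (a - b b*)` are
projectively equivalent. -/
theorem IsGeneralizedBerwald.christoffel_eq (hn : 2 ≤ n) (ha : IsHermitianMetric D a)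
    (hh : IsHermitianMetric D h) (hD : IsOpen D)
    (hb : ∀ w ∈ D, ∀ i, ContDiffAt ℝ ∞ (fun w => b w i) w) (hb0 : ∀ w ∈ D, b w ≠ 0)
    {ε : (Fin n → ℂ) → ℂ} (hε : ∀ w ∈ D, ContDiffAt ℝ ∞ ε w) (hε0 : ∀ w ∈ D, ε w ≠ 0)
    (hrel : ∀ w ∈ D, ∀ i j, h w i j = ε w * (a w i j - b w i * star (b w j)))
    (hF : IsGeneralizedBerwald D (randers a b)) (hz : z ∈ D) (η : Fin n → ℂ) (i : Fin n) :
    ∑ j, ∑ l, christoffel h z i j l * η l * η j =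
      ∑ j, ∑ l, christoffel a z i j l * η l * η j + (∑ j, dz ε j z * η j) / ε z * η i := by
  obtain ⟨η₀, hη₀, hdual⟩ := exists_dual (ha.posDef z hz) (b z) (hb0 z hz)
  have hbz := hb z hz
  set gh : Fin n → ℂ := fun i => ∑ j, ∑ l, christoffel h z i j l * η l * η j with hgh
  set ga : Fin n → ℂ := fun i => ∑ j, ∑ l, christoffel a z i j l * η l * η j with hga
  set c : ℂ := (∑ j, dz ε j z * η j) / ε z with hc
  have hform (w : Fin n → ℂ) (hw : w ∈ D) (ξ ζ : Fin n → ℂ) : hermitianForm h w ξ ζ =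
      ε w * (hermitianForm a w ξ ζ - oneForm b w ξ * star (oneForm b w ζ)) := by
    rw [hermitianForm, hermitianForm, oneForm, oneForm, star_sum, Finset.sum_mul_sum,
      ← Finset.sum_sub_distrib, Finset.mul_sum]
    refine Finset.sum_congr rfl fun i _ => ?_
    rw [← Finset.sum_sub_distrib, Finset.mul_sum]
    exact Finset.sum_congr rfl fun j _ => by rw [hrel w hw, star_mul']; ring
  have hA0 (ξ : Fin n → ℂ) : hermitianForm a z ξ η₀ = oneForm b z ξ := by
    rw [hermitianForm_eq_sum_mul]
    exact Finset.sum_congr rfl fun i _ => by rw [hdual, mul_comm]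
  -- The Leibniz rule on h = ε(a - b b*) produces derivatives of b. By
  -- `IsGeneralizedBerwald.pairing_eq` they add up to β(ga) times the conjugate of β(ζ), which
  -- together with a(ga, ζ) reassembles h(ga, ζ).
  have hX (ζ : Fin n → ℂ) : pairing (metricDeriv h z η) ζ =
      c * hermitianForm h z η ζ + hermitianForm h z ga ζ := by
    have hdε : DifferentiableAt ℝ ε z := (hε z hz).differentiableAt (by simp)
    have hdB : DifferentiableAt ℝ (fun w => oneForm b w η) z :=
      ContDiffAt.base (Φ := oneForm b) (contDiffAt_oneForm hbz)
    have hdB' : DifferentiableAt ℝ (fun w => star (oneForm b w ζ)) z :=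
      (ContDiffAt.base (Φ := oneForm b) (contDiffAt_oneForm hbz)).star
    have hdA : DifferentiableAt ℝ (fun w => hermitianForm a w η ζ) z := by
      unfold hermitianForm
      exact DifferentiableAt.fun_sum fun i _ => DifferentiableAt.fun_sum fun j _ =>
        ((ha.differentiableAt hD hz i j).mul_const _).mul_const _
    have h1 (j : Fin n) : dz (fun w => hermitianForm h w η ζ) j z =
        dz ε j z * (hermitianForm a z η ζ - oneForm b z η * star (oneForm b z ζ)) +
        ε z * (dz (fun w => hermitianForm a w η ζ) j z -
          (dz (fun w => oneForm b w η) j z * star (oneForm b z ζ) +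
            oneForm b z η * dz (fun w => star (oneForm b w ζ)) j z)) := by
      have hev : (fun w => hermitianForm h w η ζ) =ᶠ[𝓝 z] fun w =>
          ε w * (hermitianForm a w η ζ - oneForm b w η * star (oneForm b w ζ)) := by
        filter_upwards [hD.mem_nhds hz] with w hw using hform w hw η ζ
      rw [dz_congr hev, dz_mul hdε (hdA.fun_sub (hdB.fun_mul hdB')),
        dz_sub hdA (hdB.fun_mul hdB'), dz_mul hdB hdB']
    have h2 := hF.pairing_eq hn ha hD hb hz hη₀ hdual η ζ
    have h3 : hermitianForm a z ga ζ = pairing (metricDeriv a z η) ζ :=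
      hermitianForm_christoffel (ha.posDef z hz) η ζ
    have h4 : oneForm b z ga = pairing (metricDeriv a z η) η₀ := by
      rw [← hA0]; exact hermitianForm_christoffel (ha.posDef z hz) η η₀
    have h5 : pairing (metricDeriv h z η) ζ = (∑ j, dz ε j z * η j) *
        (hermitianForm a z η ζ - oneForm b z η * star (oneForm b z ζ)) +
        ε z * (pairing (metricDeriv a z η) ζ - (formDeriv b z η * star (oneForm b z ζ) +
          oneForm b z η * pairing (conjFormDeriv b z η) ζ)) := by
      rw [← sum_dz_hermitianForm hh hD hz, ← sum_dz_hermitianForm ha hD hz, ← sum_dz_oneForm hbz,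
        ← sum_dz_star_oneForm hbz]
      calc _ = ∑ j, (dz ε j z * η j *
            (hermitianForm a z η ζ - oneForm b z η * star (oneForm b z ζ)) +
            η j * dz (fun w => hermitianForm a w η ζ) j z * ε z -
            η j * dz (fun w => oneForm b w η) j z * (ε z * star (oneForm b z ζ)) -
            η j * dz (fun w => star (oneForm b w ζ)) j z * (ε z * oneForm b z η)) := by
            exact Finset.sum_congr rfl fun j _ => by rw [h1]; ring
        _ = _ := by
            rw [Finset.sum_sub_distrib, Finset.sum_sub_distrib, Finset.sum_add_distrib,
              ← Finset.sum_mul, ← Finset.sum_mul, ← Finset.sum_mul, ← Finset.sum_mul]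
            ring
    rw [h5, hform z hz, hform z hz, h3, h4, hc]
    have hε1 := hε0 z hz
    field_simp
    linear_combination -ε z * h2
  -- By `hX` this vector is h-orthogonal to every ζ, in particular to itself.
  have hdiff : gh + (-1 : ℂ) • ga + (-c) • η = 0 := by
    by_contra hne
    refine (hermitianForm_pos (hh.posDef z hz) hne).ne' ?_
    have h6 : hermitianForm h z gh (gh + (-1 : ℂ) • ga + (-c) • η) = pairing (metricDeriv h z η)
        (gh + (-1 : ℂ) • ga + (-c) • η) := hermitianForm_christoffel (hh.posDef z hz) η _
    rw [hX] at h6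
    rw [hermitianForm_add_left, hermitianForm_add_left, hermitianForm_smul_left,
      hermitianForm_smul_left, h6]
    ring
  have := congrFun hdiff i
  simp only [Pi.add_apply, Pi.smul_apply, smul_eq_mul, Pi.zero_apply] at this
  linear_combination this

end Berwald

/-! ### Regularity of navigation data and the trace of the new metric -/

section Navigation

variable {n : ℕ} {D : Set (Fin n → ℂ)} {a h : (Fin n → ℂ) → Matrix (Fin n) (Fin n) ℂ}
  {f : (Fin n → ℂ) → ℝ} {W : (Fin n → ℂ) → (Fin n → ℂ)} {z η : Fin n → ℂ}

/-- The components `b_i = W_i / ε̃` of the form `β`. -/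
noncomputable def newFormCoeff (h : (Fin n → ℂ) → Matrix (Fin n) (Fin n) ℂ) (f : (Fin n → ℂ) → ℝ)
    (W : (Fin n → ℂ) → (Fin n → ℂ)) (z : Fin n → ℂ) (i : Fin n) : ℂ :=
  lowerWind h W z i / (epsTilde h f W z : ℂ)

theorem hermitianForm_eq_sum_lowerWind (z η : Fin n → ℂ) :
    hermitianForm h z η (W z) = ∑ i, η i * lowerWind h W z i :=
  hermitianForm_eq_sum_mul h z η (W z)

namespace IsRandersNavigationData

theorem epsTilde_pos (hnav : IsRandersNavigationData D h f W) (hz : z ∈ D) :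
    0 < epsTilde h f W z :=
  sub_pos.2 (pow_lt_pow_left₀ (hnav.wind_lt_speed z hz) (hnav.wind_pos z hz).le two_ne_zero)

theorem epsTilde_ne_zero (hnav : IsRandersNavigationData D h f W) (hz : z ∈ D) :
    (epsTilde h f W z : ℂ) ≠ 0 :=
  Complex.ofReal_ne_zero.2 (hnav.epsTilde_pos hz).ne'

theorem wind_ne_zero (hnav : IsRandersNavigationData D h f W) (hz : z ∈ D) : W z ≠ 0 := by
  intro h0
  have := hnav.wind_pos z hz
  simp [h0, hermitianNorm] at this

theorem contDiffAt_epsTilde (hnav : IsRandersNavigationData D h f W) (hD : IsOpen D)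
    (hz : z ∈ D) : ContDiffAt ℝ ∞ (fun w => (epsTilde h f W w : ℂ)) z := by
  have hW : ContDiffAt ℝ ∞ W z := hnav.smooth_wind.contDiffAt (hD.mem_nhds hz)
  have hN : ContDiffAt ℝ ∞ (fun w => hermitianNorm h w (W w)) z :=
    (contDiffAt_hermitianNorm hnav.hermitian hD hz (hnav.wind_ne_zero hz)).comp
      (f := fun w => (w, W w)) z (contDiffAt_id.prodMk hW)
  exact Complex.ofRealCLM.contDiff.contDiffAt.comp z
    (((hnav.smooth_speed.contDiffAt (hD.mem_nhds hz)).pow 2).sub (hN.pow 2))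

theorem contDiffAt_div_epsTilde (hnav : IsRandersNavigationData D h f W) (hD : IsOpen D)
    (hz : z ∈ D) {g : (Fin n → ℂ) → ℂ} (hg : ContDiffAt ℝ ∞ g z) :
    ContDiffAt ℝ ∞ (fun w => g w / (epsTilde h f W w : ℂ)) z := by
  simp only [div_eq_mul_inv]
  exact hg.mul ((hnav.contDiffAt_epsTilde hD hz).inv (hnav.epsTilde_ne_zero hz))

theorem contDiffAt_newFormCoeff (hnav : IsRandersNavigationData D h f W) (hD : IsOpen D)
    (hz : z ∈ D) (i : Fin n) : ContDiffAt ℝ ∞ (fun w => newFormCoeff h f W w i) z := by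
  have hW (j : Fin n) : ContDiffAt ℝ ∞ (fun w => W w j) z :=
    contDiffAt_pi.1 (hnav.smooth_wind.contDiffAt (hD.mem_nhds hz)) j
  have hW' (j : Fin n) : ContDiffAt ℝ ∞ (fun w => star (W w j)) z :=
    ContDiffAt.comp (g := fun x : ℂ => star x) z
      (starL' (R := ℝ) (A := ℂ) : ℂ ≃L[ℝ] ℂ).contDiff.contDiffAt (hW j)
  have hl : ContDiffAt ℝ ∞ (fun w => lowerWind h W w i) z :=
    ContDiffAt.sum fun j _ => (hnav.hermitian.contDiffAt hD hz i j).mul (hW' j)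
  exact hnav.contDiffAt_div_epsTilde hD hz hl

theorem newFormCoeff_ne_zero (hnav : IsRandersNavigationData D h f W) (hz : z ∈ D) :
    newFormCoeff h f W z ≠ 0 := by
  intro h0
  refine (hermitianForm_pos (hnav.hermitian.posDef z hz) (hnav.wind_ne_zero hz)).ne' ?_
  rw [hermitianForm_eq_sum_lowerWind]
  refine Finset.sum_eq_zero fun i _ => ?_
  have := congrFun h0 i
  rw [newFormCoeff, Pi.zero_apply, div_eq_zero_iff] at this
  rw [this.resolve_right (hnav.epsTilde_ne_zero hz), mul_zero]

end IsRandersNavigationData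

theorem newMetric_apply (z : Fin n → ℂ) (i j : Fin n) :
    newMetric h f W z i j = h z i j / (epsTilde h f W z : ℂ) +
      newFormCoeff h f W z i * star (newFormCoeff h f W z j) := by
  simp only [newMetric, newFormCoeff, Matrix.of_apply, star_div₀, Complex.star_def,
    Complex.conj_ofReal]

namespace IsRandersNavigationData

theorem isHermitianMetric_newMetric (hnav : IsRandersNavigationData D h f W) (hD : IsOpen D) :
    IsHermitianMetric D (newMetric h f W) where
  smooth i j z hz := by
    have hb' : ContDiffAt ℝ ∞ (fun w => star (newFormCoeff h f W w j)) z :=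
      ContDiffAt.comp (g := fun x : ℂ => star x) z
        (starL' (R := ℝ) (A := ℂ) : ℂ ≃L[ℝ] ℂ).contDiff.contDiffAt
        (hnav.contDiffAt_newFormCoeff hD hz j)
    simp only [newMetric_apply]
    exact ((hnav.contDiffAt_div_epsTilde hD hz (hnav.hermitian.contDiffAt hD hz i j)).add
      ((hnav.contDiffAt_newFormCoeff hD hz i).mul hb')).contDiffWithinAt
  posDef z hz := by
    have hε : (0 : ℂ) < (epsTilde h f W z : ℂ)⁻¹ := by
      rw [← Complex.ofReal_inv]
      exact Complex.zero_lt_real.2 (inv_pos.2 (hnav.epsTilde_pos hz))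
    have heq : newMetric h f W z = (epsTilde h f W z : ℂ)⁻¹ • h z +
        Matrix.vecMulVec (newFormCoeff h f W z) (star (newFormCoeff h f W z)) := by
      ext i j
      rw [newMetric_apply, Matrix.add_apply, Matrix.smul_apply, Matrix.vecMulVec_apply,
        Pi.star_apply, smul_eq_mul, div_eq_inv_mul]
    rw [heq]
    exact ((hnav.hermitian.posDef z hz).smul hε).add_posSemidef
      (Matrix.posSemidef_vecMulVec_self_star _)

theorem eq_newMetric_sub (hnav : IsRandersNavigationData D h f W) (hz : z ∈ D) (i j : Fin n) :
    h z i j = (epsTilde h f W z : ℂ) * (newMetric h f W z i j -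
      newFormCoeff h f W z i * star (newFormCoeff h f W z j)) := by
  have := hnav.epsTilde_ne_zero hz
  rw [newMetric_apply]
  field_simp
  ring

/-- Raising the index of the lowered wind with h returns W̄, so the rank one part of a has trace
‖W‖² / ε̃². -/
theorem sum_inv_mul_newMetric (hnav : IsRandersNavigationData D h f W) (hz : z ∈ D) :
    ∑ m, ∑ j, (h z)⁻¹ m j * newMetric h f W z j m =
      n / (epsTilde h f W z : ℂ) +
        (hermitianNorm h z (W z) : ℂ) ^ 2 / (epsTilde h f W z : ℂ) ^ 2 := by
  have hp := hnav.hermitian.posDef z hz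
  have h1 : ∑ m, ∑ j, (h z)⁻¹ m j * h z j m = n := by
    rw [Finset.sum_comm]; exact sum_inv_mul_sum_swap hp.isUnit
  have h2 (m : Fin n) : ∑ j, (h z)⁻¹ m j * lowerWind h W z j = star (W z m) := by
    simp only [lowerWind, Finset.mul_sum]
    rw [Finset.sum_comm]
    calc _ = ∑ p, (∑ j, (h z)⁻¹ m j * h z j p) * star (W z p) := by
          refine Finset.sum_congr rfl fun p _ => ?_
          rw [Finset.sum_mul]
          exact Finset.sum_congr rfl fun j _ => by ring
      _ = _ := by simp [sum_inv_mul hp.isUnit]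
  have h3 : ∑ m, star (W z m) * star (lowerWind h W z m) =
      (hermitianNorm h z (W z) : ℂ) ^ 2 := by
    rw [← Complex.ofReal_pow, hermitianNorm_sq hp, ← hermitianForm_star hp.isHermitian,
      hermitianForm_eq_sum_lowerWind, star_sum]
    exact Finset.sum_congr rfl fun m _ => (star_mul' _ _).symm
  rw [← h1, ← h3, Finset.sum_div, Finset.sum_div, ← Finset.sum_add_distrib]
  refine Finset.sum_congr rfl fun m _ => ?_
  rw [← h2, Finset.sum_mul, Finset.sum_div, Finset.sum_div, ← Finset.sum_add_distrib]
  refine Finset.sum_congr rfl fun j _ => ?_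
  simp only [newMetric, Matrix.of_apply]
  ring

end IsRandersNavigationData
end Navigation

/-! ### Transport of projective relations -/

section Projective

variable {n : ℕ} {D : Set (Fin n → ℂ)} {a h : (Fin n → ℂ) → Matrix (Fin n) (Fin n) ℂ}
  {ψ : (Fin n → ℂ) → (Fin n → ℂ)} {z η : Fin n → ℂ}

/-- Projective equivalence of the sprays of two Kähler metrics. -/
theorem spray_eq_of_christoffel (ha : IsHermitianMetric D a) (hh : IsHermitianMetric D h)
    (hD : IsOpen D)
    (hrel : ∀ z ∈ D, ∀ η i, ∑ j, ∑ l, christoffel h z i j l * η l * η j =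
      ∑ j, ∑ l, christoffel a z i j l * η l * η j + oneForm ψ z η * η i) (hz : z ∈ D) (i : Fin n) :
    spray (hermitianNorm h) z η i = spray (hermitianNorm a) z η i + 1 / 2 * oneForm ψ z η * η i := by
  rw [spray_hermitianNorm hh hD hz, spray_hermitianNorm ha hD hz, hrel z hz]
  ring

theorem contDiffOn_oneForm (hψ : ∀ z ∈ D, ∀ i, ContDiffAt ℝ ∞ (fun w => ψ w i) z)
    (c : ℂ) : ContDiffOn ℝ ∞ (Function.uncurry fun z η => c * oneForm ψ z η) (slitBundle D) :=
  fun p hp => (contDiffAt_const.mul (contDiffAt_oneForm (η := p.2) (hψ p.1 hp.1))).contDiffWithinAt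

/-- Metrics whose sprays differ by a multiple of `η`, and whose forms `θ*` vanish, are projectively
related to the same metrics. -/
theorem IsProjectivelyRelated.trans_of_spray {F G H : (Fin n → ℂ) → (Fin n → ℂ) → ℝ}
    (hFG : IsProjectivelyRelated D F G) {P : (Fin n → ℂ) → (Fin n → ℂ) → ℂ}
    (hP : ContDiffOn ℝ ∞ (Function.uncurry P) (slitBundle D))
    (hG : ∀ z ∈ D, ∀ η i, thetaStar G z η i = 0) (hH : ∀ z ∈ D, ∀ η i, thetaStar H z η i = 0)
    (hGH : ∀ z ∈ D, ∀ η i, spray H z η i = spray G z η i + P z η * η i) :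
    IsProjectivelyRelated D F H := by
  obtain ⟨Q, hQ, hFG⟩ := hFG
  refine ⟨fun z η => Q z η + P z η, hQ.add hP, fun z hz η hη i => ?_⟩
  rw [hGH z hz, hFG z hz η hη, hG z hz, hH z hz]
  ring

theorem IsProjectivelyRelated.refl (F : (Fin n → ℂ) → (Fin n → ℂ) → ℝ) :
    IsProjectivelyRelated D F F :=
  ⟨fun _ _ => 0, contDiffOn_const, fun _ _ _ _ _ => by ring⟩

end Projective

/-! ### Consequences for the metrics h and a -/

section Main

variable {n : ℕ} {D : Set (Fin n → ℂ)} {h : (Fin n → ℂ) → Matrix (Fin n) (Fin n) ℂ}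
  {f : (Fin n → ℂ) → ℝ} {W : (Fin n → ℂ) → (Fin n → ℂ)} {z : Fin n → ℂ}

namespace IsRandersNavigationData

theorem christoffel_eq (hnav : IsRandersNavigationData D h f W) (hD : IsOpen D)
    (hF : IsGeneralizedBerwald D (randersSolution h f W)) (hn : 2 ≤ n) (hz : z ∈ D)
    (η : Fin n → ℂ) (i : Fin n) :
    ∑ j, ∑ l, christoffel h z i j l * η l * η j =
      ∑ j, ∑ l, christoffel (newMetric h f W) z i j l * η l * η j +
        (∑ j, dz (fun w => (epsTilde h f W w : ℂ)) j z * η j) / (epsTilde h f W z : ℂ) * η i :=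
  IsGeneralizedBerwald.christoffel_eq hn (hnav.isHermitianMetric_newMetric hD) hnav.hermitian hD
    (fun _ hw i => hnav.contDiffAt_newFormCoeff hD hw i) (fun _ hw => hnav.newFormCoeff_ne_zero hw)
    (fun _ hw => hnav.contDiffAt_epsTilde hD hw) (fun _ hw => hnav.epsTilde_ne_zero hw)
    (fun _ hw i j => hnav.eq_newMetric_sub hw i j) hF hz η i

/-- For n ≥ 2 the form is ∂ log ε̃. For n = 1 everything is a multiple of η and the form is the
difference of the single connection coefficients, with no use of the Berwald condition; n = 0 is
vacuous. -/
theorem exists_form (hnav : IsRandersNavigationData D h f W) (hD : IsOpen D)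
    (hF : IsGeneralizedBerwald D (randersSolution h f W)) :
    ∃ ψ : (Fin n → ℂ) → (Fin n → ℂ), (∀ z ∈ D, ∀ i, ContDiffAt ℝ ∞ (fun w => ψ w i) z) ∧
      ∀ z ∈ D, ∀ η i, ∑ j, ∑ l, christoffel h z i j l * η l * η j =
        ∑ j, ∑ l, christoffel (newMetric h f W) z i j l * η l * η j + oneForm ψ z η * η i := by
  rcases le_or_gt 2 n with hn | hn
  · refine ⟨fun z i => dz (fun w => (epsTilde h f W w : ℂ)) i z / (epsTilde h f W z : ℂ),
      fun z hz i => hnav.contDiffAt_div_epsTilde hD hz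
        (contDiffAt_dz (hnav.contDiffAt_epsTilde hD hz) i), fun z hz η i => ?_⟩
    rw [hnav.christoffel_eq hD hF hn hz, oneForm, Finset.sum_div]
    simp only [div_mul_eq_mul_div]
  · have hsub : Subsingleton (Fin n) := Fin.subsingleton_iff_le_one.2 (by omega)
    refine ⟨fun z i => christoffel h z i i i - christoffel (newMetric h f W) z i i i,
      fun z hz i => (hnav.hermitian.contDiffAt_christoffel hD hz i i i).sub
        ((hnav.isHermitianMetric_newMetric hD).contDiffAt_christoffel hD hz i i i),
      fun z hz η i => ?_⟩
    have := uniqueOfSubsingleton i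
    simp only [oneForm, Fintype.sum_unique, Subsingleton.elim (default : Fin n) i]
    ring

/-- The relation between the curvature factors of `h` and `a`. -/
theorem curvFactor_eq (hnav : IsRandersNavigationData D h f W) (hD : IsOpen D)
    (hF : IsGeneralizedBerwald D (randersSolution h f W)) (hn : 2 ≤ n)
    (hh : IsLocallyProjectivelyFlat D (hermitianNorm h))
    (ha : IsLocallyProjectivelyFlat D (hermitianNorm (newMetric h f W))) (hz : z ∈ D) :
    n * curvFactor h z = curvFactor (newMetric h f W) z *
        (n / (epsTilde h f W z : ℂ) +
          (hermitianNorm h z (W z) : ℂ) ^ 2 / (epsTilde h f W z : ℂ) ^ 2) -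
      1 / (2 * (epsTilde h f W z : ℂ)) * ∑ m, ∑ j, (h z)⁻¹ m j *
        (1 / (epsTilde h f W z : ℂ) * dzbar (fun w => (epsTilde h f W w : ℂ)) m z *
          dz (fun w => (epsTilde h f W w : ℂ)) j z -
        dzbar (fun x => dz (fun w => (epsTilde h f W w : ℂ)) j x) m z) := by
  have hha := hnav.isHermitianMetric_newMetric hD
  have hε := hnav.contDiffAt_epsTilde hD hz
  have hε0 := hnav.epsTilde_ne_zero hz
  have hq (k : (Fin n → ℂ) → Matrix (Fin n) (Fin n) ℂ) (w : Fin n → ℂ) (i : Fin n) :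
      ∑ j, ∑ l, christoffel k w i j l * (Pi.single i 1 : Fin n → ℂ) l *
        (Pi.single i 1 : Fin n → ℂ) j = christoffel k w i i i := by
    simp [Pi.single_apply]
  -- Evaluating at eᵢ suffices, since `projCurv` only sees the coefficients with three equal
  -- indices. Keeping ε̃ as a factor avoids differentiating a quotient below.
  have hΓ (i : Fin n) {w : Fin n → ℂ} (hw : w ∈ D) :
      (epsTilde h f W w : ℂ) * (christoffel h w i i i - christoffel (newMetric h f W) w i i i) =
        dz (fun w => (epsTilde h f W w : ℂ)) i w := by
    have h1 := hnav.christoffel_eq hD hF hn hw (Pi.single i 1) i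
    rw [hq, hq] at h1
    have := hnav.epsTilde_ne_zero hw
    rw [h1]
    simp only [Pi.single_apply, mul_ite, mul_one, mul_zero, Finset.sum_ite_eq', Finset.mem_univ,
      if_true]
    field_simp
    ring
  have hproj (j m : Fin n) : projCurv h z j m = projCurv (newMetric h f W) z j m -
      1 / (2 * (epsTilde h f W z : ℂ)) *
        (1 / (epsTilde h f W z : ℂ) * dzbar (fun w => (epsTilde h f W w : ℂ)) m z *
          dz (fun w => (epsTilde h f W w : ℂ)) j z -
        dzbar (fun x => dz (fun w => (epsTilde h f W w : ℂ)) j x) m z) := by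
    have hd1 : DifferentiableAt ℝ (fun w => christoffel h w j j j) z :=
      (hnav.hermitian.contDiffAt_christoffel hD hz j j j).differentiableAt (by simp)
    have hd2 : DifferentiableAt ℝ (fun w => christoffel (newMetric h f W) w j j j) z :=
      (hha.contDiffAt_christoffel hD hz j j j).differentiableAt (by simp)
    have hev : (fun w => (epsTilde h f W w : ℂ) *
        (christoffel h w j j j - christoffel (newMetric h f W) w j j j)) =ᶠ[𝓝 z]
        fun x => dz (fun w => (epsTilde h f W w : ℂ)) j x := by
      filter_upwards [hD.mem_nhds hz] with w hw using hΓ j hw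
    have h1 := dzbar_congr hev m
    rw [dzbar_mul (hε.differentiableAt (by simp)) (hd1.fun_sub hd2), dzbar_sub hd1 hd2] at h1
    rw [← h1, ← hΓ j hz, projCurv, projCurv]
    field_simp
    ring
  have htr : ∑ m, ∑ j, (h z)⁻¹ m j * h z j m = n := by
    rw [Finset.sum_comm]; exact sum_inv_mul_sum_swap (hnav.hermitian.posDef z hz).isUnit
  rw [← hnav.sum_inv_mul_newMetric hz, ← htr, Finset.sum_mul, Finset.mul_sum, Finset.mul_sum,
    ← Finset.sum_sub_distrib]
  refine Finset.sum_congr rfl fun m _ => ?_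
  rw [Finset.sum_mul, Finset.mul_sum, Finset.mul_sum, ← Finset.sum_sub_distrib]
  refine Finset.sum_congr rfl fun j _ => ?_
  have h2 := hproj j m
  rw [hh.projCurv_eq hnav.hermitian hD hz, ha.projCurv_eq hha hD hz] at h2
  linear_combination (h z)⁻¹ m j * h2

end IsRandersNavigationData
end Main

end ComplexFinsler

open ComplexFinsler
theorem corollary4p12 (n : ℕ) (D : Set (Fin n → ℂ)) (hD_open : IsOpen D) (hD_conn : IsConnected D)
    (h : (Fin n → ℂ) → Matrix (Fin n) (Fin n) ℂ) (f : (Fin n → ℂ) → ℝ)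
    (W : (Fin n → ℂ) → (Fin n → ℂ)) (hnav : IsRandersNavigationData D h f W)
    (hF : IsGeneralizedBerwald D (randersSolution h f W)) :
    ((IsKahler D (hermitianNorm h) ∧
        IsLocallyProjectivelyFlat D (hermitianNorm (newMetric h f W))) ↔
      (IsKahler D (hermitianNorm (newMetric h f W)) ∧
        IsLocallyProjectivelyFlat D (hermitianNorm h))) ∧
    (((IsKahler D (hermitianNorm h) ∧
        IsLocallyProjectivelyFlat D (hermitianNorm (newMetric h f W))) ∨
      (IsKahler D (hermitianNorm (newMetric h f W)) ∧
        IsLocallyProjectivelyFlat D (hermitianNorm h))) →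
      IsProjectivelyRelated D (hermitianNorm (newMetric h f W)) (hermitianNorm h) ∧
      (2 ≤ n → ∃ c₁ c₂ : ℝ,
        (∀ z ∈ D, ∀ η, η ≠ 0 → holCurvature (hermitianNorm h) z η = (c₁ : ℂ)) ∧
        (∀ z ∈ D, ∀ η, η ≠ 0 → holCurvature (hermitianNorm (newMetric h f W)) z η = (c₂ : ℂ)) ∧
        ∀ z ∈ D,
          (c₁ : ℂ) =
            ((n * epsTilde h f W z + hermitianNorm h z (W z) ^ 2) / (n * epsTilde h f W z ^ 2) : ℝ)
              * c₂ +
            2 / (n * (epsTilde h f W z : ℂ)) * ∑ m, ∑ j, (h z)⁻¹ m j *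
              (1 / (epsTilde h f W z : ℂ) *
                  dzbar (fun w => (epsTilde h f W w : ℂ)) m z *
                  dz (fun w => (epsTilde h f W w : ℂ)) j z -
                dzbar (fun x => dz (fun w => (epsTilde h f W w : ℂ)) j x) m z))) := by
  have hh := hnav.hermitian
  have ha := hnav.isHermitianMetric_newMetric hD_open
  obtain ⟨ψ, hψ, hrel⟩ := hnav.exists_form hD_open hF
  have hspray (z) (hz : z ∈ D) (η i) : spray (hermitianNorm h) z η i =
      spray (hermitianNorm (newMetric h f W)) z η i + 1 / 2 * oneForm ψ z η * η i :=
    spray_eq_of_christoffel ha hh hD_open hrel hz i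
  have hspray' (z) (hz : z ∈ D) (η i) : spray (hermitianNorm (newMetric h f W)) z η i =
      spray (hermitianNorm h) z η i + -(1 / 2) * oneForm ψ z η * η i := by
    rw [hspray z hz]; ring
  -- With both θ* zero, the same Minkowski metric serves for h and a: only the factor P changes, by
  -- ±½ψ.
  have hflat : IsKahler D (hermitianNorm h) → IsKahler D (hermitianNorm (newMetric h f W)) →
      (IsLocallyProjectivelyFlat D (hermitianNorm h) ↔
        IsLocallyProjectivelyFlat D (hermitianNorm (newMetric h f W))) := fun hKh hKa =>
    have hθh (z) (hz : z ∈ D) := thetaStar_of_isKahler hh hD_open hKh hz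
    have hθa (z) (hz : z ∈ D) := thetaStar_of_isKahler ha hD_open hKa hz
    ⟨fun ⟨F', hF', hP⟩ => ⟨F', hF', hP.trans_of_spray (contDiffOn_oneForm hψ _) hθh hθa
      hspray'⟩, fun ⟨F', hF', hP⟩ => ⟨F', hF', hP.trans_of_spray
      (contDiffOn_oneForm hψ _) hθa hθh hspray⟩⟩
  have hiff : (IsKahler D (hermitianNorm h) ∧
        IsLocallyProjectivelyFlat D (hermitianNorm (newMetric h f W))) ↔
      (IsKahler D (hermitianNorm (newMetric h f W)) ∧
        IsLocallyProjectivelyFlat D (hermitianNorm h)) := by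
    constructor
    · rintro ⟨hKh, hfa⟩
      have hKa := hfa.isKahler ha hD_open
      exact ⟨hKa, (hflat hKh hKa).2 hfa⟩
    · rintro ⟨hKa, hfh⟩
      have hKh := hfh.isKahler hh hD_open
      exact ⟨hKh, (hflat hKh hKa).1 hfh⟩
  refine ⟨hiff, fun hor => ?_⟩
  obtain ⟨hKh, hfa⟩ : IsKahler D (hermitianNorm h) ∧
      IsLocallyProjectivelyFlat D (hermitianNorm (newMetric h f W)) := hor.elim id hiff.2
  have ⟨hKa, hfh⟩ := hiff.1 ⟨hKh, hfa⟩
  refine ⟨(IsProjectivelyRelated.refl _).trans_of_spray (contDiffOn_oneForm hψ _)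
    (fun z hz => thetaStar_of_isKahler ha hD_open hKa hz)
    (fun z hz => thetaStar_of_isKahler hh hD_open hKh hz) hspray, fun hn => ?_⟩
  -- Both metrics are now locally projectively flat, so Schur's lemma applies to each; the curvature
  -- constants are -4κ₁ and -4κ₂.
  obtain ⟨κ₁, h₁⟩ := hfh.exists_curvFactor_eq hh hD_open hD_conn hn
  obtain ⟨κ₂, h₂⟩ := hfa.exists_curvFactor_eq ha hD_open hD_conn hn
  refine ⟨-4 * κ₁, -4 * κ₂, fun z hz η hη => ?_, fun z hz η hη => ?_, fun z hz => ?_⟩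
  · rw [hfh.holCurvature_eq hh hD_open hz hη, h₁ z hz]; push_cast; rfl
  · rw [hfa.holCurvature_eq ha hD_open hz hη, h₂ z hz]; push_cast; rfl
  · have hmain := hnav.curvFactor_eq hD_open hF hn hfh hfa hz
    have hn0 : (n : ℂ) ≠ 0 := Nat.cast_ne_zero.2 (by omega)
    have hε0 := hnav.epsTilde_ne_zero hz
    rw [h₁ z hz, h₂ z hz] at hmain
    generalize ∑ m, ∑ j, (h z)⁻¹ m j * (_ : ℂ) = S at hmain ⊢
    push_cast
    field_simp at hmain ⊢
    linear_combination -2 * hmain
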